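/- A \emph{lattice polygon} is a two-dimensional convex polygon $P\subset\mathbb{R}^2$ whose vertices lie in $\mathbb{Z}^2$. Its \emph{genus} is the number of lattice points in its interior, and $P$ is \emph{hyperelliptic} if all its interior lattice points are collinear. Let $P$ be a lattice polygon of genus at least $2$. A unimodular triangulation $\mathcal{T}$ of $P$ (a subdivision into lattice triangles of area $1/2$) is \emph{regular} if it is induced by a height function $\omega\colon P\cap\mathbb{Z}^2\to\mathbb{R}$, i.e. if it is the projection of the lower convex hull of the graph of $\omega$. In that case it is dual to the smooth tropical plane curve defined by $\min_{(i,j)\in P\cap\mathbb{Z}^2}(\omega(i,j)+ix+jy)$, whose vertices correspond to the triangles of $\mathcal{T}$ and whose bounded edges correspond to the pairs of triangles that share a side; bounded edges are measured by lattice length. The \emph{skeleton} of the curve is the metric graph obtained by removing the unbounded rays, repeatedly deleting leaves, and then smoothing over all vertices of degree $2$, adding up the lengths of concatenated edges; its combinatorial type depends only on $\mathcal{T}$. Let $\mathbb{M}_{\mathcal{T}}$ be the closure, in the space of edge lengths of this skeleton, of the set of all metric graphs that arise as the skeleton of a smooth tropical plane curve dual to $\mathcal{T}$; it is a polyhedral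 cone. Let $\mathbb{M}_P=\bigcup_{\mathcal{T}}\mathbb{M}_{\mathcal{T}}$, the union over all regular unimodular triangulations of $P$, so that $\dim(\mathbb{M}_P)=\max_{\mathcal{T}}\dim(\mathbb{M}_{\mathcal{T}})$. \textbf{Theorem.} Let $g\geq 2$ and $d\geq 0$ be integers. There exists a hyperelliptic lattice polygon $P$ of genus $g$ with $\dim(\mathbb{M}_P)=d$ if and only if \[g\leq d\leq 2g-1.\] -/

import Mathlib

namespace TropicalModuli

/-! ### Lattice polygons -/

/-- The inclusion of the lattice `ℤ²` into the plane. -/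
def toPlane (p : ℤ × ℤ) : ℝ × ℝ := ((p.1 : ℝ), (p.2 : ℝ))

/-- A two-dimensional convex lattice polygon: the convex hull of finitely many lattice points,
with nonempty interior. -/
structure IsLatticePolygon (P : Set (ℝ × ℝ)) : Prop where
  eq_convexHull : ∃ S : Finset (ℤ × ℤ), P = convexHull ℝ (toPlane '' (S : Set (ℤ × ℤ)))
  interior_nonempty : (interior P).Nonempty

/-- The lattice points `P ∩ ℤ²`. -/
def latticePoints (P : Set (ℝ × ℝ)) : Set (ℤ × ℤ) := {p | toPlane p ∈ P}

/-- The lattice points in the interior of `P`. -/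
def interiorLatticePoints (P : Set (ℝ × ℝ)) : Set (ℤ × ℤ) := {p | toPlane p ∈ interior P}

/-- The genus of `P` is the number of its interior lattice points. -/
noncomputable def genus (P : Set (ℝ × ℝ)) : ℕ := (interiorLatticePoints P).ncard

/-- `P` is hyperelliptic if all its interior lattice points are collinear. -/
def IsHyperelliptic (P : Set (ℝ × ℝ)) : Prop :=
  Collinear ℝ (toPlane '' interiorLatticePoints P)

/-! ### Unimodular triangulations -/

/-- The convex hull in the plane of a set of lattice points of `P`. -/
def hull {P : Set (ℝ × ℝ)} (s : Set (latticePoints P)) : Set (ℝ × ℝ) :=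
  convexHull ℝ ((fun p : latticePoints P => toPlane p.1) '' s)

/-- Twice the signed area of the lattice triangle `pqr`. -/
def doubleArea (p q r : ℤ × ℤ) : ℤ :=
  (q.1 - p.1) * (r.2 - p.2) - (q.2 - p.2) * (r.1 - p.1)

/-- `t` is the vertex set of a lattice triangle of area `1/2`. -/
def IsUnimodularTriangle {P : Set (ℝ × ℝ)} (t : Finset (latticePoints P)) : Prop :=
  ∃ p q r : latticePoints P,
    (t : Set (latticePoints P)) = {p, q, r} ∧ |doubleArea p.1 q.1 r.1| = 1

/-- `T`, a finite set of triangles given by their vertex sets, is a unimodular triangulation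
of `P`. -/
structure IsUnimodularTriangulation (P : Set (ℝ × ℝ))
    (T : Finset (Finset (latticePoints P))) : Prop where
  unimodular : ∀ t ∈ T, IsUnimodularTriangle t
  cover : (⋃ t ∈ T, hull (t : Set (latticePoints P))) = P
  face_to_face : ∀ t ∈ T, ∀ t' ∈ T,
    hull (t : Set (latticePoints P)) ∩ hull (t' : Set (latticePoints P)) =
      hull ((t : Set (latticePoints P)) ∩ (t' : Set (latticePoints P)))

/-! ### Tropical polynomials and dual tropical curves -/

/-- The value `ω(i,j) + i x + j y` at `u = (x, y)` of the monomial with exponent `p = (i, j)` in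
the tropical (min-plus) polynomial with coefficients `ω`. -/
def monomialValue {P : Set (ℝ × ℝ)} (ω : latticePoints P → ℝ) (p : latticePoints P)
    (u : ℝ × ℝ) : ℝ :=
  ω p + (p.1.1 : ℝ) * u.1 + (p.1.2 : ℝ) * u.2

/-- At the point `u`, the minimum of the tropical polynomial with coefficients `ω` is attained
exactly at the monomials in `t`. For a triangle `t` this says that the part of the graph of `ω`
over `t` spans a facet of the lower convex hull which contains no other lifted lattice point, and
that `u` is the vertex dual to `t` of the tropical curve. -/
def IsDualVertex {P : Set (ℝ × ℝ)} (ω : latticePoints P → ℝ) (t : Finset (latticePoints P))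
    (u : ℝ × ℝ) : Prop :=
  ∃ m : ℝ, (∀ p ∈ t, monomialValue ω p u = m) ∧ ∀ p ∉ t, m < monomialValue ω p u

/-- The height function `ω` induces the triangulation `T`: every triangle of `T` comes from a
facet of the lower convex hull of the graph of `ω`. (As `T` covers `P`, these are all of them.) -/
def Induces {P : Set (ℝ × ℝ)} (ω : latticePoints P → ℝ)
    (T : Finset (Finset (latticePoints P))) : Prop :=
  ∀ t ∈ T, ∃ u : ℝ × ℝ, IsDualVertex ω t u

/-- Regular unimodular triangulations of `P`. -/
def IsRegularUnimodularTriangulation (P : Set (ℝ × ℝ))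
    (T : Finset (Finset (latticePoints P))) : Prop :=
  IsUnimodularTriangulation P T ∧ ∃ ω : latticePoints P → ℝ, Induces ω T

/-- The segment from `u` to `v` has rational slope and lattice length `l`: it is `l` times a
primitive lattice vector. -/
def IsLatticeLength (u v : ℝ × ℝ) (l : ℝ) : Prop :=
  0 ≤ l ∧ ∃ w : ℤ × ℤ, IsCoprime w.1 w.2 ∧ v - u = l • toPlane w

/-- The graph formed by the vertices and the bounded edges of a tropical curve dual to `T`: its
vertices are the triangles of `T`, and two of them are joined if the triangles share a side. -/
def dualGraph {P : Set (ℝ × ℝ)} (T : Finset (Finset (latticePoints P))) : SimpleGraph T where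
  Adj t t' := t ≠ t' ∧
    ((t.1 : Set (latticePoints P)) ∩ (t'.1 : Set (latticePoints P))).ncard = 2
  symm := ⟨fun _ _ h => ⟨h.1.symm, by rw [Set.inter_comm]; exact h.2⟩⟩
  loopless := ⟨fun _ h => h.1 rfl⟩

/-- The lattice lengths of the bounded edges of the smooth tropical curves dual to `T`. -/
def curveEdgeLengths {P : Set (ℝ × ℝ)} (T : Finset (Finset (latticePoints P))) :
    Set ((dualGraph T).edgeSet → ℝ) :=
  {x | ∃ (ω : latticePoints P → ℝ) (u : T → ℝ × ℝ),
    (∀ t : T, IsDualVertex ω t.1 (u t)) ∧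
      ∀ (t t' : T) (h : (dualGraph T).Adj t t'), IsLatticeLength (u t) (u t') (x ⟨s(t, t'), h⟩)}

/-! ### Skeletons -/

/-- The vertices of a graph that get removed when vertices with at most one remaining neighbour
are deleted repeatedly: `v` can be removed as soon as all its neighbours but at most one (`w`)
have been. -/
inductive Pruned {V : Type*} (G : SimpleGraph V) : V → Prop
  | prune (v w : V) (h : ∀ a, G.Adj v a → a ≠ w → Pruned G a) : Pruned G v

/-- What is left of a graph after the repeated deletion of leaves. -/
def core {V : Type*} (G : SimpleGraph V) : SimpleGraph V where
  Adj v w := G.Adj v w ∧ ¬ Pruned G v ∧ ¬ Pruned G w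
  symm := ⟨fun _ _ h => ⟨h.1.symm, h.2.2, h.2.1⟩⟩
  loopless := ⟨fun _ h => h.1.ne rfl⟩

theorem core_le {V : Type*} (G : SimpleGraph V) : core G ≤ G := fun _ _ h => h.1

/-- Two edges of the core meet at a vertex of degree two, and so are concatenated when that
vertex is smoothed over. -/
def Concatenated {V : Type*} (G : SimpleGraph V) (e f : (core G).edgeSet) : Prop :=
  ∃ v : V, v ∈ e.1 ∧ v ∈ f.1 ∧ ((core G).neighborSet v).ncard = 2

/-- The edges of the skeleton of `G`: the classes of edges of the core under the equivalence
relation generated by concatenation. -/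
def SkeletonEdge {V : Type*} (G : SimpleGraph V) : Type _ := Quot (Concatenated G)

/-- The linear map `κ` from edge lengths on `G` to edge lengths on its skeleton: forget the edges
outside the core and add up the lengths of concatenated edges. -/
noncomputable def skeletonLengths {V : Type*} (G : SimpleGraph V) (x : G.edgeSet → ℝ) :
    SkeletonEdge G → ℝ :=
  fun s => ∑ᶠ (e : (core G).edgeSet) (_ : Quot.mk (Concatenated G) e = s),
    x ⟨e.1, SimpleGraph.edgeSet_mono (core_le G) e.2⟩

/-! ### Moduli spaces -/

/-- The cone `𝕄_T`: the closure of the set of all metric graphs that arise as the skeleton of a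
smooth tropical curve dual to `T`, in the space of edge lengths of the skeleton (whose
combinatorial type depends on `T` only). -/
def moduliCone {P : Set (ℝ × ℝ)} (T : Finset (Finset (latticePoints P))) :
    Set (SkeletonEdge (dualGraph T) → ℝ) :=
  closure (skeletonLengths (dualGraph T) '' curveEdgeLengths T)

/-- The dimension of the cone `𝕄_T`, that is, of its linear span. -/
noncomputable def coneDim {P : Set (ℝ × ℝ)} (T : Finset (Finset (latticePoints P))) : ℕ :=
  Module.finrank ℝ (Submodule.span ℝ (moduliCone T))

/-- `dim 𝕄_P = d`. As `𝕄_P` is the finite union of the cones `𝕄_T` over all regular unimodular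
triangulations `T` of `P`, its dimension is the maximum of theirs. -/
def HasModuliDim (P : Set (ℝ × ℝ)) (d : ℕ) : Prop :=
  IsGreatest {n : ℕ | ∃ T : Finset (Finset (latticePoints P)),
    IsRegularUnimodularTriangulation P T ∧ coneDim T = n} d

end TropicalModuli

namespace TropicalModuli

open Filter Topology

/-! ### Convex combinations of lattice points -/

section Weights

variable {P : Set (ℝ × ℝ)}

/-! For a pair of triangles `abc`, `abd` with c + d = (2 - β) a + β b, the dual edge of the curve
has lattice length ω(c) + ω(d) - (2 - β) ω(a) - β ω(b). Lengths on the skeleton are therefore linear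
in ω (`skeletonMap`). The heights inducing T absorb small perturbations, hence span the whole space,
so the dimension of the cone is the rank of this linear map (`coneDim_eq_finrank_range`).

Bounds. An affine unimodular change of coordinates moves the interior lattice points to (1,0), …,
(g,0). Two adjacent interior points force P into the strip -1 ≤ y ≤ 1, and convexity confines its
part of the axis to [0, g+1] (`Adapted.strip`). The triangles that survive pruning are exactly those
containing an interior lattice point (`not_pruned_iff`), and the skeleton is a chain of g cycles,
one around each of these points. Along an arc of the cycle around p the edge lengths telescope
(`exists_arc`), leaving the two ends, which are the same for the upper and the lower arc
(`LeftValue.capValue_eq`). So one length belongs to each cycle, and one to each of the g - 1 gaps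
between consecutive cycles: the rank is at most 2g - 1 (`Strip.coneDim_le`). For the lower bound,
let ω be supported on the interior lattice points. The cycle lengths then form a tridiagonal system,
weakly diagonally dominant with slack at both ends; a discrete maximum principle makes it injective
(`eq_zero_of_skeletonMap`), so the rank is at least g (`Strip.le_coneDim`).

Existence. For 0 ≤ m < g the `quadrilateral` has genus g and g + m + 3 lattice points. Affine
heights always lie in the kernel, so every cone has dimension at most g + m. For the triangulation
induced by explicit convex heights, the relations of zero length leave only a three-dimensional
kernel (`finrank_ker_quadrilateral_le`), so g + m is attained. -/

theorem toPlane_injective : Function.Injective toPlane := by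
  intro p q h
  simp only [toPlane, Prod.mk.injEq, Int.cast_inj] at h
  exact Prod.ext h.1 h.2

/-- Convex weights `w` on the lattice points of `P`, supported on `s`. -/
structure IsWeight [Fintype (latticePoints P)] (s : Set (latticePoints P))
    (w : latticePoints P → ℝ) : Prop where
  nonneg : ∀ p, 0 ≤ w p
  supp : ∀ p, p ∉ s → w p = 0
  sum_eq : ∑ p, w p = 1

/-- Weights live on all lattice points of P, with a support condition, so that combinations taken in
different triangles can be compared as functions. -/
theorem mem_hull_iff [Fintype (latticePoints P)] {s : Set (latticePoints P)} {z : ℝ × ℝ} :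
    z ∈ hull s ↔ ∃ w, IsWeight s w ∧ ∑ p, w p • toPlane p.1 = z := by
  classical
  constructor
  · intro hz
    have : hull s ⊆ {z | ∃ w, IsWeight s w ∧ ∑ p, w p • toPlane p.1 = z} := by
      refine convexHull_min ?_ ?_
      · rintro _ ⟨p, hp, rfl⟩
        refine ⟨Pi.single p 1, ⟨fun q => ?_, fun q hq => ?_, by simp⟩, ?_⟩
        · by_cases h : q = p
          · subst h; simp
          · simp [h]
        · rw [Pi.single_eq_of_ne]
          rintro rfl
          exact hq hp
        · rw [Finset.sum_eq_single p]
          · simp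
          · intro q _ hq
            simp [hq]
          · simp
      · rintro x ⟨w, hw, rfl⟩ y ⟨w', hw', rfl⟩ a b ha hb hab
        refine ⟨fun p => a * w p + b * w' p, ⟨fun p => ?_, fun p hp => ?_, ?_⟩, ?_⟩
        · have := hw.nonneg p
          have := hw'.nonneg p
          positivity
        · simp [hw.supp p hp, hw'.supp p hp]
        · rw [Finset.sum_add_distrib, ← Finset.mul_sum, ← Finset.mul_sum, hw.sum_eq, hw'.sum_eq]
          simpa using hab
        · simp only [add_smul, mul_smul, Finset.sum_add_distrib, Finset.smul_sum]
    exact this hz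
  · rintro ⟨w, hw, rfl⟩
    have h1 : ∑ p, w p • toPlane p.1 =
        ∑ p ∈ Finset.univ.filter (fun p => p ∈ s), w p • toPlane p.1 := by
      rw [Finset.sum_filter_of_ne]
      intro p _ hp
      by_contra h
      exact hp (by rw [hw.supp p h, zero_smul])
    have h2 : ∑ p ∈ Finset.univ.filter (fun p => p ∈ s), w p = 1 := by
      rw [← hw.sum_eq, Finset.sum_filter_of_ne]
      intro p _ hp
      by_contra h
      exact hp (hw.supp p h)
    rw [h1]
    refine (convex_convexHull ℝ _).sum_mem (fun p _ => hw.nonneg p) h2 fun p hp => ?_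
    exact subset_convexHull ℝ _ ⟨p, (Finset.mem_filter.1 hp).2, rfl⟩

theorem sum_three [Fintype (latticePoints P)] {M : Type*} [AddCommMonoid M]
    {a b c : latticePoints P} (hab : a ≠ b) (hac : a ≠ c) (hbc : b ≠ c)
    {f : latticePoints P → M} (hf : ∀ p, p ≠ a → p ≠ b → p ≠ c → f p = 0) :
    ∑ p, f p = f a + f b + f c := by
  classical
  rw [← Finset.sum_subset (Finset.subset_univ {a, b, c})]
  · rw [Finset.sum_insert (by simp [hab, hac]), Finset.sum_insert (by simp [hbc]),
      Finset.sum_singleton, add_assoc]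
  · intro p _ hp
    simp only [Finset.mem_insert, Finset.mem_singleton, not_or] at hp
    exact hf p hp.1 hp.2.1 hp.2.2

theorem ne_of_doubleArea {a b c : ℤ × ℤ} (h : |doubleArea a b c| = 1) :
    a ≠ b ∧ a ≠ c ∧ b ≠ c := by
  refine ⟨?_, ?_, ?_⟩ <;> rintro rfl <;> simp [doubleArea, mul_comm] at h

theorem doubleArea_ne_of_abs {a b c : ℤ × ℤ} (h : |doubleArea a b c| = 1) :
    (doubleArea a b c : ℝ) ≠ 0 := by
  intro h0
  rw [Int.cast_eq_zero] at h0
  simp [h0] at h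

/-- Barycentric coordinates with respect to a nondegenerate triangle are unique. -/
theorem bary_eq {a b c : ℤ × ℤ} (h : (doubleArea a b c : ℝ) ≠ 0) {x y z : ℝ}
    (h0 : x + y + z = 0)
    (h1 : x * a.1 + y * b.1 + z * c.1 = 0) (h2 : x * a.2 + y * b.2 + z * c.2 = 0) :
    x = 0 ∧ y = 0 ∧ z = 0 := by
  simp only [doubleArea] at h
  push_cast at h
  refine ⟨?_, ?_, ?_⟩ <;> refine (mul_eq_zero.1 ?_).resolve_right h
  -- Cramer's rule: the coefficients are cofactors of the matrix with columns (1, a), (1, b), (1,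
  -- c).
  · linear_combination (b.1 * c.2 - b.2 * c.1 : ℝ) * h0 + (b.2 - c.2 : ℝ) * h1
      + (c.1 - b.1 : ℝ) * h2
  · linear_combination (c.1 * a.2 - c.2 * a.1 : ℝ) * h0 + (c.2 - a.2 : ℝ) * h1
      + (a.1 - c.1 : ℝ) * h2
  · linear_combination (a.1 * b.2 - a.2 * b.1 : ℝ) * h0 + (a.2 - b.2 : ℝ) * h1
      + (b.1 - a.1 : ℝ) * h2

theorem IsWeight.eq_of_triangle [Fintype (latticePoints P)] {t : Finset (latticePoints P)}
    (ht : IsUnimodularTriangle t) {w w' : latticePoints P → ℝ}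
    (hw : IsWeight (t : Set (latticePoints P)) w) (hw' : IsWeight (t : Set (latticePoints P)) w')
    (h : ∑ p, w p • toPlane p.1 = ∑ p, w' p • toPlane p.1) : w = w' := by
  obtain ⟨a, b, c, ht, hD⟩ := ht
  have hne := ne_of_doubleArea hD
  have hab : a ≠ b := fun h => hne.1 (by rw [h])
  have hac : a ≠ c := fun h => hne.2.1 (by rw [h])
  have hbc : b ≠ c := fun h => hne.2.2 (by rw [h])
  have hz : ∀ p, p ≠ a → p ≠ b → p ≠ c → p ∉ (t : Set (latticePoints P)) := by
    intro p ha hb hc hp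
    rw [ht] at hp
    simp [ha, hb, hc] at hp
  have hs := hw.sum_eq
  have hs' := hw'.sum_eq
  rw [sum_three hab hac hbc (fun p ha hb hc => by rw [hw.supp p (hz p ha hb hc), zero_smul]),
    sum_three hab hac hbc (fun p ha hb hc => by rw [hw'.supp p (hz p ha hb hc), zero_smul])] at h
  rw [sum_three hab hac hbc (fun p ha hb hc => hw.supp p (hz p ha hb hc))] at hs
  rw [sum_three hab hac hbc (fun p ha hb hc => hw'.supp p (hz p ha hb hc))] at hs'
  simp only [toPlane, Prod.smul_mk, smul_eq_mul, Prod.mk_add_mk, Prod.mk.injEq] at h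
  obtain ⟨h1, h2, h3⟩ := bary_eq (doubleArea_ne_of_abs hD)
    (x := w a - w' a) (y := w b - w' b) (z := w c - w' c)
    (by linarith) (by linarith [h.1]) (by linarith [h.2])
  funext p
  by_cases ha : p = a
  · subst ha; linarith
  by_cases hb : p = b
  · subst hb; linarith
  by_cases hc : p = c
  · subst hc; linarith
  rw [hw.supp p (hz p ha hb hc), hw'.supp p (hz p ha hb hc)]

variable {T : Finset (Finset (latticePoints P))}

/-- Two convex combinations of the vertices of triangles of a triangulation which give the same
point are the same. -/
theorem IsUnimodularTriangulation.weight_unique [Fintype (latticePoints P)]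
    (hT : IsUnimodularTriangulation P T)
    {t t' : Finset (latticePoints P)} (ht : t ∈ T) (ht' : t' ∈ T)
    {w w' : latticePoints P → ℝ}
    (hw : IsWeight (t : Set (latticePoints P)) w) (hw' : IsWeight (t' : Set (latticePoints P)) w')
    (h : ∑ p, w p • toPlane p.1 = ∑ p, w' p • toPlane p.1) : w = w' := by
  have hz : ∑ p, w p • toPlane p.1 ∈
      hull (t : Set (latticePoints P)) ∩ hull (t' : Set (latticePoints P)) :=
    ⟨mem_hull_iff.2 ⟨w, hw, rfl⟩, mem_hull_iff.2 ⟨w', hw', h.symm⟩⟩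
  -- The common point has a weight supported on `t ∩ t'`; uniqueness inside each triangle identifies
  -- both `w` and `w'` with it.
  rw [hT.face_to_face t ht t' ht'] at hz
  obtain ⟨v, hv, hvz⟩ := mem_hull_iff.1 hz
  have e1 := IsWeight.eq_of_triangle (hT.unimodular t ht) hw
    ⟨hv.nonneg, fun p hp => hv.supp p fun h => hp h.1, hv.sum_eq⟩ hvz.symm
  have e2 := IsWeight.eq_of_triangle (hT.unimodular t' ht') hw'
    ⟨hv.nonneg, fun p hp => hv.supp p fun h => hp h.2, hv.sum_eq⟩ (h.symm.trans hvz.symm)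
  rw [e1, e2]

/-- Two segments between vertices of triangles that meet in their relative interiors have the
same ends. -/
theorem IsUnimodularTriangulation.segments_eq [Fintype (latticePoints P)]
    (hT : IsUnimodularTriangulation P T)
    {t t' : Finset (latticePoints P)} (ht : t ∈ T) (ht' : t' ∈ T)
    {a b c d : latticePoints P} (ha : a ∈ t) (hb : b ∈ t) (hc : c ∈ t') (hd : d ∈ t')
    {α β γ δ : ℤ} (hα : 0 < α) (hβ : 0 < β) (hγ : 0 < γ) (hδ : 0 < δ) (hs : α + β = γ + δ)
    (h1 : α * a.1.1 + β * b.1.1 = γ * c.1.1 + δ * d.1.1)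
    (h2 : α * a.1.2 + β * b.1.2 = γ * c.1.2 + δ * d.1.2) :
    (a = c ∨ a = d) ∧ (b = c ∨ b = d) := by
  classical
  have key : ∀ (t : Finset (latticePoints P)) (a b : latticePoints P), a ∈ t → b ∈ t →
      ∀ α β : ℝ, 0 < α → 0 < β → α + β = 1 →
      IsWeight (t : Set (latticePoints P)) (Pi.single a α + Pi.single b β) ∧
      ∑ p, (Pi.single a α + Pi.single b β : latticePoints P → ℝ) p • toPlane p.1 =
        α • toPlane a.1 + β • toPlane b.1 := by
    intro t a b ha hb α β hα hβ hs
    refine ⟨⟨fun p => ?_, fun p hp => ?_, ?_⟩, ?_⟩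
    · simp only [Pi.add_apply, Pi.single_apply]
      split_ifs <;> linarith
    · have h1 : p ≠ a := fun h => hp (h ▸ ha)
      have h2 : p ≠ b := fun h => hp (h ▸ hb)
      simp [h1, h2]
    · simp [Finset.sum_add_distrib, hs]
    · simp [add_smul, Finset.sum_add_distrib, Pi.single_apply, ite_smul]
  have hN : (0 : ℝ) < (α + β : ℤ) := by exact_mod_cast add_pos hα hβ
  have hN' : ((α + β : ℤ) : ℝ) = ((γ + δ : ℤ) : ℝ) := by rw [hs]
  have hα' : (0 : ℝ) < α := by exact_mod_cast hα
  have hβ' : (0 : ℝ) < β := by exact_mod_cast hβ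
  have hγ' : (0 : ℝ) < γ := by exact_mod_cast hγ
  have hδ' : (0 : ℝ) < δ := by exact_mod_cast hδ
  set N : ℝ := ((α + β : ℤ) : ℝ) with hNdef
  have hsum : (α : ℝ) + β = N := by rw [hNdef]; push_cast; ring
  have hsum' : (γ : ℝ) + δ = N := by rw [hN']; push_cast; ring
  obtain ⟨k1, k2⟩ := key t a b ha hb (α / N) (β / N) (by positivity) (by positivity)
    (by rw [← add_div, hsum, div_self hN.ne'])
  obtain ⟨k3, k4⟩ := key t' c d hc hd (γ / N) (δ / N) (by positivity) (by positivity)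
    (by rw [← add_div, hsum', div_self hN.ne'])
  have h1' : (α : ℝ) * a.1.1 + β * b.1.1 = γ * c.1.1 + δ * d.1.1 := by exact_mod_cast h1
  have h2' : (α : ℝ) * a.1.2 + β * b.1.2 = γ * c.1.2 + δ * d.1.2 := by exact_mod_cast h2
  have heq := hT.weight_unique ht ht' k1 k3 (by
    rw [k2, k4]
    simp only [toPlane, Prod.smul_mk, smul_eq_mul, Prod.mk_add_mk, Prod.mk.injEq]
    constructor
    · field_simp
      linarith
    · field_simp
      linarith)
  -- The two weights of the crossing point agree, so the points of positive weight on the first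
  -- segment are ends of the second.
  have pos : ∀ p, p = a ∨ p = b →
      0 < (Pi.single a (α / N) + Pi.single b (β / N) : latticePoints P → ℝ) p := by
    have p1 : 0 < α / N := by positivity
    have p2 : 0 < β / N := by positivity
    rintro p (rfl | rfl) <;> simp only [Pi.add_apply, Pi.single_apply] <;> split_ifs <;>
      linarith
  have mem : ∀ p, p = a ∨ p = b → p = c ∨ p = d := by
    intro p hp
    by_contra hcon
    rw [not_or] at hcon
    have := pos p hp
    rw [heq] at this
    simp [hcon.1, hcon.2] at this
  exact ⟨mem a (Or.inl rfl), mem b (Or.inr rfl)⟩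

end Weights

/-! ### Triangles -/

section Triangles

variable {P : Set (ℝ × ℝ)} {T : Finset (Finset (latticePoints P))}

theorem IsUnimodularTriangle.exists_of_mem {t : Finset (latticePoints P)}
    (ht : IsUnimodularTriangle t) {a : latticePoints P} (ha : a ∈ t) :
    ∃ b c, t = {a, b, c} ∧ |doubleArea a.1 b.1 c.1| = 1 := by
  obtain ⟨p, q, r, ht, hD⟩ := ht
  have ht' : t = {p, q, r} := by
    ext x
    rw [← Finset.mem_coe, ht]
    simp
  rw [ht'] at ha
  simp only [Finset.mem_insert, Finset.mem_singleton] at ha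
  rcases ha with rfl | rfl | rfl
  · exact ⟨q, r, ht', hD⟩
  · refine ⟨r, p, ?_, ?_⟩
    · rw [ht']; ext x; simp only [Finset.mem_insert, Finset.mem_singleton]; tauto
    · rw [← hD]; simp only [doubleArea]; ring_nf
  · refine ⟨p, q, ?_, ?_⟩
    · rw [ht']; ext x; simp only [Finset.mem_insert, Finset.mem_singleton]; tauto
    · rw [← hD]; simp only [doubleArea]; ring_nf

theorem abs_doubleArea_swap (a b c : ℤ × ℤ) : |doubleArea a b c| = |doubleArea a c b| := by
  rw [← abs_neg]; simp only [doubleArea]; ring_nf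

theorem IsUnimodularTriangle.exists_of_mem_mem {t : Finset (latticePoints P)}
    (ht : IsUnimodularTriangle t) {a b : latticePoints P} (ha : a ∈ t) (hb : b ∈ t)
    (hab : a ≠ b) : ∃ c, t = {a, b, c} ∧ |doubleArea a.1 b.1 c.1| = 1 := by
  obtain ⟨p, q, rfl, hD⟩ := ht.exists_of_mem ha
  simp only [Finset.mem_insert, Finset.mem_singleton] at hb
  rcases hb with rfl | rfl | rfl
  · exact absurd rfl hab
  · exact ⟨q, rfl, hD⟩
  · refine ⟨p, ?_, ?_⟩
    · ext x; simp only [Finset.mem_insert, Finset.mem_singleton]; tauto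
    · rw [abs_doubleArea_swap]; exact hD

/-- The definition names the vertices in some order of its own; counting vertices excludes
repetitions among `a`, `b`, `c`, and reordering only changes the sign of the area. -/
theorem IsUnimodularTriangle.of_triple {a b c : latticePoints P}
    (h : IsUnimodularTriangle ({a, b, c} : Finset (latticePoints P))) :
    |doubleArea a.1 b.1 c.1| = 1 := by
  have hcard : ({a, b, c} : Finset (latticePoints P)).card = 3 := by
    obtain ⟨p, q, r, ht, hD⟩ := h
    have hne := ne_of_doubleArea hD
    have ht : ({a, b, c} : Finset (latticePoints P)) = {p, q, r} := by
      rw [← Finset.coe_inj, ht]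
      simp
    rw [ht, Finset.card_eq_three]
    exact ⟨p, q, r, fun h => hne.1 (by rw [h]), fun h => hne.2.1 (by rw [h]),
      fun h => hne.2.2 (by rw [h]), rfl⟩
  have hab : a ≠ b := by
    rintro rfl
    rw [Finset.insert_idem] at hcard
    have := Finset.card_le_two (a := a) (b := c)
    omega
  obtain ⟨d, hd, hD⟩ := h.exists_of_mem_mem (a := a) (b := b) (by simp) (by simp) hab
  have hne := ne_of_doubleArea hD
  have hdc : d ∈ ({a, b, c} : Finset (latticePoints P)) := by rw [hd]; simp
  simp only [Finset.mem_insert, Finset.mem_singleton] at hdc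
  rcases hdc with rfl | rfl | rfl
  · exact absurd rfl hne.2.1
  · exact absurd rfl hne.2.2
  · exact hD

theorem mem_hull_triple {a b c : latticePoints P} {z : ℝ × ℝ} :
    z ∈ hull (({a, b, c} : Finset (latticePoints P)) : Set (latticePoints P)) ↔
      ∃ α β γ : ℝ, 0 ≤ α ∧ 0 ≤ β ∧ 0 ≤ γ ∧ α + β + γ = 1 ∧
        α * a.1.1 + β * b.1.1 + γ * c.1.1 = z.1 ∧ α * a.1.2 + β * b.1.2 + γ * c.1.2 = z.2 := by
  have him : (fun p : latticePoints P => toPlane p.1) ''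
      (({a, b, c} : Finset (latticePoints P)) : Set (latticePoints P)) =
      {toPlane a.1, toPlane b.1, toPlane c.1} := by
    simp [Set.image_insert_eq]
  rw [hull, him]
  constructor
  · intro hz
    have : convexHull ℝ {toPlane a.1, toPlane b.1, toPlane c.1} ⊆
        {z | ∃ α β γ : ℝ, 0 ≤ α ∧ 0 ≤ β ∧ 0 ≤ γ ∧ α + β + γ = 1 ∧
        α * a.1.1 + β * b.1.1 + γ * c.1.1 = z.1 ∧ α * a.1.2 + β * b.1.2 + γ * c.1.2 = z.2} := by
      refine convexHull_min ?_ ?_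
      · rintro _ (rfl | rfl | rfl)
        · exact ⟨1, 0, 0, by simp [toPlane]⟩
        · exact ⟨0, 1, 0, by simp [toPlane]⟩
        · exact ⟨0, 0, 1, by simp [toPlane]⟩
      · rintro x ⟨α, β, γ, h1, h2, h3, h4, h5, h6⟩ y ⟨α', β', γ', h1', h2', h3', h4', h5', h6'⟩
          r s hr hs hrs
        refine ⟨r * α + s * α', r * β + s * β', r * γ + s * γ', by positivity, by positivity,
          by positivity, ?_, ?_, ?_⟩
        · linear_combination r * h4 + s * h4' + hrs
        · simp only [Prod.fst_add, Prod.smul_fst, smul_eq_mul]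
          linear_combination r * h5 + s * h5'
        · simp only [Prod.snd_add, Prod.smul_snd, smul_eq_mul]
          linear_combination r * h6 + s * h6'
    exact this hz
  · rintro ⟨α, β, γ, h1, h2, h3, h4, h5, h6⟩
    have hz : z = α • toPlane a.1 + (β • toPlane b.1 + γ • toPlane c.1) := by
      ext <;> simp [toPlane] <;> linarith
    have hsub := subset_convexHull ℝ {toPlane a.1, toPlane b.1, toPlane c.1}
    have hsum := (convex_convexHull ℝ {toPlane a.1, toPlane b.1, toPlane c.1}).sum_mem
      (t := Finset.univ) (w := ![α, β, γ]) (z := ![toPlane a.1, toPlane b.1, toPlane c.1])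
      (by intro i _; fin_cases i <;> simpa) (by simp [Fin.sum_univ_three, h4])
      (by intro i _; fin_cases i <;> apply hsub <;> simp)
    rw [Fin.sum_univ_three] at hsum
    rw [hz, ← add_assoc]
    simpa using hsum

/-- A lattice point in a unimodular triangle is one of its vertices. -/
theorem mem_of_toPlane_mem_hull {t : Finset (latticePoints P)} (ht : IsUnimodularTriangle t)
    {p : latticePoints P} (hp : toPlane p.1 ∈ hull (t : Set (latticePoints P))) : p ∈ t := by
  obtain ⟨a, b, c, ht, hD⟩ := ht
  have ht' : t = {a, b, c} := by
    ext x
    rw [← Finset.mem_coe, ht]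
    simp
  subst ht'
  obtain ⟨α, β, γ, hα, hβ, hγ, hs, h1, h2⟩ := mem_hull_triple.1 hp
  simp only [toPlane] at h1 h2
  -- Barycentric coordinates are quotients of integral areas by ±1, hence integers; being
  -- nonnegative with sum 1, they are those of a vertex.
  have e1 : α * doubleArea a.1 b.1 c.1 = doubleArea p.1 b.1 c.1 := by
    simp only [doubleArea]; push_cast
    rw [← h1, ← h2]
    have : α = 1 - β - γ := by linarith
    subst this; ring
  have e2 : β * doubleArea a.1 b.1 c.1 = doubleArea a.1 p.1 c.1 := by
    simp only [doubleArea]; push_cast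
    rw [← h1, ← h2]
    have : α = 1 - β - γ := by linarith
    subst this; ring
  have int_of : ∀ (x : ℝ) (m : ℤ), x * doubleArea a.1 b.1 c.1 = m → ∃ n : ℤ, x = n := by
    intro x m h
    rcases (abs_eq zero_le_one).1 hD with h' | h'
    · exact ⟨m, by rw [← h, h']; simp⟩
    · exact ⟨-m, by push_cast; rw [← h, h']; simp⟩
  obtain ⟨m, rfl⟩ := int_of _ _ e1
  obtain ⟨n, rfl⟩ := int_of _ _ e2
  have hγ' : γ = 1 - m - n := by linarith
  subst hγ'
  have hm : 0 ≤ m := by exact_mod_cast hα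
  have hn : 0 ≤ n := by exact_mod_cast hβ
  have hk : 0 ≤ 1 - m - n := by exact_mod_cast hγ
  simp only [Finset.mem_insert, Finset.mem_singleton]
  have hcases : (m = 1 ∧ n = 0) ∨ (m = 0 ∧ n = 1) ∨ (m = 0 ∧ n = 0) := by omega
  rcases hcases with ⟨rfl, rfl⟩ | ⟨rfl, rfl⟩ | ⟨rfl, rfl⟩
  · left
    norm_num at h1 h2
    exact Subtype.ext (Prod.ext (by exact_mod_cast h1.symm) (by exact_mod_cast h2.symm))
  · right; left
    norm_num at h1 h2
    exact Subtype.ext (Prod.ext (by exact_mod_cast h1.symm) (by exact_mod_cast h2.symm))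
  · right; right
    norm_num at h1 h2
    exact Subtype.ext (Prod.ext (by exact_mod_cast h1.symm) (by exact_mod_cast h2.symm))

/-- If `P` contains a short segment from `x` in the direction `v`, then some triangle contains
`x` and a short segment in that direction. -/
theorem IsUnimodularTriangulation.exists_direction (hT : IsUnimodularTriangulation P T)
    {x v : ℝ × ℝ} (h : ∀ᶠ ε : ℝ in 𝓝[>] 0, x + ε • v ∈ P) :
    ∃ t ∈ T, x ∈ hull (t : Set (latticePoints P)) ∧
      ∃ ε : ℝ, 0 < ε ∧ x + ε • v ∈ hull (t : Set (latticePoints P)) := by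
  by_contra! hcon
  -- A closed triangle away from `x` misses all short segments at `x`, and there are only finitely
  -- many triangles.
  have hev : ∀ t ∈ T, ∀ᶠ ε : ℝ in 𝓝[>] 0, x + ε • v ∉ hull (t : Set (latticePoints P)) := by
    intro t ht
    by_cases hx : x ∈ hull (t : Set (latticePoints P))
    · filter_upwards [self_mem_nhdsWithin] with ε hε
      exact hcon t ht hx ε hε
    · have hcl : IsClosed (hull (t : Set (latticePoints P))) :=
        ((t.finite_toSet.image _).isCompact_convexHull (𝕜 := ℝ)).isClosed
      have hcont : Tendsto (fun ε : ℝ => x + ε • v) (𝓝[>] 0) (𝓝 x) := by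
        have : Continuous fun ε : ℝ => x + ε • v := by fun_prop
        have h0 := this.tendsto 0
        simp only [zero_smul, add_zero] at h0
        exact h0.mono_left nhdsWithin_le_nhds
      exact hcont.eventually (hcl.isOpen_compl.mem_nhds hx)
  rw [← Filter.eventually_all_finset] at hev
  obtain ⟨ε, h1, h2⟩ := (h.and hev).exists
  rw [← hT.cover] at h1
  simp only [Set.mem_iUnion] at h1
  obtain ⟨t, ht, h1⟩ := h1
  exact h2 t ht h1

theorem eventually_mem_of_mem_interior {x : ℝ × ℝ} (hx : x ∈ interior P) (v : ℝ × ℝ) :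
    ∀ᶠ ε : ℝ in 𝓝[>] 0, x + ε • v ∈ P := by
  have : Continuous fun ε : ℝ => x + ε • v := by fun_prop
  have h0 := this.tendsto 0
  simp only [zero_smul, add_zero] at h0
  exact (h0.mono_left nhdsWithin_le_nhds).eventually (mem_interior_iff_mem_nhds.1 hx)

theorem IsUnimodularTriangulation.doubleArea_abs (hT : IsUnimodularTriangulation P T)
    {a b c : latticePoints P} (h : {a, b, c} ∈ T) : |doubleArea a.1 b.1 c.1| = 1 :=
  (hT.unimodular _ h).of_triple

/-- A vector with vanishing determinant against one of two vectors of determinant `±1` is an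
integer multiple of it. -/
theorem exists_int_mul {u1 u2 v1 v2 w1 w2 : ℤ} (h : |u1 * v2 - u2 * v1| = 1)
    (hw : u1 * w2 - u2 * w1 = 0) : ∃ k : ℤ, w1 = k * u1 ∧ w2 = k * u2 := by
  rcases (abs_eq zero_le_one).1 h with h | h
  · exact ⟨w1 * v2 - w2 * v1, by linear_combination (-w1) * h + v1 * hw,
      by linear_combination (-w2) * h + v2 * hw⟩
  · exact ⟨-(w1 * v2 - w2 * v1), by linear_combination w1 * h - v1 * hw,
      by linear_combination w2 * h - v2 * hw⟩

/-- Two triangles on the same side of a common edge are equal. -/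
theorem IsUnimodularTriangulation.apex_unique [Fintype (latticePoints P)]
    (hT : IsUnimodularTriangulation P T) {a b c d : latticePoints P}
    (h1 : {a, b, c} ∈ T) (h2 : {a, b, d} ∈ T)
    (h : doubleArea a.1 b.1 c.1 = doubleArea a.1 b.1 d.1) : c = d := by
  have hD := hT.doubleArea_abs h1
  have hD2 := ne_of_doubleArea (hT.doubleArea_abs h2)
  -- Equal areas give d - c = k (b - a). For k < 0 the sides db and ca would cross, for k > 0 the
  -- sides da and cb.
  obtain ⟨k, hk1, hk2⟩ := exists_int_mul (w1 := d.1.1 - c.1.1) (w2 := d.1.2 - c.1.2)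
    (by simpa only [doubleArea] using hD) (by simp only [doubleArea] at h; linear_combination -h)
  rcases lt_trichotomy k 0 with hk | rfl | hk
  · have := hT.segments_eq (a := d) (b := b) (c := c) (d := a) h2 h1
      (by simp) (by simp) (by simp) (by simp)
      (α := 1) (β := -k) (γ := 1) (δ := -k) one_pos (by omega) one_pos (by omega) rfl
      (by linarith) (by linarith)
    rcases this.1 with h | h
    · exact h.symm
    · exact absurd (by rw [h]) hD2.2.1
  · exact Subtype.ext (Prod.ext (by linarith) (by linarith))
  · have := hT.segments_eq (a := d) (b := a) (c := c) (d := b) h2 h1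
      (by simp) (by simp) (by simp) (by simp)
      (α := 1) (β := k) (γ := 1) (δ := k) one_pos hk one_pos hk rfl
      (by linarith) (by linarith)
    rcases this.1 with h | h
    · exact h.symm
    · exact absurd (by rw [h]) hD2.2.2

/-- An edge whose midpoint is interior to `P` has a triangle on its other side. -/
theorem IsUnimodularTriangulation.exists_opposite [Fintype (latticePoints P)]
    (hT : IsUnimodularTriangulation P T) {a b c : latticePoints P}
    (h : {a, b, c} ∈ T)
    (hmid : (1 / 2 : ℝ) • toPlane a.1 + (1 / 2 : ℝ) • toPlane b.1 ∈ interior P) :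
    ∃ d, {a, b, d} ∈ T ∧ doubleArea a.1 b.1 d.1 = -doubleArea a.1 b.1 c.1 := by
  classical
  have hD := hT.doubleArea_abs h
  have hne := ne_of_doubleArea hD
  have hab : a ≠ b := fun h => hne.1 (by rw [h])
  -- From the midpoint of ab, the direction a - c leads to the side of ab opposite to c.
  obtain ⟨t', ht', hx, ε, hε, hxv⟩ := hT.exists_direction
    (eventually_mem_of_mem_interior hmid (toPlane a.1 - toPlane c.1))
  obtain ⟨w', hw', hw'x⟩ := mem_hull_iff.1 hx
  have hw : IsWeight (({a, b, c} : Finset (latticePoints P)) : Set (latticePoints P))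
      (Pi.single a (1 / 2) + Pi.single b (1 / 2)) := by
    refine ⟨fun p => ?_, fun p hp => ?_, ?_⟩
    · simp only [Pi.add_apply, Pi.single_apply]
      split_ifs <;> norm_num
    · simp only [Finset.coe_insert, Finset.coe_singleton, Set.mem_insert_iff,
        Set.mem_singleton_iff, not_or] at hp
      simp [hp.1, hp.2.1]
    · simp only [Pi.add_apply, Finset.sum_add_distrib, Finset.sum_pi_single', Finset.mem_univ,
        if_true]
      norm_num
  -- The midpoint has positive weight at both `a` and `b`, and its weight is the same in `t'`; so
  -- `t'` contains both.
  have heq := hT.weight_unique h ht' hw hw' (by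
    rw [hw'x]
    simp [add_smul, Finset.sum_add_distrib, Pi.single_apply, ite_smul])
  have ha : a ∈ t' := by
    by_contra hcon
    have h0 := hw'.supp a hcon
    rw [← heq] at h0
    simp [hab] at h0
  have hb : b ∈ t' := by
    by_contra hcon
    have h0 := hw'.supp b hcon
    rw [← heq] at h0
    simp [hab.symm] at h0
  obtain ⟨d, rfl, hDd⟩ := (hT.unimodular t' ht').exists_of_mem_mem ha hb hab
  refine ⟨d, ht', ?_⟩
  obtain ⟨α, β, γ, hα, hβ, hγ, hs, e1, e2⟩ := mem_hull_triple.1 hxv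
  simp only [toPlane, Prod.smul_mk, Prod.mk_add_mk, Prod.mk_sub_mk, smul_eq_mul] at e1 e2
  -- Since γ ≥ 0 and ε > 0, the two areas, each ±1, have opposite signs.
  have key : γ * doubleArea a.1 b.1 d.1 = -ε * doubleArea a.1 b.1 c.1 := by
    simp only [doubleArea]
    push_cast
    have hα' : α = 1 - β - γ := by linarith
    subst hα'
    linear_combination ((b.1.1 : ℝ) - a.1.1) * e2 - ((b.1.2 : ℝ) - a.1.2) * e1
  rcases (abs_eq zero_le_one).1 hD with h1 | h1 <;>
    rcases (abs_eq zero_le_one).1 hDd with h2 | h2 <;> rw [h1, h2] at key ⊢ <;>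
    push_cast at key <;> first | rfl | (exfalso; linarith)

end Triangles

/-! ### Finiteness -/

theorem IsLatticePolygon.convex {P : Set (ℝ × ℝ)} (hP : IsLatticePolygon P) : Convex ℝ P := by
  obtain ⟨S, rfl⟩ := hP.eq_convexHull
  exact convex_convexHull ℝ _

theorem IsLatticePolygon.finite {P : Set (ℝ × ℝ)} (hP : IsLatticePolygon P) :
    Finite (latticePoints P) := by
  obtain ⟨S, rfl⟩ := hP.eq_convexHull
  have hfin : (toPlane '' (S : Set (ℤ × ℤ))).Finite := S.finite_toSet.image _
  have hb : Bornology.IsBounded (convexHull ℝ (toPlane '' (S : Set (ℤ × ℤ)))) :=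
    (hfin.isCompact_convexHull (𝕜 := ℝ)).isBounded
  obtain ⟨R, hR⟩ := hb.subset_closedBall 0
  refine Set.Finite.subset (Set.finite_Icc ((-⌈R⌉, -⌈R⌉) : ℤ × ℤ) (⌈R⌉, ⌈R⌉)) ?_
  intro p hp
  have h := hR hp
  rw [mem_closedBall_zero_iff, Prod.norm_def, max_le_iff] at h
  simp only [toPlane, Real.norm_eq_abs, abs_le] at h
  have hc := Int.le_ceil R
  rw [Set.mem_Icc, Prod.le_def, Prod.le_def]
  refine ⟨⟨?_, ?_⟩, ⟨?_, ?_⟩⟩ <;> simp only [] <;>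
    (have : ((-⌈R⌉ : ℤ) : ℝ) = -(⌈R⌉ : ℝ) := by push_cast; ring) <;>
    (rw [← Int.cast_le (R := ℝ)]) <;> linarith [h.1.1, h.1.2, h.2.1, h.2.2]

end TropicalModuli

namespace TropicalModuli

open Filter Topology

/-! ### Lattice lengths of bounded edges as linear functions of the heights. -/

section Lengths

variable {P : Set (ℝ × ℝ)} {T : Finset (Finset (latticePoints P))}

/-- For triangles `abc` and `abd` with `c + d = (2 - β) a + β b`, the lattice length of the edge
dual to `ab`, as a linear function of the heights. -/
def quadLength (a b c d : latticePoints P) (β : ℤ) : (latticePoints P → ℝ) →ₗ[ℝ] ℝ :=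
  (LinearMap.proj c : (latticePoints P → ℝ) →ₗ[ℝ] ℝ) + LinearMap.proj d -
    (2 - β : ℝ) • LinearMap.proj a - (β : ℝ) • LinearMap.proj b

theorem quadLength_apply (a b c d : latticePoints P) (β : ℤ) (ω : latticePoints P → ℝ) :
    quadLength a b c d β ω = ω c + ω d - (2 - β) * ω a - β * ω b := by
  simp [quadLength]

/-- `e` is a pair of distinct triangles `abc` and `abd` with `c + d = (2 - β) a + β b`. -/
def IsQuad (T : Finset (Finset (latticePoints P))) (e : Sym2 T) (a b c d : latticePoints P)
    (β : ℤ) : Prop :=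
  ∃ t t' : T, e = s(t, t') ∧ t ≠ t' ∧ t.1 = {a, b, c} ∧ t'.1 = {a, b, d} ∧
    c.1.1 + d.1.1 = (2 - β) * a.1.1 + β * b.1.1 ∧ c.1.2 + d.1.2 = (2 - β) * a.1.2 + β * b.1.2

/-- The apexes lie on opposite sides of ab at the same lattice distance, so c + d - 2a is parallel
to b - a; as b - a is primitive, it is an integral multiple. -/
theorem exists_isQuad [Fintype (latticePoints P)] (hT : IsUnimodularTriangulation P T) {t t' : T}
    (h : (dualGraph T).Adj t t') : ∃ a b c d β, t.1 = {a, b, c} ∧ t'.1 = {a, b, d} ∧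
      c.1.1 + d.1.1 = (2 - β) * a.1.1 + β * b.1.1 ∧
      c.1.2 + d.1.2 = (2 - β) * a.1.2 + β * b.1.2 := by
  obtain ⟨hne, hcard⟩ := h
  obtain ⟨a, b, hab, hinter⟩ := Set.ncard_eq_two.1 hcard
  have ha : a ∈ (t.1 : Set (latticePoints P)) ∩ t'.1 := by rw [hinter]; simp
  have hb : b ∈ (t.1 : Set (latticePoints P)) ∩ t'.1 := by rw [hinter]; simp
  obtain ⟨c, hc, hDc⟩ := (hT.unimodular _ t.2).exists_of_mem_mem ha.1 hb.1 hab
  obtain ⟨d, hd, hDd⟩ := (hT.unimodular _ t'.2).exists_of_mem_mem ha.2 hb.2 hab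
  have hopp : doubleArea a.1 b.1 d.1 = -doubleArea a.1 b.1 c.1 := by
    have hcd : doubleArea a.1 b.1 c.1 ≠ doubleArea a.1 b.1 d.1 := by
      intro h
      have := hT.apex_unique (hc ▸ t.2) (hd ▸ t'.2) h
      exact hne (Subtype.ext (by rw [hc, hd, this]))
    rcases (abs_eq zero_le_one).1 hDc with h1 | h1 <;>
      rcases (abs_eq zero_le_one).1 hDd with h2 | h2 <;> rw [h1, h2] at hcd ⊢ <;> simp at hcd ⊢
  obtain ⟨k, h1, h2⟩ := exists_int_mul (w1 := c.1.1 + d.1.1 - 2 * a.1.1)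
    (w2 := c.1.2 + d.1.2 - 2 * a.1.2) (by simpa only [doubleArea] using hDc)
    (by simp only [doubleArea] at hopp; linear_combination hopp)
  exact ⟨a, b, c, d, k, hc, hd, by linear_combination h1, by linear_combination h2⟩

theorem IsQuad.symm {e : Sym2 T} {a b c d : latticePoints P} {β : ℤ}
    (h : IsQuad T e a b c d β) : IsQuad T e a b d c β := by
  obtain ⟨t, t', he, hne, ht, ht', h1, h2⟩ := h
  exact ⟨t', t, by rw [he, Sym2.eq_swap], hne.symm, ht', ht, by linarith, by linarith⟩

/-- A pair of triangles determines its labelling up to exchanging `c` with `d`, and `a` with `b`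
together with β and 2 - β. Both exchanges preserve the functional. -/
theorem IsQuad.quadLength_eq (hT : IsUnimodularTriangulation P T)
    {e : Sym2 T} {a b c d a' b' c' d' : latticePoints P} {β β' : ℤ}
    (h : IsQuad T e a b c d β) (h' : IsQuad T e a' b' c' d' β') :
    quadLength a b c d β = quadLength a' b' c' d' β' := by
  -- The unordered pair may list its triangles in either order; the exchange of `c'` and `d'` aligns
  -- the two labellings.
  wlog hw : ∃ t t' : T, e = s(t, t') ∧ t ≠ t' ∧ t.1 = {a, b, c} ∧ t'.1 = {a, b, d} ∧
      t.1 = {a', b', c'} ∧ t'.1 = {a', b', d'} generalizing c' d' with H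
  · obtain ⟨t, t', he, hne, ht, ht', -⟩ := id h
    obtain ⟨s, s', hs, hne', hs1, hs2, -⟩ := id h'
    rw [he, Sym2.eq_iff] at hs
    rcases hs with ⟨rfl, rfl⟩ | ⟨rfl, rfl⟩
    · exact H h' ⟨t, t', he, hne, ht, ht', hs1, hs2⟩
    · rw [H h'.symm ⟨t, t', he, hne, ht, ht', hs2, hs1⟩]
      apply LinearMap.ext
      intro ω
      simp only [quadLength_apply]
      ring
  obtain ⟨t, t', he, hne, ht, ht', hs, hs'⟩ := hw
  have key : ∀ {a b c d : latticePoints P}, t.1 = {a, b, c} → t'.1 = {a, b, d} →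
      a ≠ b ∧ c ∉ t'.1 ∧ d ∉ t.1 := by
    intro a b c d h1 h2
    have n1 := ne_of_doubleArea (hT.doubleArea_abs (h1 ▸ t.2))
    have n2 := ne_of_doubleArea (hT.doubleArea_abs (h2 ▸ t'.2))
    have hcd : c ≠ d := by
      rintro rfl
      exact hne (Subtype.ext (h1.trans h2.symm))
    refine ⟨fun h => n1.1 (by rw [h]), fun h => ?_, fun h => ?_⟩
    · rw [h2] at h
      simp only [Finset.mem_insert, Finset.mem_singleton] at h
      rcases h with rfl | rfl | rfl
      · exact n1.2.1 rfl
      · exact n1.2.2 rfl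
      · exact hcd rfl
    · rw [h1] at h
      simp only [Finset.mem_insert, Finset.mem_singleton] at h
      rcases h with rfl | rfl | rfl
      · exact n2.2.1 rfl
      · exact n2.2.2 rfl
      · exact hcd rfl
  obtain ⟨hab, hc, hd⟩ := key ht ht'
  obtain ⟨hab', hc', hd'⟩ := key hs hs'
  have mem : ∀ x, x ∈ t.1 → x ∈ t'.1 → x = a ∨ x = b := by
    intro x h1 h2
    rw [ht] at h1
    simp only [Finset.mem_insert, Finset.mem_singleton] at h1
    rcases h1 with rfl | rfl | rfl
    · exact Or.inl rfl
    · exact Or.inr rfl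
    · exact absurd h2 hc
  have ha' := mem a' (by rw [hs]; simp) (by rw [hs']; simp)
  have hb' := mem b' (by rw [hs]; simp) (by rw [hs']; simp)
  have ec : c' = c := by
    have : c' ∈ t.1 := by rw [hs]; simp
    rw [ht] at this
    simp only [Finset.mem_insert, Finset.mem_singleton] at this
    rcases this with rfl | rfl | rfl
    · exact absurd (by rw [ht']; simp) hc'
    · exact absurd (by rw [ht']; simp) hc'
    · rfl
  have ed : d' = d := by
    have : d' ∈ t'.1 := by rw [hs']; simp
    rw [ht'] at this
    simp only [Finset.mem_insert, Finset.mem_singleton] at this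
    rcases this with rfl | rfl | rfl
    · exact absurd (by rw [ht]; simp) hd'
    · exact absurd (by rw [ht]; simp) hd'
    · rfl
  subst ec ed
  have hne1 : a.1 ≠ b.1 := fun h => hab (Subtype.ext h)
  obtain ⟨-, -, -, -, -, -, h1, h2⟩ := h
  obtain ⟨-, -, -, -, -, -, h1', h2'⟩ := h'
  rcases ha' with rfl | rfl <;> rcases hb' with rfl | rfl
  · exact absurd rfl hab'
  · have hβ : β = β' := by
      by_contra hβ
      apply hne1
      have hβ' : β - β' ≠ 0 := sub_ne_zero.2 hβ
      refine Prod.ext (mul_left_cancel₀ hβ' ?_) (mul_left_cancel₀ hβ' ?_)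
      · linear_combination h1 - h1'
      · linear_combination h2 - h2'
    rw [hβ]
  · have hβ : β = 2 - β' := by
      by_contra hβ
      apply hne1
      have hβ' : β - (2 - β') ≠ 0 := sub_ne_zero.2 hβ
      refine Prod.ext (mul_left_cancel₀ hβ' ?_) (mul_left_cancel₀ hβ' ?_)
      · linear_combination h1 - h1'
      · linear_combination h2 - h2'
    subst hβ
    apply LinearMap.ext
    intro ω
    simp only [quadLength_apply]
    push_cast
    ring
  · exact absurd rfl hab'

open Classical in
/-- The length of the bounded edge dual to a pair of adjacent triangles, as a linear function of
the heights. -/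
noncomputable def edgeLength (T : Finset (Finset (latticePoints P))) (e : Sym2 T) :
    (latticePoints P → ℝ) →ₗ[ℝ] ℝ :=
  if h : ∃ φ, ∃ a b c d β, IsQuad T e a b c d β ∧ φ = quadLength a b c d β then h.choose else 0

/-- Any labelling computes the length, although the definition picks one by choice. -/
theorem edgeLength_eq (hT : IsUnimodularTriangulation P T) {e : Sym2 T}
    {a b c d : latticePoints P} {β : ℤ} (h : IsQuad T e a b c d β) :
    edgeLength T e = quadLength a b c d β := by
  have hex : ∃ φ, ∃ a b c d β, IsQuad T e a b c d β ∧ φ = quadLength a b c d β :=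
    ⟨_, a, b, c, d, β, h, rfl⟩
  rw [edgeLength, dif_pos hex]
  obtain ⟨a', b', c', d', β', h', heq⟩ := hex.choose_spec
  rw [heq, h'.quadLength_eq hT h]

/-- The length of the edge of a tropical curve dual to a common side of two triangles. -/
theorem isLatticeLength_quadLength {a b c d : latticePoints P} {β : ℤ}
    {ω : latticePoints P → ℝ} {u u' : ℝ × ℝ}
    (hD : |doubleArea a.1 b.1 d.1| = 1)
    (h1 : c.1.1 + d.1.1 = (2 - β) * a.1.1 + β * b.1.1)
    (h2 : c.1.2 + d.1.2 = (2 - β) * a.1.2 + β * b.1.2)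
    (hd : d ∉ ({a, b, c} : Finset (latticePoints P)))
    (hu : IsDualVertex ω {a, b, c} u) (hu' : IsDualVertex ω {a, b, d} u') :
    0 < quadLength a b c d β ω ∧ IsLatticeLength u u' (quadLength a b c d β ω) := by
  obtain ⟨m, hm, hlt⟩ := hu
  obtain ⟨m', hm', hlt'⟩ := hu'
  have ea := hm a (by simp)
  have eb := hm b (by simp)
  have ec := hm c (by simp)
  have ed := hlt d hd
  have ea' := hm' a (by simp)
  have eb' := hm' b (by simp)
  have ed' := hm' d (by simp)
  simp only [monomialValue] at ea eb ec ed ea' eb' ed'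
  have h1' : (c.1.1 : ℝ) + d.1.1 = (2 - β) * a.1.1 + β * b.1.1 := by exact_mod_cast h1
  have h2' : (c.1.2 : ℝ) + d.1.2 = (2 - β) * a.1.2 + β * b.1.2 := by exact_mod_cast h2
  -- The length is the amount by which the monomial `d` exceeds the minimum at the vertex dual to
  -- abc; this makes it positive.
  have hq : quadLength a b c d β ω = ω d + d.1.1 * u.1 + d.1.2 * u.2 - m := by
    rw [quadLength_apply]
    linear_combination ec - (2 - β : ℝ) * ea - (β : ℝ) * eb - u.1 * h1' - u.2 * h2'
  have hpos : 0 < quadLength a b c d β ω := by rw [hq]; linarith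
  refine ⟨hpos, hpos.le, ?_⟩
  set δ := doubleArea a.1 b.1 d.1 with hδ
  have hδδ : δ * δ = 1 := by
    rcases (abs_eq zero_le_one).1 hD with h | h <;> rw [h] <;> norm_num
  -- The edge is orthogonal to its dual side: the primitive vector is b - a turned by a right angle,
  -- with the sign δ of the area of abd. The Bézout coefficients come from d - a.
  refine ⟨(δ * (b.1.2 - a.1.2), -δ * (b.1.1 - a.1.1)), ?_, ?_⟩
  · refine ⟨-(d.1.1 - a.1.1), -(d.1.2 - a.1.2), ?_⟩
    have hδe : δ = (b.1.1 - a.1.1) * (d.1.2 - a.1.2) - (b.1.2 - a.1.2) * (d.1.1 - a.1.1) := hδ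
    linear_combination hδδ - δ * hδe
  · have hδδ' : (δ : ℝ) * δ = 1 := by exact_mod_cast hδδ
    have hδ' : (δ : ℝ) = (b.1.1 - a.1.1) * (d.1.2 - a.1.2) - (b.1.2 - a.1.2) * (d.1.1 - a.1.1) := by
      rw [hδ]; simp [doubleArea]
    have p1 : ((b.1.1 : ℝ) - a.1.1) * (u'.1 - u.1) + (b.1.2 - a.1.2) * (u'.2 - u.2) = 0 := by
      linear_combination eb' - ea' - eb + ea
    have p2 : ((d.1.1 : ℝ) - a.1.1) * (u'.1 - u.1) + (d.1.2 - a.1.2) * (u'.2 - u.2) =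
        -quadLength a b c d β ω := by
      rw [hq]
      linear_combination ed' - ea' + ea
    have q1 : (δ : ℝ) * (u'.1 - u.1) = quadLength a b c d β ω * (b.1.2 - a.1.2) := by
      rw [hδ']
      linear_combination ((d.1.2 : ℝ) - a.1.2) * p1 - ((b.1.2 : ℝ) - a.1.2) * p2
    have q2 : (δ : ℝ) * (u'.2 - u.2) = -quadLength a b c d β ω * (b.1.1 - a.1.1) := by
      rw [hδ']
      linear_combination -((d.1.1 : ℝ) - a.1.1) * p1 + ((b.1.1 : ℝ) - a.1.1) * p2
    ext
    · simp only [toPlane, Prod.fst_sub, Prod.smul_mk, smul_eq_mul]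
      push_cast
      linear_combination (δ : ℝ) * q1 - (u'.1 - u.1) * hδδ'
    · simp only [toPlane, Prod.snd_sub, Prod.smul_mk, smul_eq_mul]
      push_cast
      linear_combination (δ : ℝ) * q2 - (u'.2 - u.2) * hδδ'

/-- Bézout coefficients of the two primitive vectors exhibit each length as an integral multiple of
the other, so they agree up to a sign; nonnegativity fixes the sign. -/
theorem IsLatticeLength.unique {u v : ℝ × ℝ} {l l' : ℝ} (h : IsLatticeLength u v l)
    (h' : IsLatticeLength u v l') (hl : 0 < l) : l = l' := by
  obtain ⟨-, w, ⟨x, y, hxy⟩, hw⟩ := h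
  obtain ⟨hl', w', ⟨x', y', hxy'⟩, hw'⟩ := h'
  rw [hw] at hw'
  simp only [toPlane, Prod.smul_mk, smul_eq_mul, Prod.mk.injEq] at hw'
  obtain ⟨e1, e2⟩ := hw'
  have hxyR : (x : ℝ) * w.1 + y * w.2 = 1 := by exact_mod_cast hxy
  have hxyR' : (x' : ℝ) * w'.1 + y' * w'.2 = 1 := by exact_mod_cast hxy'
  have f1 : l = l' * ((x * w'.1 + y * w'.2 : ℤ) : ℝ) := by
    push_cast
    linear_combination -l * hxyR + (x : ℝ) * e1 + (y : ℝ) * e2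
  have f2 : l' = l * ((x' * w.1 + y' * w.2 : ℤ) : ℝ) := by
    push_cast
    linear_combination -l' * hxyR' - (x' : ℝ) * e1 - (y' : ℝ) * e2
  set n := x * w'.1 + y * w'.2
  set n' := x' * w.1 + y' * w.2
  have hnn : (n' : ℝ) * n = 1 := by
    have : l * ((n' : ℝ) * n) = l * 1 := by rw [← mul_assoc, ← f2, ← f1, mul_one]
    exact mul_left_cancel₀ hl.ne' this
  have hnn' : n' * n = 1 := by exact_mod_cast hnn
  rcases Int.eq_one_or_neg_one_of_mul_eq_one hnn' with h | h
  · rw [h] at f2; simpa using f2.symm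
  · rw [h] at f2
    push_cast at f2
    linarith

theorem edgeLength_of_dual [Fintype (latticePoints P)] (hT : IsUnimodularTriangulation P T)
    {ω : latticePoints P → ℝ} {u : T → ℝ × ℝ} (hu : ∀ t : T, IsDualVertex ω t.1 (u t))
    {t t' : T} (h : (dualGraph T).Adj t t') :
    0 < edgeLength T s(t, t') ω ∧ IsLatticeLength (u t) (u t') (edgeLength T s(t, t') ω) := by
  obtain ⟨a, b, c, d, β, ht, ht', h1, h2⟩ := exists_isQuad hT h
  rw [edgeLength_eq hT ⟨t, t', rfl, h.1, ht, ht', h1, h2⟩]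
  have n2 := ne_of_doubleArea (hT.doubleArea_abs (ht' ▸ t'.2))
  refine isLatticeLength_quadLength (hT.doubleArea_abs (ht' ▸ t'.2)) h1 h2 ?_ (ht ▸ hu t)
    (ht' ▸ hu t')
  intro hd
  simp only [Finset.mem_insert, Finset.mem_singleton] at hd
  rcases hd with rfl | rfl | rfl
  · exact n2.2.1 rfl
  · exact n2.2.2 rfl
  · exact h.1 (Subtype.ext (ht.trans ht'.symm))

/-- A curve dual to T carries no freedom beyond its heights, because lattice lengths are unique. Its
length vectors thus form the linear image of the set of heights inducing T. -/
theorem curveEdgeLengths_eq [Fintype (latticePoints P)] (hT : IsUnimodularTriangulation P T) :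
    curveEdgeLengths T = (fun ω e => edgeLength T e.1 ω) '' {ω | Induces ω T} := by
  ext x
  constructor
  · rintro ⟨ω, u, hu, hx⟩
    refine ⟨ω, fun t ht => ⟨u ⟨t, ht⟩, hu ⟨t, ht⟩⟩, ?_⟩
    funext ⟨e, he⟩
    induction e using Sym2.ind with
    | _ t t' =>
      obtain ⟨hpos, hlen⟩ := edgeLength_of_dual hT hu he
      exact hlen.unique (hx t t' he) hpos
  · rintro ⟨ω, hω, rfl⟩
    choose u hu using hω
    refine ⟨ω, fun t => u t.1 t.2, fun t => hu t.1 t.2, fun t t' h => ?_⟩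
    exact (edgeLength_of_dual hT (u := fun t => u t.1 t.2) (fun t => hu t.1 t.2) h).2

end Lengths

/-! ### The dimension of the cone as a rank -/

section Rank

instance {V : Type*} [Finite V] (G : SimpleGraph V) : Finite (SkeletonEdge G) :=
  inferInstanceAs (Finite (Quot (Concatenated G)))

theorem skeletonLengths_apply {V : Type*} [Finite V] (G : SimpleGraph V) (x : G.edgeSet → ℝ)
    (s : SkeletonEdge G) :
    skeletonLengths G x s = ∑ᶠ e ∈ {e : (core G).edgeSet | Quot.mk (Concatenated G) e = s},
      x ⟨e.1, SimpleGraph.edgeSet_mono (core_le G) e.2⟩ := rfl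

variable {P : Set (ℝ × ℝ)}

/-- Edge lengths of the skeleton as a linear function of the heights. -/
noncomputable def skeletonMap (T : Finset (Finset (latticePoints P))) :
    (latticePoints P → ℝ) →ₗ[ℝ] (SkeletonEdge (dualGraph T) → ℝ) where
  toFun ω := skeletonLengths (dualGraph T) fun e => edgeLength T e.1 ω
  map_add' ω ω' := by
    funext s
    simp only [skeletonLengths_apply, Pi.add_apply, map_add]
    exact finsum_mem_add_distrib (Set.toFinite _)
  map_smul' c ω := by
    funext s
    simp only [skeletonLengths_apply, Pi.smul_apply, map_smul, RingHom.id_apply, smul_eq_mul]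
    exact (mul_finsum_mem _ _).symm

theorem skeletonMap_apply (T : Finset (Finset (latticePoints P))) (ω : latticePoints P → ℝ)
    (s : SkeletonEdge (dualGraph T)) :
    skeletonMap T ω s = ∑ᶠ e ∈ {e : (core (dualGraph T)).edgeSet |
      Quot.mk (Concatenated (dualGraph T)) e = s}, edgeLength T e.1 ω := rfl

variable {T : Finset (Finset (latticePoints P))}

/-- Every function on the vertices of a unimodular triangle is the restriction of an affine
function. -/
theorem exists_interpolation {t : Finset (latticePoints P)} (ht : IsUnimodularTriangle t)
    (ω : latticePoints P → ℝ) : ∃ (u : ℝ × ℝ) (m : ℝ), ∀ p ∈ t, monomialValue ω p u = m := by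
  obtain ⟨a, b, c, ht, hD⟩ := ht
  have hne := doubleArea_ne_of_abs hD
  set δ : ℝ := (doubleArea a.1 b.1 c.1 : ℝ) with hδ
  have hδ' : δ = (b.1.1 - a.1.1) * (c.1.2 - a.1.2) - (b.1.2 - a.1.2) * (c.1.1 - a.1.1) := by
    rw [hδ]; simp [doubleArea]
  set x : ℝ := (-(ω b - ω a) * (c.1.2 - a.1.2) + (ω c - ω a) * (b.1.2 - a.1.2)) / δ with hx
  set y : ℝ := ((ω b - ω a) * (c.1.1 - a.1.1) - (ω c - ω a) * (b.1.1 - a.1.1)) / δ with hy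
  have hx' : δ * x = -(ω b - ω a) * (c.1.2 - a.1.2) + (ω c - ω a) * (b.1.2 - a.1.2) := by
    rw [hx]; field_simp
  have hy' : δ * y = (ω b - ω a) * (c.1.1 - a.1.1) - (ω c - ω a) * (b.1.1 - a.1.1) := by
    rw [hy]; field_simp
  refine ⟨(x, y), ω a + a.1.1 * x + a.1.2 * y, fun p hp => ?_⟩
  rw [← Finset.mem_coe, ht] at hp
  simp only [monomialValue]
  rcases hp with rfl | rfl | rfl
  · rfl
  · apply mul_left_cancel₀ hne
    linear_combination ((p.1.1 : ℝ) - a.1.1) * hx' + ((p.1.2 : ℝ) - a.1.2) * hy' +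
      (ω p - ω a) * hδ'
  · apply mul_left_cancel₀ hne
    linear_combination ((p.1.1 : ℝ) - a.1.1) * hx' + ((p.1.2 : ℝ) - a.1.2) * hy' +
      (ω p - ω a) * hδ'

theorem monomialValue_add_smul (ω ω' : latticePoints P → ℝ) (p : latticePoints P)
    (u u' : ℝ × ℝ) (ε : ℝ) :
    monomialValue (ω + ε • ω') p (u + ε • u') =
      monomialValue ω p u + ε * monomialValue ω' p u' := by
  simp only [monomialValue, Pi.add_apply, Pi.smul_apply, smul_eq_mul, Prod.fst_add, Prod.snd_add,
    Prod.smul_fst, Prod.smul_snd]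
  ring

/-- Small perturbations of a height function induce the same triangulation. -/
theorem Induces.eventually [Finite (latticePoints P)] (hT : IsUnimodularTriangulation P T)
    {ω : latticePoints P → ℝ} (hω : Induces ω T) (ω' : latticePoints P → ℝ) :
    ∀ᶠ ε : ℝ in 𝓝[>] 0, Induces (ω + ε • ω') T := by
  simp only [Induces]
  rw [Filter.eventually_all_finset]
  intro t ht
  obtain ⟨u, m, hm, hlt⟩ := hω t ht
  -- Moving the dual vertex along with the interpolation of `ω'` on `t` preserves equality on `t`;
  -- the finitely many strict inequalities survive for small ε.
  obtain ⟨u', m', hm'⟩ := exists_interpolation (hT.unimodular t ht) ω'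
  have hev : ∀ p : latticePoints P, ∀ᶠ ε : ℝ in 𝓝[>] 0, p ∉ t →
      m + ε * m' < monomialValue ω p u + ε * monomialValue ω' p u' := by
    intro p
    by_cases hp : p ∈ t
    · exact Eventually.of_forall fun _ h => absurd hp h
    have c1 : Continuous fun ε : ℝ => m + ε * m' := by fun_prop
    have c2 : Continuous fun ε : ℝ => monomialValue ω p u + ε * monomialValue ω' p u' := by fun_prop
    have := (c1.tendsto 0).eventually_lt (c2.tendsto 0) (by simpa using hlt p hp)
    filter_upwards [this.filter_mono nhdsWithin_le_nhds] with ε hε _ using hε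
  filter_upwards [Filter.eventually_all.2 hev] with ε hε
  refine ⟨u + ε • u', m + ε * m', fun p hp => ?_, fun p hp => ?_⟩
  · rw [monomialValue_add_smul, hm p hp, hm' p hp]
  · rw [monomialValue_add_smul]
    exact hε p hp

/-- Every ω' is recovered as a multiple of the difference of two inducing heights, ω + ε ω' and ω.
-/
theorem span_induces [Finite (latticePoints P)] (hT : IsRegularUnimodularTriangulation P T) :
    Submodule.span ℝ {ω : latticePoints P → ℝ | Induces ω T} = ⊤ := by
  obtain ⟨hT, ω, hω⟩ := hT
  rw [eq_top_iff]
  rintro ω' -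
  obtain ⟨ε, hε, hpos⟩ := ((hω.eventually hT ω').and self_mem_nhdsWithin).exists
  have h1 : ω + ε • ω' ∈ Submodule.span ℝ {ω : latticePoints P → ℝ | Induces ω T} :=
    Submodule.subset_span hε
  have h2 : ω ∈ Submodule.span ℝ {ω : latticePoints P → ℝ | Induces ω T} :=
    Submodule.subset_span hω
  have h3 := Submodule.smul_mem _ ε⁻¹ (Submodule.sub_mem _ h1 h2)
  have hpos' : ε ≠ 0 := (Set.mem_Ioi.1 hpos).ne'
  rwa [add_sub_cancel_left, smul_smul, inv_mul_cancel₀ hpos', one_smul] at h3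

/-- The image of a spanning set spans the range, and taking the closure adds nothing since subspaces
of a finite-dimensional space are closed. -/
theorem coneDim_eq_finrank_range [Finite (latticePoints P)]
    (hT : IsRegularUnimodularTriangulation P T) :
    coneDim T = Module.finrank ℝ (LinearMap.range (skeletonMap T)) := by
  have := Fintype.ofFinite (latticePoints P)
  have himg : skeletonLengths (dualGraph T) '' curveEdgeLengths T =
      skeletonMap T '' {ω | Induces ω T} := by
    rw [curveEdgeLengths_eq hT.1, Set.image_image]
    rfl
  have hspan : Submodule.span ℝ (moduliCone T) = LinearMap.range (skeletonMap T) := by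
    have h1 : Submodule.span ℝ (skeletonLengths (dualGraph T) '' curveEdgeLengths T) =
        LinearMap.range (skeletonMap T) := by
      rw [himg, Submodule.span_image, span_induces hT, LinearMap.range_eq_map]
    rw [← h1]
    apply le_antisymm
    · rw [Submodule.span_le]
      exact closure_minimal Submodule.subset_span (Submodule.closed_of_finiteDimensional _)
    · exact Submodule.span_mono subset_closure
  rw [coneDim, hspan]

/-- Affine functions give lengths zero, so the dimension is at most the number of lattice points
minus three. -/
theorem three_le_finrank_ker [Finite (latticePoints P)]
    (hT : IsUnimodularTriangulation P T) (hne : T.Nonempty) :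
    3 ≤ Module.finrank ℝ (LinearMap.ker (skeletonMap T)) := by
  have := Fintype.ofFinite (latticePoints P)
  let φ : (ℝ × ℝ × ℝ) →ₗ[ℝ] (latticePoints P → ℝ) :=
    { toFun := fun v p => v.1 * p.1.1 + v.2.1 * p.1.2 + v.2.2
      map_add' := fun v w => by funext p; simp; ring
      map_smul' := fun c v => by funext p; simp; ring }
  have hφ : ∀ v, φ v ∈ LinearMap.ker (skeletonMap T) := by
    intro v
    rw [LinearMap.mem_ker]
    funext s
    rw [skeletonMap_apply, Pi.zero_apply]
    refine finsum_mem_eq_zero_of_forall_eq_zero fun e _ => ?_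
    obtain ⟨e, he⟩ := e
    induction e using Sym2.ind with
    | _ t t' =>
      have hadj : (dualGraph T).Adj t t' := he.1
      obtain ⟨a, b, c, d, β, ht, ht', h1, h2⟩ := exists_isQuad hT hadj
      rw [edgeLength_eq hT ⟨t, t', rfl, hadj.1, ht, ht', h1, h2⟩, quadLength_apply]
      have h1' : (c.1.1 : ℝ) + d.1.1 = (2 - β) * a.1.1 + β * b.1.1 := by exact_mod_cast h1
      have h2' : (c.1.2 : ℝ) + d.1.2 = (2 - β) * a.1.2 + β * b.1.2 := by exact_mod_cast h2
      change (v.1 * c.1.1 + v.2.1 * c.1.2 + v.2.2) + (v.1 * d.1.1 + v.2.1 * d.1.2 + v.2.2) -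
        (2 - β) * (v.1 * a.1.1 + v.2.1 * a.1.2 + v.2.2) -
        β * (v.1 * b.1.1 + v.2.1 * b.1.2 + v.2.2) = 0
      linear_combination v.1 * h1' + v.2.1 * h2'
  -- An affine function that vanishes at the vertices of one unimodular triangle is zero.
  have hinj : Function.Injective (φ.codRestrict _ hφ) := by
    rw [← LinearMap.ker_eq_bot, LinearMap.ker_eq_bot']
    intro v hv
    have hv' : ∀ p : latticePoints P, v.1 * p.1.1 + v.2.1 * p.1.2 + v.2.2 = 0 := by
      intro p
      exact congrFun (congrArg Subtype.val hv) p
    obtain ⟨t, ht⟩ := hne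
    obtain ⟨a, b, c, -, hD⟩ := hT.unimodular t ht
    have hδ := doubleArea_ne_of_abs hD
    have ea := hv' a
    have eb := hv' b
    have ec := hv' c
    simp only [doubleArea] at hδ
    push_cast at hδ
    have h1 : v.1 = 0 := by
      refine (mul_eq_zero.1 ?_).resolve_right hδ
      linear_combination ((c.1.2 : ℝ) - a.1.2) * (eb - ea) - ((b.1.2 : ℝ) - a.1.2) * (ec - ea)
    have h2 : v.2.1 = 0 := by
      refine (mul_eq_zero.1 ?_).resolve_right hδ
      linear_combination ((b.1.1 : ℝ) - a.1.1) * (ec - ea) - ((c.1.1 : ℝ) - a.1.1) * (eb - ea)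
    have h3 : v.2.2 = 0 := by rw [h1, h2] at ea; linarith
    exact Prod.ext h1 (Prod.ext h2 h3)
  have := LinearMap.finrank_le_finrank_of_injective hinj
  simpa [Module.finrank_prod] using this

theorem coneDim_add_finrank_ker [Finite (latticePoints P)]
    (hT : IsRegularUnimodularTriangulation P T) :
    coneDim T + Module.finrank ℝ (LinearMap.ker (skeletonMap T)) = Nat.card (latticePoints P) := by
  have := Fintype.ofFinite (latticePoints P)
  rw [coneDim_eq_finrank_range hT, LinearMap.finrank_range_add_finrank_ker,
    Module.finrank_fintype_fun_eq_card, Nat.card_eq_fintype_card]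

end Rank

end TropicalModuli

namespace TropicalModuli

/-! ### Triangulations of polygons in a strip of width two -/

section Strip

variable {P : Set (ℝ × ℝ)}

theorem triple_swap_right (a b c : latticePoints P) :
    ({a, b, c} : Finset (latticePoints P)) = {a, c, b} := by
  rw [Finset.pair_comm]

theorem triple_swap_left (a b c : latticePoints P) :
    ({a, b, c} : Finset (latticePoints P)) = {b, a, c} := by
  rw [Finset.insert_comm]

theorem triple_rotate (a b c : latticePoints P) :
    ({a, b, c} : Finset (latticePoints P)) = {b, c, a} := by
  rw [triple_swap_left, triple_swap_right]

/-- In coordinates `X`, `Y`, the point `p` is one of `(1, 0), …, (g, 0)`. -/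
def InnerPoint (g : ℤ) (X Y : latticePoints P → ℤ) (p : latticePoints P) : Prop :=
  Y p = 0 ∧ 1 ≤ X p ∧ X p ≤ g

/-- The segment `ab` contains an inner point, or it crosses the axis strictly between two of
them. -/
def InnerPair (g : ℤ) (X Y : latticePoints P → ℤ) (a b : latticePoints P) : Prop :=
  InnerPoint g X Y a ∨ InnerPoint g X Y b ∨
    (Y a + Y b = 0 ∧ Y a ≠ 0 ∧ 2 < X a + X b ∧ X a + X b < 2 * g)

/-- Twice the signed area of a triangle in coordinates `X`, `Y`. -/
def coordArea (X Y : latticePoints P → ℤ) (a b c : latticePoints P) : ℤ :=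
  (X b - X a) * (Y c - Y a) - (Y b - Y a) * (X c - X a)

/-- Unimodular coordinates `X`, `Y` on the lattice points of a polygon with a triangulation `T`,
in which the polygon lies in the strip `-1 ≤ Y ≤ 1` and has the interior lattice points
`(1, 0), …, (g, 0)`; with the local properties of `T` in these coordinates. -/
structure Strip (P : Set (ℝ × ℝ)) (T : Finset (Finset (latticePoints P))) (g : ℤ) where
  X : latticePoints P → ℤ
  Y : latticePoints P → ℤ
  two_le : 2 ≤ g
  triangulation : IsUnimodularTriangulation P T
  ext : ∀ p q, X p = X q → Y p = Y q → p = q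
  Y_cases : ∀ p, Y p = -1 ∨ Y p = 0 ∨ Y p = 1
  abs_area : ∀ a b c, {a, b, c} ∈ T → |coordArea X Y a b c| = 1
  relation : ∀ (a b c d : latticePoints P) (β : ℤ),
    X c + X d = (2 - β) * X a + β * X b → Y c + Y d = (2 - β) * Y a + β * Y b →
    c.1.1 + d.1.1 = (2 - β) * a.1.1 + β * b.1.1 ∧ c.1.2 + d.1.2 = (2 - β) * a.1.2 + β * b.1.2
  segments : ∀ t ∈ T, ∀ t' ∈ T, ∀ a ∈ t, ∀ b ∈ t, ∀ c ∈ t', ∀ d ∈ t', ∀ α β γ δ : ℤ,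
    0 < α → 0 < β → 0 < γ → 0 < δ → α + β = γ + δ → α * X a + β * X b = γ * X c + δ * X d →
    α * Y a + β * Y b = γ * Y c + δ * Y d → (a = c ∨ a = d) ∧ (b = c ∨ b = d)
  apex_unique : ∀ a b c d, {a, b, c} ∈ T → {a, b, d} ∈ T →
    coordArea X Y a b c = coordArea X Y a b d → c = d
  opposite : ∀ a b c, {a, b, c} ∈ T → InnerPair g X Y a b →
    ∃ d, {a, b, d} ∈ T ∧ coordArea X Y a b d = -coordArea X Y a b c
  axis : ∀ p, Y p = 0 → 0 ≤ X p ∧ X p ≤ g + 1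
  sides : ∀ q r, Y q = 1 → Y r = -1 → 0 ≤ X q + X r ∧ X q + X r ≤ 2 * g + 2
  exists_inner : ∀ i, 1 ≤ i → i ≤ g → ∃ p, X p = i ∧ Y p = 0
  left : ∀ p, InnerPoint g X Y p → ∃ q r, {p, q, r} ∈ T ∧
    ((Y q = 0 ∧ X q = X p - 1) ∨ (Y q = 1 ∧ Y r = -1 ∧ X q + X r = 2 * X p - 1))
  right : ∀ p, InnerPoint g X Y p → ∃ q r, {p, q, r} ∈ T ∧
    ((Y q = 0 ∧ X q = X p + 1) ∨ (Y q = 1 ∧ Y r = -1 ∧ X q + X r = 2 * X p + 1))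

namespace Strip

variable {T : Finset (Finset (latticePoints P))} {g : ℤ}

/-- Reflection in the horizontal axis. -/
def flipY (S : Strip P T g) : Strip P T g where
  X := S.X
  Y p := -S.Y p
  two_le := S.two_le
  triangulation := S.triangulation
  ext p q h1 h2 := S.ext p q h1 (neg_injective h2)
  Y_cases p := by have := S.Y_cases p; omega
  abs_area a b c h := by
    rw [← S.abs_area a b c h, ← abs_neg]; simp only [coordArea]; ring_nf
  relation a b c d β h1 h2 := S.relation a b c d β h1 (by linear_combination -h2)
  segments t ht t' ht' a ha b hb c hc d hd α β γ δ h1 h2 h3 h4 h5 h6 h7 :=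
    S.segments t ht t' ht' a ha b hb c hc d hd α β γ δ h1 h2 h3 h4 h5 h6
      (by linear_combination -h7)
  apex_unique a b c d h1 h2 h3 := S.apex_unique a b c d h1 h2
    (by simp only [coordArea] at h3 ⊢; linear_combination -h3)
  opposite a b c h hin := by
    obtain ⟨d, hd, h⟩ := S.opposite a b c h (by
      simp only [InnerPair, InnerPoint] at hin ⊢
      omega)
    exact ⟨d, hd, by simp only [coordArea] at h ⊢; linear_combination -h⟩
  axis p h := S.axis p (by omega)
  sides q r hq hr := by have := S.sides r q (by omega) (by omega); omega
  exists_inner i h1 h2 := by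
    obtain ⟨p, h, h'⟩ := S.exists_inner i h1 h2
    exact ⟨p, h, by omega⟩
  left p hp := by
    obtain ⟨q, r, h, h'⟩ := S.left p (by simp only [InnerPoint] at hp ⊢; omega)
    rcases h' with h' | h'
    · exact ⟨q, r, h, Or.inl (by omega)⟩
    · exact ⟨r, q, by rw [triple_swap_right]; exact h, Or.inr (by omega)⟩
  right p hp := by
    obtain ⟨q, r, h, h'⟩ := S.right p (by simp only [InnerPoint] at hp ⊢; omega)
    rcases h' with h' | h'
    · exact ⟨q, r, h, Or.inl (by omega)⟩
    · exact ⟨r, q, by rw [triple_swap_right]; exact h, Or.inr (by omega)⟩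

/-- Reflection in a vertical axis. -/
def flipX (S : Strip P T g) : Strip P T g where
  X p := g + 1 - S.X p
  Y := S.Y
  two_le := S.two_le
  triangulation := S.triangulation
  ext p q h1 h2 := S.ext p q (by omega) h2
  Y_cases := S.Y_cases
  abs_area a b c h := by
    rw [← S.abs_area a b c h, ← abs_neg]; simp only [coordArea]; ring_nf
  relation a b c d β h1 h2 := S.relation a b c d β (by linear_combination -h1) h2
  segments t ht t' ht' a ha b hb c hc d hd α β γ δ h1 h2 h3 h4 h5 h6 h7 :=
    S.segments t ht t' ht' a ha b hb c hc d hd α β γ δ h1 h2 h3 h4 h5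
      (by linear_combination -h6 + (g + 1) * h5) h7
  apex_unique a b c d h1 h2 h3 := S.apex_unique a b c d h1 h2
    (by simp only [coordArea] at h3 ⊢; linear_combination -h3)
  opposite a b c h hin := by
    obtain ⟨d, hd, h⟩ := S.opposite a b c h (by
      simp only [InnerPair, InnerPoint] at hin ⊢
      omega)
    exact ⟨d, hd, by simp only [coordArea] at h ⊢; linear_combination -h⟩
  axis p h := by have := S.axis p h; omega
  sides q r hq hr := by have := S.sides q r hq hr; omega
  exists_inner i h1 h2 := by
    obtain ⟨p, h, h'⟩ := S.exists_inner (g + 1 - i) (by omega) (by omega)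
    exact ⟨p, by omega, h'⟩
  left p hp := by
    obtain ⟨q, r, h, h'⟩ := S.right p (by simp only [InnerPoint] at hp ⊢; omega)
    exact ⟨q, r, h, by omega⟩
  right p hp := by
    obtain ⟨q, r, h, h'⟩ := S.left p (by simp only [InnerPoint] at hp ⊢; omega)
    exact ⟨q, r, h, by omega⟩

variable (S : Strip P T g)

/-- The interior lattice points of the polygon. -/
def Inner (p : latticePoints P) : Prop := InnerPoint g S.X S.Y p

/-- The segments between lattice points that can be dual to edges of the core. -/
def InnerEdge (a b : latticePoints P) : Prop := InnerPair g S.X S.Y a b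

/-- Twice the signed area in the coordinates of the strip. -/
def area (a b c : latticePoints P) : ℤ := coordArea S.X S.Y a b c

theorem inner_iff {p : latticePoints P} : S.Inner p ↔ S.Y p = 0 ∧ 1 ≤ S.X p ∧ S.X p ≤ g :=
  Iff.rfl

theorem innerEdge_iff {a b : latticePoints P} : S.InnerEdge a b ↔ S.Inner a ∨ S.Inner b ∨
    (S.Y a + S.Y b = 0 ∧ S.Y a ≠ 0 ∧ 2 < S.X a + S.X b ∧ S.X a + S.X b < 2 * g) := Iff.rfl

theorem area_eq (a b c : latticePoints P) : S.area a b c =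
    (S.X b - S.X a) * (S.Y c - S.Y a) - (S.Y b - S.Y a) * (S.X c - S.X a) := rfl

theorem flipY_inner {p : latticePoints P} : S.flipY.Inner p ↔ S.Inner p := by
  simp only [inner_iff, flipY]; omega

theorem flipX_inner {p : latticePoints P} : S.flipX.Inner p ↔ S.Inner p := by
  simp only [inner_iff, flipX]; omega

theorem InnerEdge.symm {S : Strip P T g} {a b : latticePoints P} (h : S.InnerEdge a b) :
    S.InnerEdge b a := by
  rw [innerEdge_iff] at h ⊢
  rcases h with h | h | h
  · exact Or.inr (Or.inl h)
  · exact Or.inl h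
  · exact Or.inr (Or.inr (by omega))

theorem innerEdge_of_left {a : latticePoints P} (b : latticePoints P) (h : S.Inner a) :
    S.InnerEdge a b := Or.inl h

variable {S}

theorem area_cases {a b c : latticePoints P} (S : Strip P T g) (h : {a, b, c} ∈ T) :
    S.area a b c = 1 ∨ S.area a b c = -1 := (abs_eq zero_le_one).1 (S.abs_area a b c h)

theorem ne_of_mem {a b c : latticePoints P} (S : Strip P T g) (h : {a, b, c} ∈ T) :
    a ≠ b ∧ a ≠ c ∧ b ≠ c := by
  have hne := ne_of_doubleArea (S.triangulation.doubleArea_abs h)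
  exact ⟨fun h => hne.1 (by rw [h]), fun h => hne.2.1 (by rw [h]), fun h => hne.2.2 (by rw [h])⟩

theorem exists_triple {t : Finset (latticePoints P)} (S : Strip P T g) (ht : t ∈ T)
    {a b : latticePoints P} (ha : a ∈ t) (hb : b ∈ t) (hab : a ≠ b) : ∃ c, t = {a, b, c} := by
  obtain ⟨c, h, -⟩ := (S.triangulation.unimodular t ht).exists_of_mem_mem ha hb hab
  exact ⟨c, h⟩

theorem exists_triple' {t : Finset (latticePoints P)} (S : Strip P T g) (ht : t ∈ T)
    {a : latticePoints P} (ha : a ∈ t) : ∃ b c, t = {a, b, c} := by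
  obtain ⟨b, c, h, -⟩ := (S.triangulation.unimodular t ht).exists_of_mem ha
  exact ⟨b, c, h⟩

theorem area_opposite {a b c d : latticePoints P} (S : Strip P T g) (hc : {a, b, c} ∈ T)
    (hd : {a, b, d} ∈ T) (hcd : c ≠ d) : S.area a b d = -S.area a b c := by
  have h := fun h => hcd (S.apex_unique a b c d hc hd h)
  change ¬S.area a b c = S.area a b d at h
  rcases S.area_cases hc with h1 | h1 <;> rcases S.area_cases hd with h2 | h2 <;> omega

theorem eq_or_eq_of_mem {a b c d e : latticePoints P} (S : Strip P T g) (hc : {a, b, c} ∈ T)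
    (hd : {a, b, d} ∈ T) (he : {a, b, e} ∈ T) (hcd : c ≠ d) : e = c ∨ e = d := by
  by_contra! hcon
  have h1 := S.area_opposite hc hd hcd
  have h2 := S.area_opposite hc he hcon.1.symm
  exact hcon.2 (S.apex_unique a b e d he hd (h2.trans h1.symm))

theorem exists_neighbor {a b c : latticePoints P} (S : Strip P T g) (h : {a, b, c} ∈ T)
    (hin : S.InnerEdge a b) : ∃ d, {a, b, d} ∈ T ∧ c ≠ d := by
  obtain ⟨d, hd, h'⟩ := S.opposite a b c h hin
  refine ⟨d, hd, ?_⟩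
  rintro rfl
  change S.area a b c = -S.area a b c at h'
  rcases S.area_cases h with h1 | h1 <;> omega

theorem adj_of_ne {a b c d : latticePoints P} (S : Strip P T g) (hc : {a, b, c} ∈ T)
    (hd : {a, b, d} ∈ T) (hcd : c ≠ d) :
    (dualGraph T).Adj ⟨{a, b, c}, hc⟩ ⟨{a, b, d}, hd⟩ := by
  have n1 := S.ne_of_mem hc
  have n2 := S.ne_of_mem hd
  refine ⟨fun h => ?_, ?_⟩
  · have h' : ({a, b, c} : Finset (latticePoints P)) = {a, b, d} := congrArg Subtype.val h
    have : c ∈ ({a, b, d} : Finset (latticePoints P)) := by rw [← h']; simp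
    simp only [Finset.mem_insert, Finset.mem_singleton] at this
    rcases this with h | h | h
    · exact n1.2.1 h.symm
    · exact n1.2.2 h.symm
    · exact hcd h
  · rw [Set.ncard_eq_two]
    refine ⟨a, b, n1.1, ?_⟩
    ext x
    simp only [Finset.coe_insert, Finset.coe_singleton, Set.mem_inter_iff, Set.mem_insert_iff,
      Set.mem_singleton_iff]
    constructor
    · rintro ⟨rfl | rfl | rfl, h⟩
      · simp
      · simp
      · rcases h with h | h | h
        · exact Or.inl h
        · exact Or.inr h
        · exact absurd h hcd
    · rintro (rfl | rfl) <;> simp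

theorem exists_of_adj {t t' : T} (S : Strip P T g) (h : (dualGraph T).Adj t t') :
    ∃ a b c d, t.1 = {a, b, c} ∧ t'.1 = {a, b, d} ∧ c ≠ d := by
  obtain ⟨hne, hcard⟩ := h
  obtain ⟨a, b, hab, hinter⟩ := Set.ncard_eq_two.1 hcard
  have ha : a ∈ (t.1 : Set (latticePoints P)) ∩ t'.1 := by rw [hinter]; simp
  have hb : b ∈ (t.1 : Set (latticePoints P)) ∩ t'.1 := by rw [hinter]; simp
  obtain ⟨c, hc⟩ := S.exists_triple t.2 ha.1 hb.1 hab
  obtain ⟨d, hd⟩ := S.exists_triple t'.2 ha.2 hb.2 hab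
  refine ⟨a, b, c, d, hc, hd, ?_⟩
  rintro rfl
  exact hne (Subtype.ext (hc.trans hd.symm))

/-- The neighbours of a triangle share one of its three sides. -/
theorem adj_cases {a b c : latticePoints P} (S : Strip P T g) (h : {a, b, c} ∈ T) {v : T}
    (hadj : (dualGraph T).Adj ⟨{a, b, c}, h⟩ v) :
    (∃ d, v.1 = {a, b, d} ∧ c ≠ d) ∨ (∃ d, v.1 = {a, c, d} ∧ b ≠ d) ∨
      (∃ d, v.1 = {b, c, d} ∧ a ≠ d) := by
  obtain ⟨a', b', c', d, h1, h2, hcd⟩ := S.exists_of_adj hadj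
  simp only at h1
  have n := S.ne_of_mem h
  have n' := S.ne_of_mem (h1 ▸ h)
  have hmem : c' ∈ ({a, b, c} : Finset (latticePoints P)) := by rw [h1]; simp
  have hall : ∀ x, x ∈ ({a, b, c} : Finset (latticePoints P)) → x = c' ∨ x ∈ v.1 := by
    intro x hx
    rw [h1] at hx
    rw [h2]
    simp only [Finset.mem_insert, Finset.mem_singleton] at hx ⊢
    tauto
  have hcv : c' ∉ v.1 := by
    rw [h2]
    simp only [Finset.mem_insert, Finset.mem_singleton]
    rintro (h | h | h)
    · exact n'.2.1 h.symm
    · exact n'.2.2 h.symm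
    · exact hcd h
  have close : ∀ x y, x ≠ y → x ∈ v.1 → y ∈ v.1 → ∃ d, v.1 = {x, y, d} ∧ c' ≠ d := by
    intro x y hxy hx hy
    obtain ⟨e, he⟩ := S.exists_triple v.2 hx hy hxy
    refine ⟨e, he, ?_⟩
    rintro rfl
    exact hcv (by rw [he]; simp)
  simp only [Finset.mem_insert, Finset.mem_singleton] at hmem
  rcases hmem with rfl | rfl | rfl
  · exact Or.inr (Or.inr (close b c n.2.2 ((hall b (by simp)).resolve_left n.1.symm)
      ((hall c (by simp)).resolve_left n.2.1.symm)))
  · exact Or.inr (Or.inl (close a c n.2.1 ((hall a (by simp)).resolve_left n.1)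
      ((hall c (by simp)).resolve_left n.2.2.symm)))
  · exact Or.inl (close a b n.1 ((hall a (by simp)).resolve_left n.2.1)
      ((hall b (by simp)).resolve_left n.2.2))

/-- At most one neighbour of a triangle shares a given side. -/
theorem neighbor_unique {a b c : latticePoints P} (S : Strip P T g) (h : {a, b, c} ∈ T) {v w : T}
    (hv : (dualGraph T).Adj ⟨{a, b, c}, h⟩ v) (hw : (dualGraph T).Adj ⟨{a, b, c}, h⟩ w)
    (hav : a ∈ v.1) (hbv : b ∈ v.1) (haw : a ∈ w.1) (hbw : b ∈ w.1) : v = w := by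
  have n := S.ne_of_mem h
  obtain ⟨t, ht⟩ := v
  obtain ⟨t', ht'⟩ := w
  obtain ⟨d, rfl⟩ := S.exists_triple ht hav hbv n.1
  obtain ⟨e, rfl⟩ := S.exists_triple ht' haw hbw n.1
  by_contra hvw
  have hde : d ≠ e := by rintro rfl; exact hvw rfl
  rcases S.eq_or_eq_of_mem ht ht' h hde with rfl | rfl
  · exact hv.1 rfl
  · exact hw.1 rfl

/-- A triangle is pruned if all its neighbours but the one across the side `ab` are. -/
theorem pruned_of_forall {a b c : latticePoints P} (S : Strip P T g) (h : {a, b, c} ∈ T)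
    (hall : ∀ v : T, (dualGraph T).Adj ⟨{a, b, c}, h⟩ v →
      Pruned (dualGraph T) v ∨ (a ∈ v.1 ∧ b ∈ v.1)) :
    Pruned (dualGraph T) ⟨{a, b, c}, h⟩ := by
  by_cases hex : ∃ w : T, (dualGraph T).Adj ⟨{a, b, c}, h⟩ w ∧ a ∈ w.1 ∧ b ∈ w.1
  · obtain ⟨w, hw, haw, hbw⟩ := hex
    refine Pruned.prune _ w fun v hv hvw => ?_
    rcases hall v hv with h' | ⟨h1, h2⟩
    · exact h'
    · exact absurd (S.neighbor_unique h hv hw h1 h2 haw hbw) hvw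
  -- Nothing lies across ab, so no exception is needed; the triangle itself fills the slot.
  · refine Pruned.prune _ ⟨{a, b, c}, h⟩ fun v hv hvw => ?_
    rcases hall v hv with h' | h'
    · exact h'
    · exact absurd ⟨v, hv, h'⟩ hex

/-- Triangles with an interior lattice point are not pruned. -/
theorem not_pruned (S : Strip P T g) {v : T} {p : latticePoints P} (hp : p ∈ v.1)
    (hin : S.Inner p) : ¬Pruned (dualGraph T) v := by
  intro h
  induction h generalizing p with
  | prune v w h ih =>
    obtain ⟨t, ht⟩ := v
    obtain ⟨b, c, rfl⟩ := S.exists_triple' ht hp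
    -- The triangles across the two sides at `p` both contain `p`. At most one is the exempted
    -- neighbour `w`; induction applies to the other.
    obtain ⟨d, hd, hcd⟩ := S.exists_neighbor ht (S.innerEdge_of_left b hin)
    have ht' : {p, c, b} ∈ T := by rw [triple_swap_right]; exact ht
    obtain ⟨e, he, hbe⟩ := S.exists_neighbor ht' (S.innerEdge_of_left c hin)
    have hadj1 := S.adj_of_ne ht hd hcd
    have hadj2 := S.adj_of_ne ht' he hbe
    have hsub : (⟨{p, c, b}, ht'⟩ : T) = ⟨{p, b, c}, ht⟩ := Subtype.ext (triple_swap_right _ _ _)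
    rw [hsub] at hadj2
    by_cases hw : (⟨{p, b, d}, hd⟩ : T) = w
    · refine ih _ hadj2 ?_ (p := p) (by simp) hin
      intro h2
      have h3 : ({p, b, d} : Finset (latticePoints P)) = {p, c, e} :=
        congrArg Subtype.val (hw.trans h2.symm)
      have : c ∈ ({p, b, d} : Finset (latticePoints P)) := by rw [h3]; simp
      have n1 := S.ne_of_mem ht
      simp only [Finset.mem_insert, Finset.mem_singleton] at this
      rcases this with h | h | h
      · exact n1.2.1 h.symm
      · exact n1.2.2 h.symm
      · exact hcd h
    · exact ih _ hadj1 hw (p := p) (by simp) hin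

theorem exists_lower_bound [Finite (latticePoints P)] (S : Strip P T g) :
    ∃ B, ∀ p, B ≤ S.X p := by
  obtain ⟨B, hB⟩ := (Set.finite_range S.X).bddBelow
  exact ⟨B, fun p => hB ⟨p, rfl⟩⟩

/-- Pruning of the triangles with a side in the top row and apex at the left end of the axis. -/
theorem pruned_top_left [Finite (latticePoints P)] (S : Strip P T g) {p q q' : latticePoints P}
    (hp : S.Y p = 0) (hp' : S.X p = 0) (hq : S.Y q = 1) (hq' : S.Y q' = 1)
    (hqq : S.X q' = S.X q + 1) (h : {p, q, q'} ∈ T) :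
    Pruned (dualGraph T) ⟨{p, q, q'}, h⟩ := by
  obtain ⟨B, hB⟩ := S.exists_lower_bound
  -- Induction on the distance from `q` to the left end of the polygon.
  obtain ⟨n, hn⟩ : ∃ n : ℕ, S.X q - B = n := ⟨(S.X q - B).toNat, by have := hB q; omega⟩
  induction n using Nat.strong_induction_on generalizing q q' with
  | _ n ih =>
    -- Across pq lies at most the next such triangle to the left, pruned by induction; nothing lies
    -- across qq', where the strip ends; the neighbour across pq' is the exempted one.
    have key : ∀ v : T, (dualGraph T).Adj ⟨{p, q, q'}, h⟩ v →
        Pruned (dualGraph T) v ∨ (p ∈ v.1 ∧ q' ∈ v.1) := by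
      rintro ⟨v, hv⟩ hadj
      rcases S.adj_cases h hadj with ⟨e, he, hne⟩ | ⟨e, he, hne⟩ | ⟨e, he, hne⟩ <;>
        simp only at he <;> subst he
      · left
        have ho := S.area_opposite h hv hne
        simp only [area_eq] at ho
        rcases S.Y_cases e with he | he | he
        · simp only [he, hp, hq, hq', hqq, hp'] at ho
          have := S.sides q e hq he
          omega
        · simp only [he, hp, hq, hq', hqq, hp'] at ho
          have := S.axis e he
          omega
        · simp only [he, hp, hq, hq', hqq, hp'] at ho
          have hsw : (⟨{p, q, e}, hv⟩ : T) = ⟨{p, e, q}, by rw [triple_swap_right]; exact hv⟩ :=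
            Subtype.ext (triple_swap_right _ _ _)
          rw [hsw]
          have := hB e
          exact ih (S.X e - B).toNat (by omega) he hq (by omega) _ (by omega)
      · right
        simp
      · exfalso
        have ho := S.area_opposite (a := q) (b := q') (c := p) (by rw [← triple_rotate]; exact h) hv
          hne
        have hc := S.area_cases hv
        simp only [area_eq] at ho hc
        rcases S.Y_cases e with he | he | he <;>
          simp only [he, hp, hq, hq', hqq] at ho hc <;> omega
    have hsw : (⟨{p, q, q'}, h⟩ : T) = ⟨{p, q', q}, by rw [triple_swap_right]; exact h⟩ :=
      Subtype.ext (triple_swap_right _ _ _)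
    rw [hsw] at key ⊢
    exact S.pruned_of_forall _ key

/-- Triangles without interior lattice point at the left end of the axis are pruned. -/
theorem pruned_left [Finite (latticePoints P)] (S : Strip P T g) {p q r : latticePoints P}
    (hp : S.Y p = 0) (hp' : S.X p = 0) (hq : S.Y q = 1) (hr : S.Y r ≠ 0) (h : {p, q, r} ∈ T) :
    Pruned (dualGraph T) ⟨{p, q, r}, h⟩ := by
  have hA := S.area_cases h
  simp only [area_eq] at hA
  rcases S.Y_cases r with hr' | hr' | hr'
  · have hs := S.sides q r hq hr'
    simp only [hp, hp', hq, hr'] at hA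
    -- Across pq and pr there are only triangles with a side in an outer row, already pruned; the
    -- single exit is across qr.
    have key : ∀ v : T, (dualGraph T).Adj ⟨{p, q, r}, h⟩ v →
        Pruned (dualGraph T) v ∨ (q ∈ v.1 ∧ r ∈ v.1) := by
      rintro ⟨v, hv⟩ hadj
      rcases S.adj_cases h hadj with ⟨e, he, hne⟩ | ⟨e, he, hne⟩ | ⟨e, he, hne⟩ <;>
        simp only at he <;> subst he
      · left
        have ho := S.area_opposite h hv hne
        simp only [area_eq] at ho
        rcases S.Y_cases e with he | he | he <;> simp only [he, hp, hq, hr', hp'] at ho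
        · have := S.sides q e hq he
          omega
        · have := S.axis e he
          omega
        · have hsw : (⟨{p, q, e}, hv⟩ : T) = ⟨{p, e, q}, by rw [triple_swap_right]; exact hv⟩ :=
            Subtype.ext (triple_swap_right _ _ _)
          rw [hsw]
          exact S.pruned_top_left hp hp' he hq (by omega) _
      · left
        have h' : {p, r, q} ∈ T := by rw [triple_swap_right]; exact h
        have ho := S.area_opposite h' hv hne
        simp only [area_eq] at ho
        rcases S.Y_cases e with he | he | he <;> simp only [he, hp, hq, hr', hp'] at ho
        · have hsw : (⟨{p, r, e}, hv⟩ : T) = ⟨{p, e, r}, by rw [triple_swap_right]; exact hv⟩ :=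
            Subtype.ext (triple_swap_right _ _ _)
          rw [hsw]
          exact S.flipY.pruned_top_left (by simp [flipY, hp]) hp' (by simp [flipY, he])
            (by simp [flipY, hr']) (by simp only [flipY]; omega) _
        · have := S.axis e he
          omega
        · have := S.sides e r he hr'
          omega
      · right
        simp
    have hsw : (⟨{p, q, r}, h⟩ : T) = ⟨{q, r, p}, by rw [← triple_rotate]; exact h⟩ :=
      Subtype.ext (triple_rotate _ _ _)
    rw [hsw] at key ⊢
    exact S.pruned_of_forall _ key
  · exact absurd hr' hr
  · simp only [hp, hp', hq, hr'] at hA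
    rcases hA with hA | hA
    · have hsw : (⟨{p, q, r}, h⟩ : T) = ⟨{p, r, q}, by rw [triple_swap_right]; exact h⟩ :=
        Subtype.ext (triple_swap_right _ _ _)
      rw [hsw]
      exact S.pruned_top_left hp hp' hr' hq (by omega) _
    · exact S.pruned_top_left hp hp' hq hr' (by omega) _

/-- Every triangle has a vertex on the axis. -/
theorem exists_axis (S : Strip P T g) {t : Finset (latticePoints P)} (ht : t ∈ T) :
    ∃ p ∈ t, S.Y p = 0 := by
  obtain ⟨a, b, c, h, -⟩ := S.triangulation.unimodular t ht
  have h' : t = {a, b, c} := by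
    ext x
    rw [← Finset.mem_coe, h]
    simp
  subst h'
  have hA := S.area_cases ht
  -- With all vertices in the rows ±1 the differences of Y are even, and so is the doubled area,
  -- which is ±1.
  simp only [area_eq] at hA
  rcases S.Y_cases a with ha | ha | ha
  · rcases S.Y_cases b with hb | hb | hb
    · rcases S.Y_cases c with hc | hc | hc
      · simp only [ha, hb, hc] at hA; omega
      · exact ⟨c, by simp, hc⟩
      · simp only [ha, hb, hc] at hA; omega
    · exact ⟨b, by simp, hb⟩
    · rcases S.Y_cases c with hc | hc | hc
      · simp only [ha, hb, hc] at hA; omega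
      · exact ⟨c, by simp, hc⟩
      · simp only [ha, hb, hc] at hA; omega
  · exact ⟨a, by simp, ha⟩
  · rcases S.Y_cases b with hb | hb | hb
    · rcases S.Y_cases c with hc | hc | hc
      · simp only [ha, hb, hc] at hA; omega
      · exact ⟨c, by simp, hc⟩
      · simp only [ha, hb, hc] at hA; omega
    · exact ⟨b, by simp, hb⟩
    · rcases S.Y_cases c with hc | hc | hc
      · simp only [ha, hb, hc] at hA; omega
      · exact ⟨c, by simp, hc⟩
      · simp only [ha, hb, hc] at hA; omega

/-- Triangles without interior lattice point are pruned. -/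
theorem pruned_of_forall_not_inner [Finite (latticePoints P)] (S : Strip P T g) {v : T}
    (hv : ∀ p ∈ v.1, ¬S.Inner p) : Pruned (dualGraph T) v := by
  obtain ⟨p, hpv, hp⟩ := S.exists_axis v.2
  -- A point of the axis which is not interior is (0,0) or (g+1,0); the reflection exchanges them.
  wlog hp' : S.X p = 0 generalizing S
  · have hpi := hv p hpv
    have hax := S.axis p hp
    rw [inner_iff] at hpi
    exact this S.flipX (fun p hp => by rw [flipX_inner]; exact hv p hp) hp
      (by simp only [flipX]; omega)
  obtain ⟨t, ht⟩ := v
  obtain ⟨q, r, rfl⟩ := S.exists_triple' ht hpv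
  have hA := S.area_cases ht
  simp only [area_eq] at hA
  have hqi := hv q (by simp)
  have hri := hv r (by simp)
  rw [inner_iff] at hqi hri
  have h2 := S.two_le
  have hq0 : S.Y q ≠ 0 := by
    intro hq
    have := S.axis q hq
    rcases S.Y_cases r with hr | hr | hr <;> simp only [hp, hq, hr, hp'] at hA <;> omega
  have hr0 : S.Y r ≠ 0 := by
    intro hr
    have := S.axis r hr
    rcases S.Y_cases q with hq | hq | hq <;> simp only [hp, hq, hr, hp'] at hA <;> omega
  rcases S.Y_cases q with hq | hq | hq
  · exact S.flipY.pruned_left (by simp [flipY, hp]) hp' (by simp [flipY, hq])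
      (by simp only [flipY]; omega) _
  · exact absurd hq hq0
  · exact S.pruned_left hp hp' hq hr0 _

theorem not_pruned_iff [Finite (latticePoints P)] (S : Strip P T g) {v : T} :
    ¬Pruned (dualGraph T) v ↔ ∃ p ∈ v.1, S.Inner p := by
  constructor
  · intro h
    by_contra! hcon
    exact h (S.pruned_of_forall_not_inner hcon)
  · rintro ⟨p, hp, hin⟩
    exact S.not_pruned hp hin

/-- The edges of the core are dual to inner edges of the triangulation. -/
theorem exists_of_core_adj [Finite (latticePoints P)] (S : Strip P T g) {t t' : T}
    (h : (core (dualGraph T)).Adj t t') :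
    ∃ a b c d, t.1 = {a, b, c} ∧ t'.1 = {a, b, d} ∧ c ≠ d ∧ S.InnerEdge a b := by
  obtain ⟨hadj, h1, h2⟩ := h
  obtain ⟨a, b, c, d, ht, ht', hcd⟩ := S.exists_of_adj hadj
  refine ⟨a, b, c, d, ht, ht', hcd, ?_⟩
  obtain ⟨t, htm⟩ := t
  obtain ⟨t', htm'⟩ := t'
  simp only at ht ht'
  subst ht ht'
  -- Otherwise the interior points of the two triangles are the apexes c and d, on opposite sides of
  -- ab. Then ab crosses the axis between two interior points, which makes it inner after all.
  by_contra hin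
  rw [innerEdge_iff, not_or, not_or] at hin
  obtain ⟨ha, hb, hx⟩ := hin
  rw [S.not_pruned_iff] at h1 h2
  have hc : S.Inner c := by
    obtain ⟨p, hp, hpi⟩ := h1
    simp only [Finset.mem_insert, Finset.mem_singleton] at hp
    rcases hp with rfl | rfl | rfl
    · exact absurd hpi ha
    · exact absurd hpi hb
    · exact hpi
  have hd : S.Inner d := by
    obtain ⟨p, hp, hpi⟩ := h2
    simp only [Finset.mem_insert, Finset.mem_singleton] at hp
    rcases hp with rfl | rfl | rfl
    · exact absurd hpi ha
    · exact absurd hpi hb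
    · exact hpi
  have hA := S.area_cases htm
  have ho := S.area_opposite htm htm' hcd
  have axa := S.axis a
  have axb := S.axis b
  simp only [area_eq] at hA ho
  rw [inner_iff] at ha hb hc hd
  rcases S.Y_cases a with ya | ya | ya <;> rcases S.Y_cases b with yb | yb | yb <;>
    simp only [ya, yb, hc.1, hd.1] at hA ho <;> omega

end Strip

end Strip

end TropicalModuli

namespace TropicalModuli

/-! ### Edges of the core, concatenation, and telescoping along arcs. -/

section Strip

variable {P : Set (ℝ × ℝ)}

/-- Both triangles of the pair `e` contain the distinct points `a` and `b`. -/
def HasSide {T : Finset (Finset (latticePoints P))} (e : Sym2 T) (a b : latticePoints P) : Prop :=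
  a ≠ b ∧ ∀ v ∈ e, a ∈ v.1 ∧ b ∈ v.1

theorem HasSide.symm {T : Finset (Finset (latticePoints P))} {e : Sym2 T} {a b : latticePoints P}
    (h : HasSide e a b) : HasSide e b a :=
  ⟨h.1.symm, fun v hv => (h.2 v hv).symm⟩

theorem hasSide_mk {T : Finset (Finset (latticePoints P))} {a b c d : latticePoints P}
    (hab : a ≠ b) (hc : {a, b, c} ∈ T) (hd : {a, b, d} ∈ T) :
    HasSide (s((⟨{a, b, c}, hc⟩ : T), ⟨{a, b, d}, hd⟩)) a b := by
  refine ⟨hab, fun v hv => ?_⟩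
  rw [Sym2.mem_iff] at hv
  rcases hv with rfl | rfl <;> simp

/-- The edge of the skeleton which contains an edge of the core. -/
def skeletonClass {V : Type*} {G : SimpleGraph V} (e : (core G).edgeSet) : SkeletonEdge G :=
  Quot.mk (Concatenated G) e

theorem exists_skeletonClass {V : Type*} {G : SimpleGraph V} (s : SkeletonEdge G) :
    ∃ e : (core G).edgeSet, skeletonClass e = s := Quot.exists_rep s

theorem skeletonClass_eq {V : Type*} {G : SimpleGraph V} {e f : (core G).edgeSet}
    (h : Concatenated G e f) : skeletonClass e = skeletonClass f := Quot.sound h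

/-- If a set of edges of the core is closed under concatenation and consists of equivalent edges,
the length of the corresponding edge of the skeleton is its sum. -/
theorem skeletonMap_skeletonClass {T : Finset (Finset (latticePoints P))}
    {E : Set (core (dualGraph T)).edgeSet} {e : (core (dualGraph T)).edgeSet} (he : e ∈ E)
    (hclosed : ∀ e ∈ E, ∀ f, Concatenated (dualGraph T) e f → f ∈ E)
    (hconn : ∀ f ∈ E, skeletonClass f = skeletonClass e)
    (ω : latticePoints P → ℝ) :
    skeletonMap T ω (skeletonClass e) = ∑ᶠ f ∈ E, edgeLength T f.1 ω := by
  have hE : {f : (core (dualGraph T)).edgeSet | skeletonClass f = skeletonClass e} = E := by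
    ext f
    refine ⟨fun hf => ?_, fun hf => hconn f hf⟩
    -- Concatenation is symmetric, so closedness of `E` passes to the generated equivalence
    -- relation.
    have key : ∀ x y, Relation.EqvGen (Concatenated (dualGraph T)) x y → (x ∈ E ↔ y ∈ E) := by
      intro x y h
      induction h with
      | rel x y h =>
        refine ⟨fun hx => hclosed x hx y h, fun hy => hclosed y hy x ?_⟩
        obtain ⟨v, h1, h2, h3⟩ := h
        exact ⟨v, h2, h1, h3⟩
      | refl x => exact Iff.rfl
      | symm x y _ ih => exact ih.symm
      | trans x y z _ _ ih1 ih2 => exact ih1.trans ih2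
    exact (key f e (Quot.eqvGen_exact hf)).2 he
  exact congrArg (fun E : Set (core (dualGraph T)).edgeSet => ∑ᶠ f ∈ E, edgeLength T f.1 ω) hE

namespace Strip

variable {T : Finset (Finset (latticePoints P))} {g : ℤ}

/-- Each triangle at an inner edge contains an interior lattice point: an end of the edge or, when
the edge crosses the axis between interior points, its apex, which unimodularity places half a unit
from the crossing. -/
theorem core_adj_of_innerEdge {a b c d : latticePoints P} (S : Strip P T g) (hc : {a, b, c} ∈ T)
    (hd : {a, b, d} ∈ T) (hcd : c ≠ d) (hin : S.InnerEdge a b) :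
    (core (dualGraph T)).Adj ⟨{a, b, c}, hc⟩ ⟨{a, b, d}, hd⟩ := by
  have key : ∀ c, ∀ hc : {a, b, c} ∈ T, ¬Pruned (dualGraph T) ⟨{a, b, c}, hc⟩ := by
    intro c hc
    rw [innerEdge_iff] at hin
    rcases hin with h | h | h
    · exact S.not_pruned (p := a) (by simp) h
    · exact S.not_pruned (p := b) (by simp) h
    · refine S.not_pruned (p := c) (by simp) ?_
      have hA := S.area_cases hc
      simp only [area_eq] at hA
      rw [inner_iff]
      rcases S.Y_cases a with ya | ya | ya <;> rcases S.Y_cases b with yb | yb | yb <;>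
        rcases S.Y_cases c with yc | yc | yc <;>
        simp only [ya, yb, yc] at hA <;> omega
  exact ⟨S.adj_of_ne hc hd hcd, key c hc, key d hd⟩

theorem exists_edge {a b c : latticePoints P} (S : Strip P T g) (hc : {a, b, c} ∈ T)
    (hin : S.InnerEdge a b) : ∃ e : (core (dualGraph T)).edgeSet, HasSide e.1 a b := by
  obtain ⟨d, hd, hcd⟩ := S.exists_neighbor hc hin
  exact ⟨⟨_, S.core_adj_of_innerEdge hc hd hcd hin⟩, hasSide_mk (S.ne_of_mem hc).1 hc hd⟩

theorem exists_rep (S : Strip P T g) {e : (core (dualGraph T)).edgeSet} {a b : latticePoints P}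
    (h : HasSide e.1 a b) : ∃ c d, ∃ (hc : {a, b, c} ∈ T) (hd : {a, b, d} ∈ T), c ≠ d ∧
      e.1 = s(⟨{a, b, c}, hc⟩, ⟨{a, b, d}, hd⟩) := by
  obtain ⟨e, he⟩ := e
  induction e using Sym2.ind with
  | _ t t' =>
    obtain ⟨hab, h⟩ := h
    obtain ⟨t, ht⟩ := t
    obtain ⟨t', ht'⟩ := t'
    have h1 := h ⟨t, ht⟩ (by simp)
    have h2 := h ⟨t', ht'⟩ (by simp)
    obtain ⟨c, rfl⟩ := S.exists_triple ht h1.1 h1.2 hab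
    obtain ⟨d, rfl⟩ := S.exists_triple ht' h2.1 h2.2 hab
    refine ⟨c, d, ht, ht', ?_, rfl⟩
    rintro rfl
    exact he.1.1 rfl

theorem mem_of_hasSide (S : Strip P T g) {e : (core (dualGraph T)).edgeSet} {a b : latticePoints P}
    (h : HasSide e.1 a b) {v : T} (ha : a ∈ v.1) (hb : b ∈ v.1) : v ∈ e.1 := by
  obtain ⟨c, d, hc, hd, hcd, he⟩ := S.exists_rep h
  obtain ⟨t, ht⟩ := v
  obtain ⟨x, rfl⟩ := S.exists_triple ht ha hb h.1
  rw [he, Sym2.mem_iff]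
  rcases S.eq_or_eq_of_mem hc hd ht hcd with rfl | rfl
  · exact Or.inl rfl
  · exact Or.inr rfl

/-- At most two triangles share a given side, so the side determines the edge. -/
theorem edge_unique (S : Strip P T g) {e f : (core (dualGraph T)).edgeSet}
    {a b : latticePoints P} (he : HasSide e.1 a b) (hf : HasSide f.1 a b) : e = f := by
  obtain ⟨c, d, hc, hd, hcd, h⟩ := S.exists_rep he
  have h1 := S.mem_of_hasSide hf (v := ⟨{a, b, c}, hc⟩) (by simp) (by simp)
  have h2 := S.mem_of_hasSide hf (v := ⟨{a, b, d}, hd⟩) (by simp) (by simp)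
  have hne : (⟨{a, b, c}, hc⟩ : T) ≠ ⟨{a, b, d}, hd⟩ := (S.adj_of_ne hc hd hcd).1
  exact Subtype.ext (h.trans ((Sym2.mem_and_mem_iff hne).1 ⟨h1, h2⟩).symm)

theorem hasSide_cases (S : Strip P T g) {e : (core (dualGraph T)).edgeSet}
    {a b x y : latticePoints P} (h : HasSide e.1 a b) (h' : HasSide e.1 x y) :
    (x = a ∧ y = b) ∨ (x = b ∧ y = a) := by
  obtain ⟨c, d, hc, hd, hcd, he⟩ := S.exists_rep h
  have h1 := h'.2 ⟨{a, b, c}, hc⟩ (by rw [he]; simp)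
  have h2 := h'.2 ⟨{a, b, d}, hd⟩ (by rw [he]; simp)
  have hne := h'.1
  simp only [Finset.mem_insert, Finset.mem_singleton] at h1 h2
  have n1 := S.ne_of_mem hc
  have n2 := S.ne_of_mem hd
  have key : ∀ x, (x = a ∨ x = b ∨ x = c) → (x = a ∨ x = b ∨ x = d) → x = a ∨ x = b := by
    rintro x (rfl | rfl | rfl) hx
    · exact Or.inl rfl
    · exact Or.inr rfl
    · rcases hx with h | h | h
      · exact Or.inl h
      · exact Or.inr h
      · exact absurd h hcd
  rcases key x h1.1 h2.1 with rfl | rfl <;> rcases key y h1.2 h2.2 with rfl | rfl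
  · exact absurd rfl hne
  · exact Or.inl ⟨rfl, rfl⟩
  · exact Or.inr ⟨rfl, rfl⟩
  · exact absurd rfl hne

theorem exists_side [Finite (latticePoints P)] (S : Strip P T g)
    (e : (core (dualGraph T)).edgeSet) : ∃ a b, HasSide e.1 a b ∧ S.InnerEdge a b := by
  obtain ⟨e, he⟩ := e
  induction e using Sym2.ind with
  | _ t t' =>
    obtain ⟨a, b, c, d, ht, ht', hcd, hin⟩ := S.exists_of_core_adj he
    obtain ⟨t, htm⟩ := t
    obtain ⟨t', htm'⟩ := t'
    simp only at ht ht'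
    subst ht ht'
    exact ⟨a, b, hasSide_mk (S.ne_of_mem htm).1 htm htm', hin⟩

theorem innerEdge_of_hasSide [Finite (latticePoints P)] (S : Strip P T g)
    {e : (core (dualGraph T)).edgeSet} {a b : latticePoints P} (h : HasSide e.1 a b) :
    S.InnerEdge a b := by
  obtain ⟨x, y, h', hin⟩ := S.exists_side e
  rcases S.hasSide_cases h' h with ⟨rfl, rfl⟩ | ⟨rfl, rfl⟩
  · exact hin
  · exact hin.symm

theorem exists_core_neighbor {a b c : latticePoints P} (S : Strip P T g) (h : {a, b, c} ∈ T)
    (hin : S.InnerEdge a b) :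
    ∃ w : T, (core (dualGraph T)).Adj ⟨{a, b, c}, h⟩ w ∧ a ∈ w.1 ∧ b ∈ w.1 ∧ c ∉ w.1 := by
  obtain ⟨d, hd, hcd⟩ := S.exists_neighbor h hin
  refine ⟨_, S.core_adj_of_innerEdge h hd hcd hin, by simp, by simp, ?_⟩
  have n := S.ne_of_mem h
  simp only [Finset.mem_insert, Finset.mem_singleton]
  rintro (h | h | h)
  · exact n.2.1 h.symm
  · exact n.2.2 h.symm
  · exact hcd h

/-- A triangle with three inner sides has degree three in the core. -/
theorem ncard_neighborSet_ne_two {a b c : latticePoints P} (S : Strip P T g) (h : {a, b, c} ∈ T)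
    (hab : S.InnerEdge a b) (hac : S.InnerEdge a c) (hbc : S.InnerEdge b c) :
    ((core (dualGraph T)).neighborSet ⟨{a, b, c}, h⟩).ncard ≠ 2 := by
  intro hcard
  obtain ⟨x, y, hxy, hset⟩ := Set.ncard_eq_two.1 hcard
  have h' : {a, c, b} ∈ T := by rw [triple_swap_right]; exact h
  have h'' : {b, c, a} ∈ T := by rw [← triple_rotate]; exact h
  have e' : (⟨{a, c, b}, h'⟩ : T) = ⟨{a, b, c}, h⟩ := Subtype.ext (triple_swap_right _ _ _)
  have e'' : (⟨{b, c, a}, h''⟩ : T) = ⟨{a, b, c}, h⟩ := Subtype.ext (triple_rotate _ _ _).symm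
  obtain ⟨u, hu, hu1, hu2, hu3⟩ := S.exists_core_neighbor h hab
  obtain ⟨v, hv, hv1, hv2, hv3⟩ := S.exists_core_neighbor h' hac
  obtain ⟨w, hw, hw1, hw2, hw3⟩ := S.exists_core_neighbor h'' hbc
  rw [e'] at hv
  rw [e''] at hw
  have mu : u ∈ ({x, y} : Set T) := by rw [← hset]; exact hu
  have mv : v ∈ ({x, y} : Set T) := by rw [← hset]; exact hv
  have mw : w ∈ ({x, y} : Set T) := by rw [← hset]; exact hw
  rw [Set.mem_insert_iff, Set.mem_singleton_iff] at mu mv mw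
  have huv : u ≠ v := fun h => hv3 (h ▸ hu2)
  have huw : u ≠ w := fun h => hw3 (h ▸ hu1)
  have hvw : v ≠ w := fun h => hw3 (h ▸ hv1)
  rcases mu with rfl | rfl <;> rcases mv with rfl | rfl <;> rcases mw with rfl | rfl <;> simp_all

/-- A triangle with exactly two inner sides has degree two in the core. -/
theorem ncard_neighborSet_eq_two [Finite (latticePoints P)] {a b c : latticePoints P}
    (S : Strip P T g) (h : {a, b, c} ∈ T)
    (hab : S.InnerEdge a b) (hac : S.InnerEdge a c) (hbc : ¬S.InnerEdge b c) :
    ((core (dualGraph T)).neighborSet ⟨{a, b, c}, h⟩).ncard = 2 := by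
  have h' : {a, c, b} ∈ T := by rw [triple_swap_right]; exact h
  have e' : (⟨{a, c, b}, h'⟩ : T) = ⟨{a, b, c}, h⟩ := Subtype.ext (triple_swap_right _ _ _)
  obtain ⟨u, hu, hu1, hu2, hu3⟩ := S.exists_core_neighbor h hab
  obtain ⟨v, hv, hv1, hv2, hv3⟩ := S.exists_core_neighbor h' hac
  rw [e'] at hv
  rw [Set.ncard_eq_two]
  refine ⟨u, v, fun h => hv3 (h ▸ hu2), ?_⟩
  ext w
  simp only [SimpleGraph.mem_neighborSet, Set.mem_insert_iff, Set.mem_singleton_iff]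
  constructor
  · intro hw
    rcases S.adj_cases h hw.1 with ⟨d, hd, hne⟩ | ⟨d, hd, hne⟩ | ⟨d, hd, hne⟩
    · exact Or.inl (S.neighbor_unique h hw.1 hu.1 (by simp [hd]) (by simp [hd]) hu1 hu2)
    · right
      have hw' := hw.1
      have hv' := hv.1
      rw [← e'] at hw' hv'
      exact S.neighbor_unique h' hw' hv' (by simp [hd]) (by simp [hd]) hv1 hv2
    · exfalso
      apply hbc
      refine S.innerEdge_of_hasSide (e := ⟨s(_, w), hw⟩) ⟨(S.ne_of_mem h).2.2, fun x hx => ?_⟩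
      rw [Sym2.mem_iff] at hx
      rcases hx with rfl | rfl
      · simp
      · simp [hd]
  · rintro (rfl | rfl)
    · exact hu
    · exact hv

theorem concatenated [Finite (latticePoints P)] {a b c : latticePoints P}
    (S : Strip P T g) (h : {a, b, c} ∈ T) (hbc : ¬S.InnerEdge b c)
    {e f : (core (dualGraph T)).edgeSet} (he : HasSide e.1 a b) (hf : HasSide f.1 a c) :
    Concatenated (dualGraph T) e f :=
  ⟨⟨{a, b, c}, h⟩, S.mem_of_hasSide he (by simp) (by simp),
    S.mem_of_hasSide hf (by simp) (by simp),
    S.ncard_neighborSet_eq_two h (S.innerEdge_of_hasSide he) (S.innerEdge_of_hasSide hf) hbc⟩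

/-- The common triangle has degree two, so not all its sides are inner: if `f` crosses a side other
than ab, the third side is not inner. -/
theorem concatenated_cases [Finite (latticePoints P)] {a b : latticePoints P}
    (S : Strip P T g) {e f : (core (dualGraph T)).edgeSet} (he : HasSide e.1 a b)
    (hef : Concatenated (dualGraph T) e f) : f = e ∨ ∃ c, {a, b, c} ∈ T ∧
      ((HasSide f.1 a c ∧ ¬S.InnerEdge b c) ∨ (HasSide f.1 b c ∧ ¬S.InnerEdge a c)) := by
  obtain ⟨⟨v, hv⟩, hve, hvf, hdeg⟩ := hef
  obtain ⟨ha, hb⟩ := he.2 _ hve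
  obtain ⟨c, rfl⟩ := S.exists_triple hv ha hb he.1
  have hab := S.innerEdge_of_hasSide he
  obtain ⟨x, y, hxy, hin⟩ := S.exists_side f
  have hm := hxy.2 _ hvf
  have hxyne := hxy.1
  simp only [Finset.mem_insert, Finset.mem_singleton] at hm
  have r1 : HasSide f.1 a b → f = e := fun h => S.edge_unique h he
  have r2 : HasSide f.1 a c → HasSide f.1 a c ∧ ¬S.InnerEdge b c := fun h =>
    ⟨h, fun hbc => S.ncard_neighborSet_ne_two hv hab (S.innerEdge_of_hasSide h) hbc hdeg⟩
  have r3 : HasSide f.1 b c → HasSide f.1 b c ∧ ¬S.InnerEdge a c := fun h =>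
    ⟨h, fun hac => S.ncard_neighborSet_ne_two hv hab hac (S.innerEdge_of_hasSide h) hdeg⟩
  obtain ⟨hx, hy⟩ := hm
  rcases hx with rfl | rfl | rfl <;> rcases hy with rfl | rfl | rfl
  · exact absurd rfl hxyne
  · exact Or.inl (r1 hxy)
  · exact Or.inr ⟨y, hv, Or.inl (r2 hxy)⟩
  · exact Or.inl (r1 hxy.symm)
  · exact absurd rfl hxyne
  · exact Or.inr ⟨y, hv, Or.inr (r3 hxy)⟩
  · exact Or.inr ⟨x, hv, Or.inl (r2 hxy.symm)⟩
  · exact Or.inr ⟨x, hv, Or.inr (r3 hxy.symm)⟩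
  · exact absurd rfl hxyne

/-! ### Arcs of edges around an interior lattice point -/

/-- The slope at which a triangle `p q c` ends an arc of edges around `p`. -/
def capValue (S : Strip P T g) (p q c : latticePoints P) (ω : latticePoints P → ℝ) : ℝ :=
  ω c - ω p - S.Y c * (ω q - ω p)

theorem isQuad_of_hasSide (S : Strip P T g) {e : (core (dualGraph T)).edgeSet}
    {a b c d : latticePoints P} (he : HasSide e.1 a b) (hc : {a, b, c} ∈ T) (hd : {a, b, d} ∈ T)
    (hcd : c ≠ d) {β : ℤ} (hX : S.X c + S.X d = (2 - β) * S.X a + β * S.X b)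
    (hY : S.Y c + S.Y d = (2 - β) * S.Y a + β * S.Y b) : IsQuad T e.1 a b c d β := by
  have h1 := S.mem_of_hasSide he (v := ⟨{a, b, c}, hc⟩) (by simp) (by simp)
  have h2 := S.mem_of_hasSide he (v := ⟨{a, b, d}, hd⟩) (by simp) (by simp)
  have hne : (⟨{a, b, c}, hc⟩ : T) ≠ ⟨{a, b, d}, hd⟩ := (S.adj_of_ne hc hd hcd).1
  have hrel := S.relation a b c d β hX hY
  exact ⟨_, _, (Sym2.mem_and_mem_iff hne).1 ⟨h1, h2⟩, hne, rfl, rfl, hrel.1, hrel.2⟩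

/-- The length splits into one contribution from each adjoining triangle. In a triangle between two
consecutive spokes these contributions are opposite, which is why arcs telescope. -/
theorem edgeLength_spoke (S : Strip P T g) {e : (core (dualGraph T)).edgeSet}
    {p q c d : latticePoints P} (hp : S.Y p = 0) (hq : S.Y q = 1) (he : HasSide e.1 p q)
    (hc : {p, q, c} ∈ T) (hd : {p, q, d} ∈ T) (hcA : S.area p q c = 1) (hdA : S.area p q d = -1)
    (ω : latticePoints P → ℝ) :
    edgeLength T e.1 ω = S.capValue p q c ω + S.capValue p q d ω := by
  have hcd : c ≠ d := by rintro rfl; omega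
  simp only [area_eq, hp, hq] at hcA hdA
  rw [edgeLength_eq S.triangulation (S.isQuad_of_hasSide he hc hd hcd (β := S.Y c + S.Y d)
    (by linear_combination -hcA - hdA) (by rw [hp, hq]; ring)), quadLength_apply]
  simp only [capValue]
  push_cast
  ring

/-- The edges of the core dual to segments from `p` to the top row. -/
def topArc (S : Strip P T g) (p : latticePoints P) : Set (core (dualGraph T)).edgeSet :=
  {e | ∃ q, S.Y q = 1 ∧ HasSide e.1 p q}

theorem exists_upper_bound [Finite (latticePoints P)] (S : Strip P T g) :
    ∃ B, ∀ p, S.X p ≤ B := by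
  obtain ⟨B, hB⟩ := (Set.finite_range S.X).bddAbove
  exact ⟨B, fun p => hB ⟨p, rfl⟩⟩

theorem exists_right_apex (S : Strip P T g) {p q c : latticePoints P} (hp : S.Inner p)
    (h : {p, q, c} ∈ T) : ∃ d, {p, q, d} ∈ T ∧ S.area p q d = -1 := by
  rcases S.area_cases h with hA | hA
  · obtain ⟨d, hd, hcd⟩ := S.exists_neighbor h (S.innerEdge_of_left q hp)
    exact ⟨d, hd, by rw [S.area_opposite h hd hcd, hA]⟩
  · exact ⟨c, h, hA⟩

/-- The triangles from a segment `pq` clockwise around `p` as far as they have a side in the top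
row. -/
theorem exists_walk [Finite (latticePoints P)] (S : Strip P T g) {p q c : latticePoints P}
    (hp : S.Inner p) (hq : S.Y q = 1) (h : {p, q, c} ∈ T) :
    ∃ (n : ℕ) (w : ℕ → latticePoints P) (d : latticePoints P), w 0 = q ∧
      (∀ k ≤ n, S.Y (w k) = 1 ∧ S.X (w k) = S.X q + k) ∧
      (∀ k < n, {p, w k, w (k + 1)} ∈ T) ∧ {p, w n, d} ∈ T ∧ S.area p (w n) d = -1 ∧
      S.Y d ≠ 1 := by
  obtain ⟨B, hB⟩ := S.exists_upper_bound
  obtain ⟨m, hm⟩ : ∃ m : ℕ, B - S.X q = m := ⟨(B - S.X q).toNat, by have := hB q; omega⟩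
  induction m using Nat.strong_induction_on generalizing q c with
  | _ m ih =>
    obtain ⟨d, hd, hdA⟩ := S.exists_right_apex hp h
    by_cases hY : S.Y d = 1
    · have hA := hdA
      rw [inner_iff] at hp
      simp only [area_eq, hp.1, hq, hY] at hA
      have := hB d
      have hd' : {p, d, q} ∈ T := by rw [triple_swap_right]; exact hd
      obtain ⟨n, w, d', h0, h1, h2, h3, h4, h5⟩ :=
        ih (B - S.X d).toNat (by omega) hY hd' (by omega)
      refine ⟨n + 1, fun k => Nat.casesOn k q w, d', rfl, ?_, ?_, h3, h4, h5⟩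
      · rintro (_ | k) hk
        · exact ⟨hq, by simp⟩
        · have := h1 k (by omega)
          refine ⟨this.1, ?_⟩
          change S.X (w k) = _
          push_cast
          omega
      · rintro (_ | k) hk
        · change {p, q, w 0} ∈ T
          rw [h0]
          exact hd
        · exact h2 k (by omega)
    · exact ⟨0, fun _ => q, d, rfl, by simp [hq], by simp, hd, hdA, hY⟩

/-- No segment from `p` to the top row passes to the left of the last triangle on the left. -/
theorem le_of_left_cap (S : Strip P T g) {p q c q' : latticePoints P} (hp : S.Y p = 0)
    (hq : S.Y q = 1) (h : {p, q, c} ∈ T) (hA : S.area p q c = 1) (hc : S.Y c ≠ 1)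
    (hq' : S.Y q' = 1) {t : Finset (latticePoints P)} (ht : t ∈ T) (hpt : p ∈ t) (hqt : q' ∈ t) :
    S.X q ≤ S.X q' := by
  by_contra! hlt
  have n := S.ne_of_mem h
  -- If q' lay to the left of q, the segment pq' would cross the side qc of the cap. The weights
  -- below, written with X q - X q' > 0, locate the crossing point.
  have hne : ∀ α β γ δ : ℤ, 0 < α → 0 < β → 0 < γ → 0 < δ → α + β = γ + δ →
      α * S.X p + β * S.X q' = γ * S.X q + δ * S.X c →
      α * S.Y p + β * S.Y q' = γ * S.Y q + δ * S.Y c → False := by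
    intro α β γ δ h1 h2 h3 h4 h5 h6 h7
    have := S.segments t ht _ h p hpt q' hqt q (by simp) c (by simp) α β γ δ h1 h2 h3 h4 h5 h6 h7
    rcases this.1 with h | h
    · exact n.1 h
    · exact n.2.1 h
  simp only [area_eq] at hA
  rcases S.Y_cases c with yc | yc | yc
  · simp only [hp, hq, yc] at hA
    refine hne (2 * (S.X q - S.X q')) 1 (S.X q - S.X q' + 1) (S.X q - S.X q') (by omega) one_pos
      (by omega) (by omega) (by ring) ?_ ?_
    · have : S.X c = 2 * S.X p - S.X q - 1 := by omega
      rw [this]; ring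
    · rw [hp, hq, hq', yc]; ring
  · simp only [hp, hq, yc] at hA
    refine hne (S.X q - S.X q') 1 1 (S.X q - S.X q') (by omega) one_pos
      (by omega) (by omega) (by ring) ?_ ?_
    · have : S.X c = S.X p - 1 := by omega
      rw [this]; ring
    · rw [hp, hq, hq', yc]; ring
  · exact hc yc

theorem flipX_area (S : Strip P T g) (a b c : latticePoints P) :
    S.flipX.area a b c = -S.area a b c := by
  simp only [area_eq, flipX]; ring

theorem le_of_right_cap (S : Strip P T g) {p q c q' : latticePoints P} (hp : S.Y p = 0)
    (hq : S.Y q = 1) (h : {p, q, c} ∈ T) (hA : S.area p q c = -1) (hc : S.Y c ≠ 1)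
    (hq' : S.Y q' = 1) {t : Finset (latticePoints P)} (ht : t ∈ T) (hpt : p ∈ t) (hqt : q' ∈ t) :
    S.X q' ≤ S.X q := by
  have := S.flipX.le_of_left_cap hp hq h (by rw [flipX_area, hA]; rfl) hc hq' ht hpt hqt
  simp only [flipX] at this
  omega

theorem not_innerEdge_top (S : Strip P T g) {a b : latticePoints P} (ha : S.Y a = 1)
    (hb : S.Y b = 1) : ¬S.InnerEdge a b := by
  rw [innerEdge_iff, inner_iff, inner_iff]
  omega

/-- The total length of the arc of edges dual to segments from `p` to the top row, between the
last triangle on the left and the last one on the right. -/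
theorem exists_arc [Finite (latticePoints P)] (S : Strip P T g) {p q c : latticePoints P}
    (hp : S.Inner p) (hq : S.Y q = 1) (h : {p, q, c} ∈ T) (hA : S.area p q c = 1)
    (hc : S.Y c ≠ 1) :
    ∃ q' d, S.Y q' = 1 ∧ {p, q', d} ∈ T ∧ S.area p q' d = -1 ∧ S.Y d ≠ 1 ∧
      (∀ ω, ∑ᶠ e ∈ S.topArc p, edgeLength T e.1 ω = S.capValue p q c ω + S.capValue p q' d ω) ∧
      ∀ e ∈ S.topArc p, ∀ f ∈ S.topArc p, skeletonClass e = skeletonClass f := by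
  obtain ⟨n, w, d, h0, h1, h2, h3, h4, h5⟩ := S.exists_walk hp hq h
  have hp0 : S.Y p = 0 := hp.1
  -- The left apex at the spoke `k` is the preceding point of the walk, or the cap `c` when k = 0.
  have hleft : ∀ k ≤ n, ∃ c', {p, w k, c'} ∈ T ∧ S.area p (w k) c' = 1 ∧
      c' = (Nat.casesOn k c w : latticePoints P) := by
    rintro (_ | k) hk
    · exact ⟨c, by rw [h0]; exact h, by rw [h0]; exact hA, rfl⟩
    · refine ⟨w k, ?_, ?_, rfl⟩
      · rw [triple_swap_right]; exact h2 k (by omega)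
      · have a1 := h1 k (by omega)
        have a2 := h1 (k + 1) hk
        push_cast at a2
        simp only [area_eq, hp0, a1.1, a2.1]
        omega
  have hright : ∀ k < n, S.area p (w k) (w (k + 1)) = -1 := by
    intro k hk
    have a1 := h1 k (by omega)
    have a2 := h1 (k + 1) hk
    push_cast at a2
    simp only [area_eq, hp0, a1.1, a2.1]
    omega
  have hex : ∀ k, ∃ e : (core (dualGraph T)).edgeSet, k ≤ n → HasSide e.1 p (w k) := by
    intro k
    by_cases hk : k ≤ n
    · obtain ⟨c', hc', -⟩ := hleft k hk
      obtain ⟨e, he⟩ := S.exists_edge hc' (S.innerEdge_of_left _ hp)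
      exact ⟨e, fun _ => he⟩
    · obtain ⟨e, -⟩ := S.exists_edge h (S.innerEdge_of_left _ hp)
      exact ⟨e, fun h => absurd h hk⟩
  choose E hE using hex
  -- The two caps bound all spokes to the top row, and the walk meets every lattice point of that
  -- row in between.
  have htop : S.topArc p = E '' (Finset.range (n + 1) : Set ℕ) := by
    ext e
    constructor
    · rintro ⟨q', hq', he⟩
      obtain ⟨x, y, hx, -, -⟩ := S.exists_rep he
      have b1 := S.le_of_left_cap hp0 hq h hA hc hq' hx (by simp) (by simp)
      have b2 := S.le_of_right_cap hp0 (h1 n le_rfl).1 h3 h4 h5 hq' hx (by simp) (by simp)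
      have b3 := (h1 n le_rfl).2
      have hk : (S.X q' - S.X q).toNat ≤ n := by omega
      refine ⟨(S.X q' - S.X q).toNat, by simp; omega, ?_⟩
      have : w (S.X q' - S.X q).toNat = q' := by
        have b4 := h1 _ hk
        exact S.ext _ _ (by omega) (by omega)
      refine S.edge_unique (hE _ hk) ?_
      rw [this]
      exact he
    · rintro ⟨k, hk, rfl⟩
      have hk : k ≤ n := by simp at hk; omega
      exact ⟨w k, (h1 k hk).1, hE k hk⟩
  have hinj : Set.InjOn E (Finset.range (n + 1) : Set ℕ) := by
    intro k hk l hl hkl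
    have hk : k ≤ n := by simp at hk; omega
    have hl : l ≤ n := by simp at hl; omega
    have e1 := hE k hk
    rw [hkl] at e1
    rcases S.hasSide_cases (hE l hl) e1 with ⟨-, h⟩ | ⟨h, -⟩
    · have a1 := (h1 k hk).2
      have a2 := (h1 l hl).2
      rw [h] at a1
      omega
    · have := (h1 l hl).1
      rw [← h] at this
      omega
  refine ⟨w n, d, (h1 n le_rfl).1, h3, h4, h5, fun ω => ?_, ?_⟩
  · rw [htop, finsum_mem_image hinj, finsum_mem_coe_finset]
    -- `F k` is the left contribution at the spoke `k`; for k < n the right contribution is `-F (k +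
    -- 1)`.
    let F : ℕ → ℝ := fun k => S.capValue p (w k) (Nat.casesOn k c w) ω
    have hstep : ∀ k < n, edgeLength T (E k).1 ω = F k - F (k + 1) := by
      intro k hk
      obtain ⟨c', hc', hcA, hceq⟩ := hleft k hk.le
      rw [S.edgeLength_spoke hp0 (h1 k hk.le).1 (hE k hk.le) hc' (h2 k hk) hcA (hright k hk)]
      have e1 : F k = S.capValue p (w k) c' ω := by rw [hceq]
      have e2 : F (k + 1) = S.capValue p (w (k + 1)) (w k) ω := rfl
      rw [e1, e2]
      simp only [capValue, (h1 k hk.le).1, (h1 (k + 1) hk).1]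
      push_cast
      ring
    have hlast : edgeLength T (E n).1 ω = F n + S.capValue p (w n) d ω := by
      obtain ⟨c', hc', hcA, hceq⟩ := hleft n le_rfl
      rw [S.edgeLength_spoke hp0 (h1 n le_rfl).1 (hE n le_rfl) hc' h3 hcA h4, hceq]
    rw [Finset.sum_range_succ, hlast,
      Finset.sum_congr rfl fun k hk => hstep k (Finset.mem_range.1 hk), Finset.sum_range_sub']
    have : F 0 = S.capValue p q c ω := by change S.capValue p (w 0) c ω = _; rw [h0]
    rw [this]
    ring
  · have hconn : ∀ k ≤ n, skeletonClass (E k) = skeletonClass (E 0) := by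
      intro k hk
      induction k with
      | zero => rfl
      | succ k ih =>
        rw [← ih (by omega)]
        refine (skeletonClass_eq
          (S.concatenated (h2 k (by omega)) ?_ (hE k (by omega)) (hE _ hk))).symm
        exact S.not_innerEdge_top (h1 k (by omega)).1 (h1 _ hk).1
    intro e he f hf
    rw [htop] at he hf
    obtain ⟨k, hk, rfl⟩ := he
    obtain ⟨l, hl, rfl⟩ := hf
    rw [hconn k (by simp at hk; omega), hconn l (by simp at hl; omega)]

end Strip

end Strip

end TropicalModuli

namespace TropicalModuli

/-! ### Lengths of the cycles around interior points and of the gaps between them. -/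

section Strip

variable {P : Set (ℝ × ℝ)}

namespace Strip

variable {T : Finset (Finset (latticePoints P))} {g : ℤ}

/-- The segment from `p` to its left neighbour `p'` on the axis is the common side of the
triangles `p p' q` and `p p' r`. -/
structure LeftSpine (S : Strip P T g) (p p' q r : latticePoints P) : Prop where
  Y_eq : S.Y p' = 0
  X_eq : S.X p' = S.X p - 1
  top : S.Y q = 1
  bot : S.Y r = -1
  mem_top : {p, p', q} ∈ T
  mem_bot : {p, p', r} ∈ T

/-- The segment `qr` crosses the axis directly to the left of `p`, in the triangle `pqr`. -/
structure LeftCross (S : Strip P T g) (p q r : latticePoints P) : Prop where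
  top : S.Y q = 1
  bot : S.Y r = -1
  X_eq : S.X q + S.X r = 2 * S.X p - 1
  mem : {p, q, r} ∈ T

/-- The slope at which the arcs around `p` end on the left. -/
def LeftValue (S : Strip P T g) (p : latticePoints P) (φ : (latticePoints P → ℝ) → ℝ) : Prop :=
  (∃ p' q r, S.LeftSpine p p' q r ∧ φ = fun ω => ω p' - ω p) ∨
    ∃ q r, S.LeftCross p q r ∧ φ = fun ω => ω q + ω r - 2 * ω p

theorem left_cases (S : Strip P T g) {p : latticePoints P} (hp : S.Inner p) :
    (∃ p' q r, S.LeftSpine p p' q r) ∨ ∃ q r, S.LeftCross p q r := by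
  have hp0 : S.Y p = 0 := hp.1
  obtain ⟨q, r, h, ⟨h1, h2⟩ | ⟨h1, h2, h3⟩⟩ := S.left p hp
  · left
    obtain ⟨d, hd, hrd⟩ := S.exists_neighbor h (S.innerEdge_of_left q hp)
    have ho := S.area_opposite h hd hrd
    have hA := S.area_cases h
    simp only [area_eq, hp0, h1, h2] at ho hA
    rcases S.Y_cases r with yr | yr | yr <;> rcases S.Y_cases d with yd | yd | yd <;>
      simp only [yr, yd] at ho hA <;> first
      | (exfalso; omega)
      | exact ⟨q, d, r, h1, h2, yd, yr, hd, h⟩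
      | exact ⟨q, r, d, h1, h2, yr, yd, h, hd⟩
  · right
    exact ⟨q, r, h1, h2, h3, h⟩

theorem exists_leftValue (S : Strip P T g) {p : latticePoints P} (hp : S.Inner p) :
    ∃ φ, S.LeftValue p φ := by
  rcases S.left_cases hp with ⟨p', q, r, h⟩ | ⟨q, r, h⟩
  · exact ⟨_, Or.inl ⟨p', q, r, h, rfl⟩⟩
  · exact ⟨_, Or.inr ⟨q, r, h, rfl⟩⟩

theorem LeftSpine.flipY {S : Strip P T g} {p p' q r : latticePoints P}
    (h : S.LeftSpine p p' q r) : S.flipY.LeftSpine p p' r q where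
  Y_eq := by simp [Strip.flipY, h.Y_eq]
  X_eq := h.X_eq
  top := by simp [Strip.flipY, h.bot]
  bot := by simp [Strip.flipY, h.top]
  mem_top := h.mem_bot
  mem_bot := h.mem_top

theorem LeftCross.flipY {S : Strip P T g} {p q r : latticePoints P}
    (h : S.LeftCross p q r) : S.flipY.LeftCross p r q where
  top := by simp [Strip.flipY, h.bot]
  bot := by simp [Strip.flipY, h.top]
  X_eq := by have := h.X_eq; simp only [Strip.flipY]; omega
  mem := by rw [triple_swap_right]; exact h.mem

theorem LeftValue.flipY {S : Strip P T g} {p : latticePoints P}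
    {φ : (latticePoints P → ℝ) → ℝ} (h : S.LeftValue p φ) : S.flipY.LeftValue p φ := by
  rcases h with ⟨p', q, r, h, rfl⟩ | ⟨q, r, h, rfl⟩
  · exact Or.inl ⟨p', r, q, h.flipY, rfl⟩
  · exact Or.inr ⟨r, q, h.flipY, by funext ω; ring⟩

/-- A segment on the axis and one between the outer rows do not cross. -/
theorem not_cross (S : Strip P T g) {p p' q r : latticePoints P} {t t' : Finset (latticePoints P)}
    (ht : t ∈ T) (ht' : t' ∈ T) (hp : p ∈ t) (hp' : p' ∈ t) (hq : q ∈ t') (hr : r ∈ t')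
    (yp : S.Y p = 0) (yp' : S.Y p' = 0) (yq : S.Y q = 1) (yr : S.Y r = -1) :
    S.X q + S.X r ≠ S.X p + S.X p' := by
  intro h
  have := S.segments t ht t' ht' p hp p' hp' q hq r hr 1 1 1 1 one_pos one_pos one_pos one_pos rfl
    (by omega) (by omega)
  rcases this.1 with rfl | rfl <;> omega

/-- Two segments between the outer rows do not cross on the axis. -/
theorem cross_unique (S : Strip P T g) {q r q' r' : latticePoints P}
    {t t' : Finset (latticePoints P)}
    (ht : t ∈ T) (ht' : t' ∈ T) (hq : q ∈ t) (hr : r ∈ t) (hq' : q' ∈ t') (hr' : r' ∈ t')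
    (yq : S.Y q = 1) (yr : S.Y r = -1) (yq' : S.Y q' = 1) (yr' : S.Y r' = -1)
    (h : S.X q + S.X r = S.X q' + S.X r') : q = q' ∧ r = r' := by
  have := S.segments t ht t' ht' q hq r hr q' hq' r' hr' 1 1 1 1 one_pos one_pos one_pos one_pos rfl
    (by omega) (by omega)
  rcases this with ⟨h1, h2⟩
  constructor
  · rcases h1 with h | h
    · exact h
    · subst h; omega
  · rcases h2 with h | h
    · subst h; omega
    · exact h

/-- A cap of the other type, or with another crossing segment, would cross the given one at the same
midpoint on the axis. The end of an arc thus depends only on `p` and not on the row, which gives the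
upper and lower arcs equal lengths. -/
theorem LeftValue.capValue_eq {S : Strip P T g} {p q c : latticePoints P}
    {φ : (latticePoints P → ℝ) → ℝ} (hφ : S.LeftValue p φ) (hp : S.Inner p) (hq : S.Y q = 1)
    (h : {p, q, c} ∈ T) (hA : S.area p q c = 1) (hc : S.Y c ≠ 1) (ω : latticePoints P → ℝ) :
    S.capValue p q c ω = φ ω := by
  have hp0 : S.Y p = 0 := hp.1
  simp only [area_eq] at hA
  rcases hφ with ⟨p', q', r', h', rfl⟩ | ⟨q', r', h', rfl⟩
  · rcases S.Y_cases c with yc | yc | yc <;> simp only [hp0, hq, yc] at hA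
    · exact absurd (by have := h'.X_eq; omega) (S.not_cross h'.mem_top h (p := p) (p' := p')
        (q := q) (r := c) (by simp) (by simp) (by simp) (by simp) hp0 h'.Y_eq hq yc)
    · have : c = p' := S.ext _ _ (by have := h'.X_eq; omega) (by have := h'.Y_eq; omega)
      simp [capValue, this, h'.Y_eq]
    · exact absurd yc hc
  · rcases S.Y_cases c with yc | yc | yc <;> simp only [hp0, hq, yc] at hA
    · obtain ⟨e1, e2⟩ := S.cross_unique h h'.mem (q := q) (r := c) (by simp) (by simp)
        (by simp) (by simp) hq yc h'.top h'.bot (by have := h'.X_eq; omega)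
      subst e1 e2
      simp only [capValue, yc]
      push_cast
      ring
    · exact absurd (by have := h'.X_eq; omega) (S.not_cross h h'.mem (p := p) (p' := c)
        (q := q') (r := r') (by simp) (by simp) (by simp) (by simp) hp0 yc h'.top h'.bot)
    · exact absurd yc hc

theorem exists_left_cap (S : Strip P T g) {p : latticePoints P} (hp : S.Inner p) :
    ∃ q c, {p, q, c} ∈ T ∧ S.Y q = 1 ∧ S.area p q c = 1 ∧ S.Y c ≠ 1 := by
  have hp0 : S.Y p = 0 := hp.1
  rcases S.left_cases hp with ⟨p', q, r, h⟩ | ⟨q, r, h⟩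
  · refine ⟨q, p', by rw [triple_swap_right]; exact h.mem_top, h.top, ?_, by have := h.Y_eq; omega⟩
    simp only [area_eq, hp0, h.top, h.Y_eq, h.X_eq]
    ring
  · refine ⟨q, r, h.mem, h.top, ?_, by have := h.bot; omega⟩
    have := h.X_eq
    simp only [area_eq, hp0, h.top, h.bot]
    omega

/-- The length of the arc of edges between `p` and the top row. -/
theorem topArc_sum [Finite (latticePoints P)] (S : Strip P T g) {p : latticePoints P}
    {φ ψ : (latticePoints P → ℝ) → ℝ} (hp : S.Inner p) (hφ : S.LeftValue p φ)
    (hψ : S.flipX.LeftValue p ψ) :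
    (∀ ω, ∑ᶠ e ∈ S.topArc p, edgeLength T e.1 ω = φ ω + ψ ω) ∧
      (∀ e ∈ S.topArc p, ∀ f ∈ S.topArc p, skeletonClass e = skeletonClass f) ∧
      (S.topArc p).Nonempty := by
  obtain ⟨q, c, h, hq, hA, hc⟩ := S.exists_left_cap hp
  obtain ⟨q', d, hq', h', hA', hd, hsum, hconn⟩ := S.exists_arc hp hq h hA hc
  refine ⟨fun ω => ?_, hconn, ?_⟩
  · rw [hsum, hφ.capValue_eq hp hq h hA hc]
    have := hψ.capValue_eq (S.flipX_inner.2 hp) hq' h' (by rw [flipX_area, hA']; rfl) hd ω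
    rw [← this]
    rfl
  · obtain ⟨e, he⟩ := S.exists_edge h (S.innerEdge_of_left q hp)
    exact ⟨e, q, hq, he⟩

theorem abs_X_sub (S : Strip P T g) {p q : latticePoints P} {e : (core (dualGraph T)).edgeSet}
    (he : HasSide e.1 p q) (hp : S.Y p = 0) (hq : S.Y q = 0) :
    S.X q = S.X p - 1 ∨ S.X q = S.X p + 1 := by
  obtain ⟨c, d, hc, -⟩ := S.exists_rep he
  have hA := S.area_cases hc
  simp only [area_eq, hp, hq] at hA
  rcases S.Y_cases c with yc | yc | yc <;> simp only [yc] at hA <;> omega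

/-- With interior neighbours on both sides, a cap pqc has three inner sides: `c` is interior, or qc
crosses the axis between interior points. Its degree in the core is three, and the arc stops there.
-/
theorem topArc_closed [Finite (latticePoints P)] (S : Strip P T g) {p : latticePoints P}
    (hp : S.Inner p) (h1 : S.X p ≠ 1) (h2 : S.X p ≠ g)
    {e f : (core (dualGraph T)).edgeSet} (he : e ∈ S.topArc p)
    (hef : Concatenated (dualGraph T) e f) : f ∈ S.topArc p := by
  obtain ⟨q, hq, hs⟩ := he
  rcases S.concatenated_cases hs hef with rfl | ⟨c, hc, ⟨hf, hin⟩ | ⟨-, hin⟩⟩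
  · exact ⟨q, hq, hs⟩
  · refine ⟨c, ?_, hf⟩
    by_contra hY
    apply hin
    have hA := S.area_cases hc
    rw [inner_iff] at hp
    simp only [area_eq, hp.1, hq] at hA
    rw [innerEdge_iff, inner_iff, inner_iff]
    rcases S.Y_cases c with yc | yc | yc <;> simp only [yc] at hA <;> omega
  · exact absurd (S.innerEdge_of_left c hp) hin

/-- The lengths of the skeleton edges around an interior lattice point with neighbours on both
sides. -/
theorem skeletonMap_middle [Finite (latticePoints P)] (S : Strip P T g) {p q : latticePoints P}
    {φ ψ : (latticePoints P → ℝ) → ℝ} (hp : S.Inner p) (hφ : S.LeftValue p φ)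
    (hψ : S.flipX.LeftValue p ψ) (h1 : S.X p ≠ 1) (h2 : S.X p ≠ g)
    {e : (core (dualGraph T)).edgeSet} (he : HasSide e.1 p q) (hq : ¬S.Inner q)
    (ω : latticePoints P → ℝ) : skeletonMap T ω (skeletonClass e) = φ ω + ψ ω := by
  wlog hY : S.Y q = 1 generalizing S
  · have hp' := hp
    rw [inner_iff] at hq hp'
    rcases S.Y_cases q with yq | yq | yq
    · exact this S.flipY (S.flipY_inner.2 hp) hφ.flipY hψ.flipY h1 h2
        (fun h => hq (S.flipY_inner.1 h)) (by simp [flipY, yq])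
    · have := S.abs_X_sub he hp.1 yq
      omega
    · exact absurd yq hY
  obtain ⟨hsum, hconn, -⟩ := S.topArc_sum hp hφ hψ
  have hmem : e ∈ S.topArc p := ⟨q, hY, he⟩
  rw [skeletonMap_skeletonClass hmem (fun e he f hf => S.topArc_closed hp h1 h2 he hf)
    (fun f hf => hconn f hf e hmem), hsum]

/-- The edges of the core dual to segments from `p` to points which are not interior. -/
def outerArc (S : Strip P T g) (p : latticePoints P) : Set (core (dualGraph T)).edgeSet :=
  {e | ∃ q, ¬S.Inner q ∧ HasSide e.1 p q}

theorem outerArc_closed [Finite (latticePoints P)] (S : Strip P T g) {p : latticePoints P}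
    (hp : S.Inner p) {e f : (core (dualGraph T)).edgeSet} (he : e ∈ S.outerArc p)
    (hef : Concatenated (dualGraph T) e f) : f ∈ S.outerArc p := by
  obtain ⟨q, hq, hs⟩ := he
  rcases S.concatenated_cases hs hef with rfl | ⟨c, hc, ⟨hf, hin⟩ | ⟨-, hin⟩⟩
  · exact ⟨q, hq, hs⟩
  · exact ⟨c, fun h => hin (Or.inr (Or.inl h)), hf⟩
  · exact absurd (S.innerEdge_of_left c hp) hin

theorem topArc_disjoint (S : Strip P T g) (p : latticePoints P) :
    Disjoint (S.topArc p) (S.flipY.topArc p) := by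
  rw [Set.disjoint_left]
  rintro e ⟨q, hq, he⟩ ⟨r, hr, he'⟩
  simp only [flipY] at hr
  rcases S.hasSide_cases he he' with ⟨-, rfl⟩ | ⟨rfl, rfl⟩
  · omega
  · exact he'.1 (by rfl) |>.elim

theorem not_inner_of_top (S : Strip P T g) {q : latticePoints P} (hq : S.Y q = 1) :
    ¬S.Inner q := by
  rw [inner_iff]; omega

/-- The length of the loop around the leftmost interior lattice point, if the segment to its left
neighbour is in the triangulation. -/
theorem skeletonMap_left_spine [Finite (latticePoints P)] (S : Strip P T g)
    {p p' q r : latticePoints P} {ψ : (latticePoints P → ℝ) → ℝ} (hp : S.Inner p)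
    (h1 : S.X p = 1) (h : S.LeftSpine p p' q r) (hψ : S.flipX.LeftValue p ψ)
    {e : (core (dualGraph T)).edgeSet} (he : e ∈ S.outerArc p) (ω : latticePoints P → ℝ) :
    skeletonMap T ω (skeletonClass e) = 2 * (ω p' - ω p + ψ ω) +
      (ω q + ω r - (2 - (S.X q + S.X r : ℤ)) * ω p' - (S.X q + S.X r : ℤ) * ω p) := by
  have hp0 : S.Y p = 0 := hp.1
  have hφ : S.LeftValue p (fun ω => ω p' - ω p) := Or.inl ⟨p', q, r, h, rfl⟩
  obtain ⟨hsum, hconn, -⟩ := S.topArc_sum hp hφ hψ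
  obtain ⟨hsum', hconn', -⟩ := S.flipY.topArc_sum (S.flipY_inner.2 hp) hφ.flipY hψ.flipY
  have hp'i : ¬S.Inner p' := by have := h.X_eq; rw [inner_iff]; omega
  obtain ⟨e₀, he₀⟩ := S.exists_edge h.mem_top (S.innerEdge_of_left p' hp)
  have m1 : {p, q, p'} ∈ T := by rw [triple_swap_right]; exact h.mem_top
  have m2 : {p, r, p'} ∈ T := by rw [triple_swap_right]; exact h.mem_bot
  obtain ⟨e₁, he₁⟩ := S.exists_edge m1 (S.innerEdge_of_left q hp)
  obtain ⟨e₂, he₂⟩ := S.exists_edge m2 (S.innerEdge_of_left r hp)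
  have hb := h.bot
  have ht := h.top
  have hY := h.Y_eq
  have hX := h.X_eq
  -- Neither qp' nor rp' is inner, so the triangles at pp' have degree two and join both arcs and
  -- the edge dual to pp' into one loop.
  have i1 : ¬S.InnerEdge q p' := by
    rw [innerEdge_iff, inner_iff, inner_iff]; omega
  have i2 : ¬S.InnerEdge r p' := by
    rw [innerEdge_iff, inner_iff, inner_iff]; omega
  have c1 := skeletonClass_eq (S.concatenated m1 i1 he₁ he₀)
  have c2 := skeletonClass_eq (S.concatenated m2 i2 he₂ he₀)
  have k1 : e₁ ∈ S.topArc p := ⟨q, ht, he₁⟩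
  have k2 : e₂ ∈ S.flipY.topArc p := ⟨r, by simp [flipY, hb], he₂⟩
  have hset : S.outerArc p = (S.topArc p ∪ S.flipY.topArc p) ∪ {e₀} := by
    ext f
    constructor
    · rintro ⟨x, hx, hf⟩
      rcases S.Y_cases x with yx | yx | yx
      · exact Or.inl (Or.inr ⟨x, by simp [flipY, yx], hf⟩)
      · right
        have hax := S.abs_X_sub hf hp0 yx
        have h2 := S.two_le
        rw [inner_iff] at hx
        have : x = p' := S.ext _ _ (by omega) (by omega)
        subst this
        exact S.edge_unique hf he₀
      · exact Or.inl (Or.inl ⟨x, yx, hf⟩)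
    · rintro ((⟨x, hx, hf⟩ | ⟨x, hx, hf⟩) | rfl)
      · exact ⟨x, S.not_inner_of_top hx, hf⟩
      · exact ⟨x, fun hi => S.flipY.not_inner_of_top hx (S.flipY_inner.2 hi), hf⟩
      · exact ⟨p', hp'i, he₀⟩
  have hall : ∀ f ∈ S.outerArc p, skeletonClass f = skeletonClass e₀ := by
    intro f hf
    rw [hset] at hf
    rcases hf with (hf | hf) | rfl
    · rw [hconn f hf e₁ k1, c1]
    · rw [hconn' f hf e₂ k2, c2]
    · rfl
  have hdisj : Disjoint (S.topArc p ∪ S.flipY.topArc p) {e₀} := by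
    rw [Set.disjoint_singleton_right]
    rintro (⟨x, hx, hf⟩ | ⟨x, hx, hf⟩)
    · rcases S.hasSide_cases he₀ hf with ⟨-, rfl⟩ | ⟨-, rfl⟩ <;> omega
    · simp only [flipY] at hx
      rcases S.hasSide_cases he₀ hf with ⟨-, rfl⟩ | ⟨-, rfl⟩ <;> omega
  rw [skeletonMap_skeletonClass he (fun e he f hf => S.outerArc_closed hp he hf)
    (fun f hf => (hall f hf).trans (hall e he).symm), hset,
    finsum_mem_union hdisj (Set.toFinite _) (Set.toFinite _),
    finsum_mem_union (S.topArc_disjoint p) (Set.toFinite _) (Set.toFinite _), hsum, hsum',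
    finsum_mem_singleton]
  have hqr : q ≠ r := by rintro rfl; omega
  -- Here p' = (0,0) and p = (1,0), so q + r = β p with β the sum of the first coordinates.
  rw [edgeLength_eq S.triangulation (S.isQuad_of_hasSide he₀.symm (β := S.X q + S.X r)
    (c := q) (d := r) (by rw [triple_swap_left]; exact h.mem_top)
    (by rw [triple_swap_left]; exact h.mem_bot) hqr (by rw [hX, h1]; ring)
    (by rw [hY, hp0, ht, hb]; ring)), quadLength_apply]
  ring

/-- The length of the loop around the leftmost interior lattice point, if there is no segment to
its left neighbour. -/
theorem skeletonMap_left_cross [Finite (latticePoints P)] (S : Strip P T g)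
    {p q r : latticePoints P} {ψ : (latticePoints P → ℝ) → ℝ} (hp : S.Inner p)
    (h1 : S.X p = 1) (h : S.LeftCross p q r) (hψ : S.flipX.LeftValue p ψ)
    {e : (core (dualGraph T)).edgeSet} (he : e ∈ S.outerArc p) (ω : latticePoints P → ℝ) :
    skeletonMap T ω (skeletonClass e) = 2 * (ω q + ω r - 2 * ω p + ψ ω) := by
  have hp0 : S.Y p = 0 := hp.1
  have hφ : S.LeftValue p (fun ω => ω q + ω r - 2 * ω p) := Or.inr ⟨q, r, h, rfl⟩
  obtain ⟨hsum, hconn, -⟩ := S.topArc_sum hp hφ hψ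
  obtain ⟨hsum', hconn', -⟩ := S.flipY.topArc_sum (S.flipY_inner.2 hp) hφ.flipY hψ.flipY
  have m2 : {p, r, q} ∈ T := by rw [triple_swap_right]; exact h.mem
  obtain ⟨e₁, he₁⟩ := S.exists_edge h.mem (S.innerEdge_of_left q hp)
  obtain ⟨e₂, he₂⟩ := S.exists_edge m2 (S.innerEdge_of_left r hp)
  have hb := h.bot
  have ht := h.top
  have hX := h.X_eq
  -- The crossing lies to the left of the first interior point, so qr is not inner and the two arcs
  -- are concatenated at the triangle pqr.
  have i1 : ¬S.InnerEdge q r := by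
    rw [innerEdge_iff, inner_iff, inner_iff]; omega
  have c1 := skeletonClass_eq (S.concatenated h.mem i1 he₁ he₂)
  have k1 : e₁ ∈ S.topArc p := ⟨q, ht, he₁⟩
  have k2 : e₂ ∈ S.flipY.topArc p := ⟨r, by simp [flipY, hb], he₂⟩
  have hset : S.outerArc p = S.topArc p ∪ S.flipY.topArc p := by
    ext f
    constructor
    · rintro ⟨x, hx, hf⟩
      rcases S.Y_cases x with yx | yx | yx
      · exact Or.inr ⟨x, by simp [flipY, yx], hf⟩
      · exfalso
        have hax := S.abs_X_sub hf hp0 yx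
        have h2 := S.two_le
        rw [inner_iff] at hx
        obtain ⟨c, d, hc, -⟩ := S.exists_rep hf
        exact S.not_cross hc h.mem (p := p) (p' := x) (q := q) (r := r) (by simp) (by simp)
          (by simp) (by simp) hp0 yx ht hb (by omega)
      · exact Or.inl ⟨x, yx, hf⟩
    · rintro (⟨x, hx, hf⟩ | ⟨x, hx, hf⟩)
      · exact ⟨x, S.not_inner_of_top hx, hf⟩
      · exact ⟨x, fun hi => S.flipY.not_inner_of_top hx (S.flipY_inner.2 hi), hf⟩
  have hall : ∀ f ∈ S.outerArc p, skeletonClass f = skeletonClass e₂ := by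
    intro f hf
    rw [hset] at hf
    rcases hf with hf | hf
    · rw [hconn f hf e₁ k1, c1]
    · rw [hconn' f hf e₂ k2]
  rw [skeletonMap_skeletonClass he (fun e he f hf => S.outerArc_closed hp he hf)
    (fun f hf => (hall f hf).trans (hall e he).symm), hset,
    finsum_mem_union (S.topArc_disjoint p) (Set.toFinite _) (Set.toFinite _), hsum, hsum']
  ring

/-- A skeleton edge between two cycles consists of a single edge. -/
theorem skeletonMap_gap [Finite (latticePoints P)] (S : Strip P T g) {a b : latticePoints P}
    {e : (core (dualGraph T)).edgeSet} (he : HasSide e.1 a b)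
    (h : (S.Inner a ∧ S.Inner b) ∨ (¬S.Inner a ∧ ¬S.Inner b)) (ω : latticePoints P → ℝ) :
    skeletonMap T ω (skeletonClass e) = edgeLength T e.1 ω := by
  rw [skeletonMap_skeletonClass (E := {e}) rfl, finsum_mem_singleton]
  -- Both triangles at a gap have three inner sides, so nothing is concatenated to it.
  · rintro _ rfl f hf
    have hin := S.innerEdge_of_hasSide he
    rcases S.concatenated_cases he hf with rfl | ⟨c, hc, h'⟩
    · rfl
    · exfalso
      rcases h with ⟨ha, hb⟩ | ⟨ha, hb⟩
      · rcases h' with ⟨-, h'⟩ | ⟨-, h'⟩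
        · exact h' (S.innerEdge_of_left c hb)
        · exact h' (S.innerEdge_of_left c ha)
      · have hci : S.Inner c := by
          rw [innerEdge_iff] at hin
          have hx := (hin.resolve_left ha).resolve_left hb
          have hA := S.area_cases hc
          simp only [area_eq] at hA
          rw [inner_iff]
          rcases S.Y_cases a with ya | ya | ya <;> rcases S.Y_cases b with yb | yb | yb <;>
            rcases S.Y_cases c with yc | yc | yc <;>
            simp only [ya, yb, yc] at hA <;> omega
        rcases h' with ⟨-, h'⟩ | ⟨-, h'⟩
        · exact h' (Or.inr (Or.inl hci))
        · exact h' (Or.inr (Or.inl hci))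
  · rintro _ rfl
    rfl

end Strip

end Strip

end TropicalModuli

/-! ### The bounds g and 2g - 1 for a strip. -/

namespace TropicalModuli

/-- A linear map to functions which factor through `f : ι → κ` has rank at most the size
of `κ`. -/
theorem finrank_range_le_card {V ι κ : Type*} [AddCommGroup V] [Module ℝ V]
    [Fintype κ] (L : V →ₗ[ℝ] (ι → ℝ)) (f : ι → κ)
    (h : ∀ s s', f s = f s' → ∀ v, L v s = L v s') :
    Module.finrank ℝ (LinearMap.range L) ≤ Fintype.card κ := by
  have hle : LinearMap.range L ≤ LinearMap.range (LinearMap.funLeft ℝ ℝ f) := by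
    rintro _ ⟨v, rfl⟩
    have hf : Function.FactorsThrough (L v) f := fun s s' hs => h s s' hs v
    refine ⟨Function.extend f (L v) 0, ?_⟩
    funext s
    exact hf.extend_apply 0 s
  calc Module.finrank ℝ (LinearMap.range L)
      ≤ Module.finrank ℝ (LinearMap.range (LinearMap.funLeft ℝ ℝ f)) :=
        Submodule.finrank_mono hle
    _ ≤ Module.finrank ℝ (κ → ℝ) := LinearMap.finrank_range_le _
    _ = Fintype.card κ := Module.finrank_fintype_fun_eq_card ℝ

section Strip

variable {P : Set (ℝ × ℝ)}

namespace Strip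

variable {T : Finset (Finset (latticePoints P))} {g : ℤ}

theorem flipX_flipX (S : Strip P T g) : S.flipX.flipX = S := by
  cases S
  simp [flipX]

theorem flipX_outerArc (S : Strip P T g) (p : latticePoints P) :
    S.flipX.outerArc p = S.outerArc p := by
  simp only [outerArc, flipX_inner]

/-- All skeleton edges around an interior lattice point have the same length. -/
theorem exists_outer_value [Finite (latticePoints P)] (S : Strip P T g) {p : latticePoints P}
    (hp : S.Inner p) : ∃ Φ : (latticePoints P → ℝ) → ℝ,
      ∀ e ∈ S.outerArc p, ∀ ω, skeletonMap T ω (skeletonClass e) = Φ ω := by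
  have left : ∀ S : Strip P T g, S.Inner p → S.X p = 1 → ∃ Φ : (latticePoints P → ℝ) → ℝ,
      ∀ e ∈ S.outerArc p, ∀ ω, skeletonMap T ω (skeletonClass e) = Φ ω := by
    intro S hp h1
    obtain ⟨ψ, hψ⟩ := S.flipX.exists_leftValue (S.flipX_inner.2 hp)
    rcases S.left_cases hp with ⟨p', q, r, h⟩ | ⟨q, r, h⟩
    · exact ⟨_, fun e he ω => S.skeletonMap_left_spine hp h1 h hψ he ω⟩
    · exact ⟨_, fun e he ω => S.skeletonMap_left_cross hp h1 h hψ he ω⟩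
  by_cases h1 : S.X p = 1
  · exact left S hp h1
  by_cases h2 : S.X p = g
  · have := left S.flipX (S.flipX_inner.2 hp) (by simp only [flipX]; omega)
    rwa [flipX_outerArc] at this
  obtain ⟨φ, hφ⟩ := S.exists_leftValue hp
  obtain ⟨ψ, hψ⟩ := S.flipX.exists_leftValue (S.flipX_inner.2 hp)
  exact ⟨fun ω => φ ω + ψ ω, fun e ⟨q, hq, he⟩ ω => S.skeletonMap_middle hp hφ hψ h1 h2 he hq ω⟩

/-- The two segments have the same midpoint, and edges of a triangulation meeting in their relative
interiors coincide. -/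
theorem gap_unique (S : Strip P T g) {a b a' b' : latticePoints P}
    {e f : (core (dualGraph T)).edgeSet} (he : HasSide e.1 a b) (hf : HasSide f.1 a' b')
    (h : S.Y a + S.Y b = 0) (h' : S.Y a' + S.Y b' = 0) (hX : S.X a + S.X b = S.X a' + S.X b') :
    e = f := by
  obtain ⟨c, -, hc, -⟩ := S.exists_rep he
  obtain ⟨c', -, hc', -⟩ := S.exists_rep hf
  have key := S.segments _ hc _ hc' a (by simp) b (by simp) a' (by simp) b' (by simp) 1 1 1 1
    one_pos one_pos one_pos one_pos rfl (by linarith) (by linarith)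
  have hab := he.1
  obtain ⟨rfl | rfl, rfl | rfl⟩ := key
  · exact absurd rfl hab
  · exact S.edge_unique he hf
  · exact S.edge_unique he hf.symm
  · exact absurd rfl hab

/-- Each edge of the core belongs to the cycle around an interior lattice point or to the gap
between two of them. -/
theorem edge_cases [Finite (latticePoints P)] (S : Strip P T g)
    (e : (core (dualGraph T)).edgeSet) :
    (∃ p, S.Inner p ∧ e ∈ S.outerArc p) ∨
      ∃ a b, HasSide e.1 a b ∧ S.Y a + S.Y b = 0 ∧
        ((S.Inner a ∧ S.Inner b) ∨ (¬S.Inner a ∧ ¬S.Inner b)) ∧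
        ∃ i, 1 ≤ i ∧ i < g ∧ S.X a + S.X b = 2 * i + 1 := by
  obtain ⟨a, b, h, hin⟩ := S.exists_side e
  by_cases ha : S.Inner a
  · by_cases hb : S.Inner b
    · right
      have := S.abs_X_sub h ha.1 hb.1
      have ha' := ha
      have hb' := hb
      rw [inner_iff] at ha' hb'
      refine ⟨a, b, h, by omega, Or.inl ⟨ha, hb⟩, (S.X a + S.X b) / 2, ?_⟩
      omega
    · exact Or.inl ⟨a, ha, b, hb, h⟩
  · by_cases hb : S.Inner b
    · exact Or.inl ⟨b, hb, a, ha, h.symm⟩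
    · right
      rw [innerEdge_iff] at hin
      have hx := (hin.resolve_left ha).resolve_left hb
      obtain ⟨c, d, hc, -⟩ := S.exists_rep h
      have hA := S.area_cases hc
      simp only [area_eq] at hA
      -- The apex lies on the axis and the doubled area is odd, so the crossing point is
      -- half-integral.
      have hpar : (S.X a + S.X b) % 2 = 1 := by
        rcases S.Y_cases a with ya | ya | ya <;> rcases S.Y_cases b with yb | yb | yb <;>
          rcases S.Y_cases c with yc | yc | yc <;>
          simp only [ya, yb, yc] at hA <;> omega
      exact ⟨a, b, h, hx.1, Or.inr ⟨ha, hb⟩, (S.X a + S.X b) / 2, by omega⟩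

/-- Label the cycle around (i,0) by 2i - 1 and the gap from (i,0) to (i+1,0) by 2i. Skeleton edges
with equal labels have equal lengths, so the lengths factor through 2g - 1 labels. -/
theorem coneDim_le [Finite (latticePoints P)] (S : Strip P T g)
    (hT : IsRegularUnimodularTriangulation P T) : (coneDim T : ℤ) ≤ 2 * g - 1 := by
  have hlab : ∀ s : SkeletonEdge (dualGraph T), ∃ i : Finset.Icc 1 (2 * g - 1),
      (∃ e p, skeletonClass e = s ∧ S.Inner p ∧ e ∈ S.outerArc p ∧ i.1 = 2 * S.X p - 1) ∨
      (∃ e a b, skeletonClass e = s ∧ HasSide e.1 a b ∧ S.Y a + S.Y b = 0 ∧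
        i.1 = S.X a + S.X b - 1 ∧ i.1 % 2 = 0) := by
    intro s
    obtain ⟨e, rfl⟩ := exists_skeletonClass s
    rcases S.edge_cases e with ⟨p, hp, he⟩ | ⟨a, b, h, h0, -, i, h1, h2, h3⟩
    · have hp' := hp
      rw [inner_iff] at hp'
      exact ⟨⟨2 * S.X p - 1, Finset.mem_Icc.2 (by omega)⟩, Or.inl ⟨e, p, rfl, hp, he, rfl⟩⟩
    · exact ⟨⟨S.X a + S.X b - 1, Finset.mem_Icc.2 (by omega)⟩,
        Or.inr ⟨e, a, b, rfl, h, h0, rfl, by simp only; omega⟩⟩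
  choose lab hlab using hlab
  have hle := finrank_range_le_card (skeletonMap T) lab (by
    intro s s' hs ω
    rcases hlab s with ⟨e, p, rfl, hp, he, hi⟩ | ⟨e, a, b, rfl, h, h0, hi, hpar⟩ <;>
      rcases hlab s' with ⟨e', p', rfl, hp', he', hi'⟩ | ⟨e', a', b', rfl, h', h0', hi', hpar'⟩
    · have : p = p' := S.ext _ _ (by rw [hs] at hi; omega) (hp.1.trans hp'.1.symm)
      subst this
      obtain ⟨Φ, hΦ⟩ := S.exists_outer_value hp
      rw [hΦ e he, hΦ e' he']
    · rw [hs] at hi; omega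
    · rw [hs] at hpar; omega
    · rw [S.gap_unique h h' h0 h0' (by rw [hs] at hi; omega)])
  rw [← coneDim_eq_finrank_range hT, Fintype.card_coe, Int.card_Icc] at hle
  have := S.two_le
  omega

/-- Each end of an arc contributes at least 1 to the diagonal coefficient of the cycle length and at
most one off-diagonal entry, equal to 1: this is the diagonal dominance. -/
theorem LeftValue.eq_sub {S : Strip P T g} {p : latticePoints P}
    {φ : (latticePoints P → ℝ) → ℝ} (hφ : S.LeftValue p φ) {ω : latticePoints P → ℝ}
    (hω : ∀ q, ¬S.Inner q → ω q = 0) :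
    ∃ x c : ℝ, 1 ≤ c ∧ φ ω = x - c * ω p ∧
      (x = 0 ∨ ∃ p', S.Inner p' ∧ S.X p' = S.X p - 1 ∧ x = ω p') := by
  rcases hφ with ⟨p', q, r, h, rfl⟩ | ⟨q, r, h, rfl⟩
  · refine ⟨ω p', 1, le_rfl, by ring, ?_⟩
    by_cases hi : S.Inner p'
    · exact Or.inr ⟨p', hi, h.X_eq, rfl⟩
    · exact Or.inl (hω p' hi)
  · refine ⟨0, 2, by norm_num, ?_, Or.inl rfl⟩
    have h1 := h.top
    have h2 := h.bot
    simp only [hω q (by rw [inner_iff]; omega), hω r (by rw [inner_iff]; omega)]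
    ring

theorem two_mul_abs_le {w x y c : ℝ} (hc : 2 ≤ c) (h : c * w = x + y) :
    2 * |w| ≤ |x| + |y| := by
  have h1 : |c * w| ≤ |x| + |y| := by rw [h]; exact abs_add_le x y
  rw [abs_mul, abs_of_nonneg (by linarith)] at h1
  nlinarith [abs_nonneg w]

/-- If heights vanish outside the interior lattice points and give length zero around `p`, the
height at `p` is at most the average of the neighbouring ones. -/
theorem two_mul_abs_height_le [Finite (latticePoints P)] (S : Strip P T g) {p : latticePoints P}
    (hp : S.Inner p) {ω : latticePoints P → ℝ} (hω : ∀ q, ¬S.Inner q → ω q = 0)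
    {e : (core (dualGraph T)).edgeSet} (he : e ∈ S.outerArc p)
    (h : skeletonMap T ω (skeletonClass e) = 0) :
    ∃ x y : ℝ, 2 * |ω p| ≤ |x| + |y| ∧
      (x = 0 ∨ ∃ p', S.Inner p' ∧ S.X p' = S.X p - 1 ∧ x = ω p') ∧
      (y = 0 ∨ ∃ p', S.Inner p' ∧ S.X p' = S.X p + 1 ∧ y = ω p') := by
  have left : ∀ S : Strip P T g, S.Inner p → (∀ q, ¬S.Inner q → ω q = 0) → S.X p = 1 →
      e ∈ S.outerArc p → ∃ y : ℝ, 2 * |ω p| ≤ |(0 : ℝ)| + |y| ∧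
      (y = 0 ∨ ∃ p', S.flipX.Inner p' ∧ S.flipX.X p' = S.flipX.X p - 1 ∧ y = ω p') := by
    intro S hp hω h1 he
    obtain ⟨ψ, hψ⟩ := S.flipX.exists_leftValue (S.flipX_inner.2 hp)
    obtain ⟨y, c, hc, hψω, hy⟩ := hψ.eq_sub (ω := ω)
      (fun q hq => hω q fun h => hq (S.flipX_inner.2 h))
    refine ⟨y, ?_, hy⟩
    rcases S.left_cases hp with ⟨p', q, r, h'⟩ | ⟨q, r, h'⟩
    · have t1 := h'.top
      have t2 := h'.bot
      have t3 := h'.X_eq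
      rw [S.skeletonMap_left_spine hp h1 h' hψ he, hω p' (by rw [inner_iff]; omega),
        hω q (by rw [inner_iff]; omega), hω r (by rw [inner_iff]; omega), hψω] at h
      -- The segment qr meets the axis at or to the right of (0,0); this keeps the coefficient 1 + c
      -- + β/2 at least 2.
      have hβ : (0 : ℝ) ≤ (S.X q + S.X r : ℤ) := by exact_mod_cast (S.sides q r t1 t2).1
      exact two_mul_abs_le (c := 1 + c + (S.X q + S.X r : ℤ) / 2) (by linarith) (by linarith)
    · have t1 := h'.top
      have t2 := h'.bot
      rw [S.skeletonMap_left_cross hp h1 h' hψ he,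
        hω q (by rw [inner_iff]; omega), hω r (by rw [inner_iff]; omega), hψω] at h
      exact two_mul_abs_le (c := 2 + c) (by linarith) (by linarith)
  by_cases h1 : S.X p = 1
  · obtain ⟨y, hle, hy⟩ := left S hp hω h1 he
    refine ⟨0, y, hle, Or.inl rfl, hy.imp id ?_⟩
    rintro ⟨p', hp', hX, hyp⟩
    exact ⟨p', S.flipX_inner.1 hp', by simp only [flipX] at hX; omega, hyp⟩
  by_cases h2 : S.X p = g
  · obtain ⟨x, hle, hx⟩ := left S.flipX (S.flipX_inner.2 hp)
      (fun q hq => hω q fun h => hq (S.flipX_inner.2 h)) (by simp only [flipX]; omega)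
      (by rw [flipX_outerArc]; exact he)
    rw [flipX_flipX] at hx
    exact ⟨x, 0, by linarith, hx, Or.inl rfl⟩
  obtain ⟨φ, hφ⟩ := S.exists_leftValue hp
  obtain ⟨ψ, hψ⟩ := S.flipX.exists_leftValue (S.flipX_inner.2 hp)
  obtain ⟨x, c, hc, hφω, hx⟩ := hφ.eq_sub hω
  obtain ⟨y, c', hc', hψω, hy⟩ := hψ.eq_sub (ω := ω)
    (fun q hq => hω q fun h => hq (S.flipX_inner.2 h))
  obtain ⟨q, hq, hs⟩ := he
  rw [S.skeletonMap_middle hp hφ hψ h1 h2 hs hq, hφω, hψω] at h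
  refine ⟨x, y, two_mul_abs_le (c := c + c') (by linarith) (by linarith), hx, hy.imp id ?_⟩
  rintro ⟨p', hp', hX, hyp⟩
  exact ⟨p', S.flipX_inner.1 hp', by simp only [flipX] at hX; omega, hyp⟩

theorem outerArc_nonempty [Finite (latticePoints P)] (S : Strip P T g) {p : latticePoints P}
    (hp : S.Inner p) : (S.outerArc p).Nonempty := by
  obtain ⟨q, c, h, hq, -⟩ := S.exists_left_cap hp
  obtain ⟨e, he⟩ := S.exists_edge h (S.innerEdge_of_left q hp)
  exact ⟨e, q, S.not_inner_of_top hq, he⟩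

/-- Discrete maximum principle: at the leftmost point where |ω| is maximal, 2|ω(p)| ≤ |x| + |y|
forces |x| to be maximal too. Then x is neither 0 nor the height of a point further left. -/
theorem eq_zero_of_skeletonMap [Finite (latticePoints P)] (S : Strip P T g)
    {ω : latticePoints P → ℝ} (hω : ∀ q, ¬S.Inner q → ω q = 0)
    (h : ∀ p, S.Inner p → ∃ e ∈ S.outerArc p, skeletonMap T ω (skeletonClass e) = 0) : ω = 0 := by
  by_contra hne
  obtain ⟨p₀, hp₀⟩ := Function.ne_iff.1 hne
  have : Nonempty (latticePoints P) := ⟨p₀⟩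
  obtain ⟨m, hm⟩ := Finite.exists_max fun p => |ω p|
  have hmpos : 0 < |ω m| := (abs_pos.2 hp₀).trans_le (hm p₀)
  have : Nonempty {p // |ω p| = |ω m|} := ⟨⟨m, rfl⟩⟩
  obtain ⟨⟨p, hp⟩, hmin⟩ := Finite.exists_min fun p : {p // |ω p| = |ω m|} => S.X p.1
  have hpi : S.Inner p := by
    by_contra hcon
    rw [hω p hcon, abs_zero] at hp
    exact hmpos.ne hp
  obtain ⟨e, he, h0⟩ := h p hpi
  obtain ⟨x, y, hle, hx, hy⟩ := S.two_mul_abs_height_le hpi hω he h0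
  have hy' : |y| ≤ |ω m| := by
    rcases hy with rfl | ⟨p', -, -, rfl⟩
    · rw [abs_zero]; exact hmpos.le
    · exact hm p'
  have hx' : |ω m| ≤ |x| := by rw [hp] at hle; linarith
  rcases hx with rfl | ⟨p', -, hX, rfl⟩
  · rw [abs_zero] at hx'; linarith
  · have := hmin ⟨p', le_antisymm (hm p') hx'⟩
    simp only at this
    omega

theorem card_inner [Finite (latticePoints P)] (S : Strip P T g) :
    (Nat.card {p // S.Inner p} : ℤ) = g := by
  have hbij : Function.Bijective
      (fun p : {p // S.Inner p} => (⟨S.X p.1, Finset.mem_Icc.2 p.2.2⟩ : Finset.Icc 1 g)) := by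
    constructor
    · intro p q h
      exact Subtype.ext (S.ext _ _ (congrArg Subtype.val h) (p.2.1.trans q.2.1.symm))
    · rintro ⟨i, hi⟩
      rw [Finset.mem_Icc] at hi
      obtain ⟨p, h1, h2⟩ := S.exists_inner i hi.1 hi.2
      exact ⟨⟨p, h2, by omega⟩, Subtype.ext h1⟩
  rw [Nat.card_congr (Equiv.ofBijective _ hbij), Nat.card_eq_fintype_card, Fintype.card_coe,
    Int.card_Icc]
  have := S.two_le
  omega

/-- On the g-dimensional space of heights supported on the interior lattice points, the cycle
lengths alone are injective. -/
theorem le_coneDim [Finite (latticePoints P)] (S : Strip P T g)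
    (hT : IsRegularUnimodularTriangulation P T) : g ≤ coneDim T := by
  classical
  have := Fintype.ofFinite {p // S.Inner p}
  let ext : ({p // S.Inner p} → ℝ) →ₗ[ℝ] (latticePoints P → ℝ) :=
    { toFun := fun h p => if hp : S.Inner p then h ⟨p, hp⟩ else 0
      map_add' := fun h h' => by
        funext p
        by_cases hp : S.Inner p <;> simp [hp]
      map_smul' := fun c h => by
        funext p
        by_cases hp : S.Inner p <;> simp [hp] }
  have hinj : Function.Injective (skeletonMap T ∘ₗ ext) := by
    rw [← LinearMap.ker_eq_bot, LinearMap.ker_eq_bot']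
    intro h h0
    have hz : ext h = 0 := by
      refine S.eq_zero_of_skeletonMap (fun q hq => ?_) fun p hp => ?_
      · exact dif_neg hq
      · obtain ⟨e, he⟩ := S.outerArc_nonempty hp
        exact ⟨e, he, congrFun h0 _⟩
    funext p
    have := congrFun hz p.1
    rw [Pi.zero_apply] at this
    rw [Pi.zero_apply, ← this]
    change h p = if hp : S.Inner p.1 then h ⟨p.1, hp⟩ else 0
    rw [dif_pos p.2]
  have h1 := LinearMap.finrank_range_of_inj hinj
  have h2 : LinearMap.range (skeletonMap T ∘ₗ ext) ≤ LinearMap.range (skeletonMap T) :=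
    LinearMap.range_comp_le_range _ _
  have h3 := Submodule.finrank_mono h2
  rw [h1, Module.finrank_fintype_fun_eq_card, ← Nat.card_eq_fintype_card,
    ← coneDim_eq_finrank_range hT] at h3
  rw [← S.card_inner]
  exact_mod_cast h3

end Strip

end Strip

end TropicalModuli

namespace TropicalModuli

/-! ### Unimodular coordinates -/

/-- An orientation preserving affine automorphism of the lattice, `p ↦ (X p, Y p)`. -/
structure Chart where
  a : ℤ
  b : ℤ
  c : ℤ
  a' : ℤ
  b' : ℤ
  c' : ℤ
  det : a * b' - b * a' = 1

namespace Chart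

variable (χ : Chart)

/-- The first coordinate of a lattice point. -/
def X (p : ℤ × ℤ) : ℤ := χ.a * p.1 + χ.b * p.2 + χ.c

/-- The second coordinate of a lattice point. -/
def Y (p : ℤ × ℤ) : ℤ := χ.c' + χ.a' * p.1 + χ.b' * p.2

/-- The first coordinate of a point in the plane. -/
def x (z : ℝ × ℝ) : ℝ := χ.a * z.1 + χ.b * z.2 + χ.c

/-- The second coordinate of a point in the plane. -/
def y (z : ℝ × ℝ) : ℝ := χ.c' + χ.a' * z.1 + χ.b' * z.2

/-- The lattice point with given coordinates. -/
def point (m n : ℤ) : ℤ × ℤ :=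
  (χ.b' * (m - χ.c) - χ.b * (n - χ.c'), χ.a * (n - χ.c') - χ.a' * (m - χ.c))

@[simp] theorem X_point (m n : ℤ) : χ.X (χ.point m n) = m := by
  simp only [X, point]; linear_combination (m - χ.c) * χ.det

@[simp] theorem Y_point (m n : ℤ) : χ.Y (χ.point m n) = n := by
  simp only [Y, point]; linear_combination (n - χ.c') * χ.det

@[simp] theorem x_toPlane (p : ℤ × ℤ) : χ.x (toPlane p) = χ.X p := by simp [x, X, toPlane]

@[simp] theorem y_toPlane (p : ℤ × ℤ) : χ.y (toPlane p) = χ.Y p := by simp [y, Y, toPlane]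

theorem ext_real {z w : ℝ × ℝ} (h1 : χ.x z = χ.x w) (h2 : χ.y z = χ.y w) : z = w := by
  have hd : (χ.a : ℝ) * χ.b' - χ.b * χ.a' = 1 := by exact_mod_cast χ.det
  simp only [x, y] at h1 h2
  ext
  · linear_combination (w.1 - z.1) * hd + (χ.b' : ℝ) * h1 - (χ.b : ℝ) * h2
  · linear_combination (w.2 - z.2) * hd - (χ.a' : ℝ) * h1 + (χ.a : ℝ) * h2

theorem x_combo {r s : ℝ} (h : r + s = 1) (z w : ℝ × ℝ) :
    χ.x (r • z + s • w) = r * χ.x z + s * χ.x w := by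
  simp only [x, Prod.fst_add, Prod.snd_add, Prod.smul_fst, Prod.smul_snd, smul_eq_mul]
  linear_combination (-(χ.c : ℝ)) * h

theorem y_combo {r s : ℝ} (h : r + s = 1) (z w : ℝ × ℝ) :
    χ.y (r • z + s • w) = r * χ.y z + s * χ.y w := by
  simp only [y, Prod.fst_add, Prod.snd_add, Prod.smul_fst, Prod.smul_snd, smul_eq_mul]
  linear_combination (-(χ.c' : ℝ)) * h

/-- The affine relations between lattice points can be read off from their coordinates. -/
theorem relation {α β γ δ : ℤ} {p q r s : ℤ × ℤ} (h : α + β = γ + δ)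
    (h1 : α * χ.X p + β * χ.X q = γ * χ.X r + δ * χ.X s)
    (h2 : α * χ.Y p + β * χ.Y q = γ * χ.Y r + δ * χ.Y s) :
    α * p.1 + β * q.1 = γ * r.1 + δ * s.1 ∧ α * p.2 + β * q.2 = γ * r.2 + δ * s.2 := by
  simp only [X, Y] at h1 h2
  constructor
  · linear_combination (-(α * p.1 + β * q.1 - γ * r.1 - δ * s.1)) * χ.det + χ.b' * h1 - χ.b * h2
      - (χ.b' * χ.c - χ.b * χ.c') * h
  · linear_combination (-(α * p.2 + β * q.2 - γ * r.2 - δ * s.2)) * χ.det - χ.a' * h1 + χ.a * h2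
      - (χ.a * χ.c' - χ.a' * χ.c) * h

/-- In the coordinates, `P` has the interior lattice points `(1, 0), …, (g, 0)`. -/
def Adapted (P : Set (ℝ × ℝ)) (g : ℤ) : Prop :=
  ∀ p, p ∈ interiorLatticePoints P ↔ χ.Y p = 0 ∧ 1 ≤ χ.X p ∧ χ.X p ≤ g

/-- The half turn of the coordinates about the centre of `(1, 0), …, (g, 0)`. -/
def turn (g : ℤ) : Chart where
  a := -χ.a
  b := -χ.b
  c := g + 1 - χ.c
  a' := -χ.a'
  b' := -χ.b'
  c' := -χ.c'
  det := by linear_combination χ.det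

theorem turn_X (g : ℤ) (p : ℤ × ℤ) : (χ.turn g).X p = g + 1 - χ.X p := by
  simp only [turn, X]; ring

theorem turn_Y (g : ℤ) (p : ℤ × ℤ) : (χ.turn g).Y p = -χ.Y p := by
  simp only [turn, Y]; ring

theorem turn_x (g : ℤ) (z : ℝ × ℝ) : (χ.turn g).x z = g + 1 - χ.x z := by
  simp only [turn, x]; push_cast; ring

theorem turn_y (g : ℤ) (z : ℝ × ℝ) : (χ.turn g).y z = -χ.y z := by
  simp only [turn, y]; push_cast; ring

variable {χ} {P : Set (ℝ × ℝ)} {g : ℤ}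

theorem Adapted.turn (h : χ.Adapted P g) : (χ.turn g).Adapted P g := by
  intro p
  rw [h p, turn_X, turn_Y]
  omega

/-- The interior of a convex set is convex, so it contains the segment from (1,0) to (g,0). -/
theorem Adapted.mem_interior (h : χ.Adapted P g) (hP : Convex ℝ P) {z : ℝ × ℝ}
    (hg : 1 ≤ g) (hy : χ.y z = 0) (h1 : 1 ≤ χ.x z) (h2 : χ.x z ≤ g) : z ∈ interior P := by
  have m1 : toPlane (χ.point 1 0) ∈ interior P := (h _).2 (by simp [hg])
  have m2 : toPlane (χ.point g 0) ∈ interior P := (h _).2 (by simp [hg])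
  rcases hg.eq_or_lt with rfl | hg
  · have : z = toPlane (χ.point 1 0) := χ.ext_real
      (by rw [x_toPlane, X_point]; push_cast at h2 ⊢; linarith)
      (by rw [y_toPlane, Y_point, hy]; simp)
    rw [this]
    exact m1
  · have hg' : (0 : ℝ) < g - 1 := by
      have : (1 : ℝ) < g := by exact_mod_cast hg
      linarith
    have hs : ((g : ℝ) - χ.x z) / (g - 1) + (χ.x z - 1) / (g - 1) = 1 := by field_simp; ring
    have hz : z = (((g : ℝ) - χ.x z) / (g - 1)) • toPlane (χ.point 1 0) +
        ((χ.x z - 1) / (g - 1)) • toPlane (χ.point g 0) := by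
      refine χ.ext_real ?_ ?_
      · rw [x_combo _ hs, x_toPlane, x_toPlane, X_point, X_point]
        field_simp
        push_cast
        ring
      · rw [y_combo _ hs, y_toPlane, y_toPlane, Y_point, Y_point, hy]
        simp
    rw [hz]
    exact hP.interior m1 m2 (div_nonneg (by linarith) hg'.le) (div_nonneg (by linarith) hg'.le) hs

/-- On the axis, `P` extends at most to the next lattice points beyond the interior ones. -/
theorem Adapted.nonneg (h : χ.Adapted P g) (hP : Convex ℝ P) (hg : 1 ≤ g) {z : ℝ × ℝ}
    (hz : z ∈ P) (hy : χ.y z = 0) : 0 ≤ χ.x z := by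
  by_contra! hlt
  have m1 : toPlane (χ.point 1 0) ∈ interior P := (h _).2 (by simp [hg])
  have hpos : 0 < 1 - χ.x z := by linarith
  have hs : (-χ.x z) / (1 - χ.x z) + 1 / (1 - χ.x z) = 1 := by field_simp; ring
  -- If `z` were beyond (0,0), that lattice point would lie strictly between `z` and the interior
  -- point (1,0), and so be interior.
  have m0 := hP.combo_interior_self_mem_interior m1 hz (div_pos (neg_pos.2 hlt) hpos)
    (div_nonneg zero_le_one hpos.le) hs
  have heq : (-χ.x z / (1 - χ.x z)) • toPlane (χ.point 1 0) + (1 / (1 - χ.x z)) • z =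
      toPlane (χ.point 0 0) := by
    refine χ.ext_real ?_ ?_
    · rw [x_combo _ hs, x_toPlane, x_toPlane, X_point, X_point]
      field_simp
      push_cast
      ring
    · rw [y_combo _ hs, y_toPlane, y_toPlane, Y_point, Y_point, hy]
      simp
  rw [heq] at m0
  have := (h _).1 m0
  rw [X_point] at this
  omega

theorem Adapted.le_add_one (h : χ.Adapted P g) (hP : Convex ℝ P) (hg : 1 ≤ g) {z : ℝ × ℝ}
    (hz : z ∈ P) (hy : χ.y z = 0) : χ.x z ≤ g + 1 := by
  have := h.turn.nonneg hP hg hz (by rw [turn_y, hy, neg_zero])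
  rw [turn_x] at this
  linarith

/-- A polygon with at least two interior lattice points, all on the axis, lies in a strip. -/
theorem Adapted.Y_le_one (h : χ.Adapted P g) (hP : Convex ℝ P) (hg : 2 ≤ g) {p : ℤ × ℤ}
    (hp : p ∈ latticePoints P) : χ.Y p ≤ 1 := by
  by_contra! hlt
  set k := χ.Y p with hk
  -- At height 1, the triangle on (1,0), (2,0) with apex p has first coordinates from (X p + k -
  -- 1)/k to (X p + 2k - 2)/k. Among these k consecutive numerators one is divisible by k; `n` is
  -- its quotient.
  set n := (χ.X p + 2 * k - 2) / k with hn
  have hk0 : 0 < k := by omega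
  have h1 : k * n ≤ χ.X p + 2 * k - 2 := Int.mul_ediv_self_le hk0.ne'
  have h2 : χ.X p + 2 * k - 2 < k * n + k := Int.lt_mul_ediv_self_add hk0
  have h1' : (k : ℝ) * n ≤ χ.X p + 2 * k - 2 := by exact_mod_cast h1
  have h2' : (χ.X p : ℝ) + k - 1 ≤ k * n := by
    have : χ.X p + k - 1 ≤ k * n := by omega
    exact_mod_cast this
  have hk1 : (1 : ℝ) < k := by exact_mod_cast hlt
  have hg' : (2 : ℝ) ≤ g := by exact_mod_cast hg
  -- The line from `p` through (n,1) meets the axis at (c,0). Since 1 ≤ c ≤ 2, this is an interior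
  -- point, and so (n,1) is interior.
  set c : ℝ := (k * n - χ.X p) / (k - 1) with hc
  have hc' : c * (k - 1) = k * n - χ.X p := by
    rw [hc]; field_simp [show (k : ℝ) - 1 ≠ 0 by linarith]
  have c1 : 1 ≤ c := by rw [hc, le_div_iff₀ (by linarith)]; linarith
  have c2 : c ≤ 2 := by rw [hc, div_le_iff₀ (by linarith)]; linarith
  have hs0 : (2 - c) + (c - 1) = 1 := by ring
  have hz : (2 - c) • toPlane (χ.point 1 0) + (c - 1) • toPlane (χ.point 2 0) ∈ interior P := by
    refine h.mem_interior hP (by omega) ?_ ?_ ?_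
    · rw [y_combo _ hs0]; simp
    · rw [x_combo _ hs0]; simp; linarith
    · rw [x_combo _ hs0]; simp; linarith
  have hs : ((k : ℝ) - 1) / k + 1 / k = 1 := by field_simp; ring
  have m := hP.combo_interior_self_mem_interior hz hp (div_pos (by linarith) (by linarith))
    (div_nonneg zero_le_one (by linarith)) hs
  have heq : (((k : ℝ) - 1) / k) •
      ((2 - c) • toPlane (χ.point 1 0) + (c - 1) • toPlane (χ.point 2 0)) +
      ((1 : ℝ) / k) • toPlane p = toPlane (χ.point n 1) := by
    refine χ.ext_real ?_ ?_
    · rw [x_combo _ hs, x_combo _ hs0]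
      simp only [x_toPlane, X_point]
      push_cast
      field_simp
      linear_combination hc'
    · rw [y_combo _ hs, y_combo _ hs0]
      simp only [y_toPlane, Y_point, ← hk]
      push_cast
      field_simp
      ring
  rw [heq] at m
  have := (h _).1 m
  rw [Y_point] at this
  omega

theorem Adapted.neg_one_le_Y (h : χ.Adapted P g) (hP : Convex ℝ P) (hg : 2 ≤ g) {p : ℤ × ℤ}
    (hp : p ∈ latticePoints P) : -1 ≤ χ.Y p := by
  have := h.turn.Y_le_one hP hg hp
  rw [turn_Y] at this
  omega

theorem coordArea_eq (a b c : latticePoints P) :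
    coordArea (fun p => χ.X p.1) (fun p => χ.Y p.1) a b c = doubleArea a.1 b.1 c.1 := by
  simp only [coordArea, doubleArea, X, Y]
  linear_combination ((b.1.1 - a.1.1) * (c.1.2 - a.1.2) - (b.1.2 - a.1.2) * (c.1.1 - a.1.1)) * χ.det

/-- The triangle at an interior lattice point that contains the direction `±1` of the axis. -/
theorem Adapted.exists_cap (h : χ.Adapted P g) (hP : Convex ℝ P) (hg : 2 ≤ g)
    {T : Finset (Finset (latticePoints P))} (hT : IsUnimodularTriangulation P T) {ε : ℤ}
    (hε : ε = 1 ∨ ε = -1) {p : latticePoints P}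
    (hp : InnerPoint g (fun p => χ.X p.1) (fun p => χ.Y p.1) p) :
    ∃ q r, {p, q, r} ∈ T ∧ ((χ.Y q.1 = 0 ∧ χ.X q.1 = χ.X p.1 + ε) ∨
      (χ.Y q.1 = 1 ∧ χ.Y r.1 = -1 ∧ χ.X q.1 + χ.X r.1 = 2 * χ.X p.1 + ε)) := by
  have hd : (χ.a : ℝ) * χ.b' - χ.b * χ.a' = 1 := by exact_mod_cast χ.det
  -- The vector (b'ε, -a'ε) is the axis direction (ε, 0) of the chart, written in the original
  -- coordinates.
  obtain ⟨t, ht, hpt, δ, hδ, hdir⟩ := hT.exists_direction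
    (eventually_mem_of_mem_interior ((h p.1).2 hp) ((χ.b' * ε : ℝ), (-χ.a' * ε : ℝ)))
  have hpt' := mem_of_toPlane_mem_hull (hT.unimodular t ht) hpt
  obtain ⟨q, r, rfl, hD⟩ := (hT.unimodular t ht).exists_of_mem hpt'
  rw [← χ.coordArea_eq] at hD
  simp only [coordArea] at hD
  obtain ⟨α, β, γ, hα, hβ, hγ, hs, e1, e2⟩ := mem_hull_triple.1 hdir
  simp only [toPlane, Prod.smul_mk, Prod.mk_add_mk, smul_eq_mul] at e1 e2
  have hα' : α = 1 - β - γ := by linarith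
  subst hα'
  have E1 : β * ((χ.X q.1 : ℝ) - χ.X p.1) + γ * ((χ.X r.1 : ℝ) - χ.X p.1) = δ * ε := by
    simp only [X]
    push_cast
    linear_combination (χ.a : ℝ) * e1 + (χ.b : ℝ) * e2 + δ * ε * hd
  have E2 : β * ((χ.Y q.1 : ℝ) - χ.Y p.1) + γ * ((χ.Y r.1 : ℝ) - χ.Y p.1) = 0 := by
    simp only [Y]
    push_cast
    linear_combination (χ.a' : ℝ) * e1 + (χ.b' : ℝ) * e2
  have hp0 : χ.Y p.1 = 0 := hp.1
  rw [hp0] at E2 hD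
  have hY : ∀ q : latticePoints P, χ.Y q.1 = -1 ∨ χ.Y q.1 = 0 ∨ χ.Y q.1 = 1 := by
    intro q
    have := h.Y_le_one hP hg q.2
    have := h.neg_one_le_Y hP hg q.2
    omega
  have hswap : {p, r, q} ∈ T := by rw [triple_swap_right]; exact ht
  -- the sign of a coordinate difference `±1`, from a positive multiple of it
  have sgn : ∀ (s : ℝ) (m : ℤ), 0 ≤ s → s * m = δ * ε → m = 1 ∨ m = -1 → m = ε := by
    intro s m hs h hm
    rcases hε with rfl | rfl <;> rcases hm with rfl | rfl <;> push_cast at h <;>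
      first | rfl | (exfalso; linarith)
  have hDc := (abs_eq zero_le_one).1 hD
  -- The vertical components of the edges at `p` must cancel: either one edge lies on the axis, or
  -- one goes up and one down with equal weights.
  rcases hY q with yq | yq | yq <;> rcases hY r with yr | yr | yr <;>
    simp only [yq, yr] at E2 hDc <;> push_cast at E2
  · exfalso
    have hβ0 : β = 0 := by linarith
    have hγ0 : γ = 0 := by linarith
    rw [hβ0, hγ0] at E1
    rcases hε with rfl | rfl <;> push_cast at E1 <;> linarith
  · refine ⟨r, q, hswap, Or.inl ⟨yr, ?_⟩⟩
    have hβ0 : β = 0 := by linarith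
    have := sgn γ (χ.X r.1 - χ.X p.1) hγ (by push_cast; rw [hβ0] at E1; linarith) (by omega)
    omega
  · refine ⟨r, q, hswap, Or.inr ⟨yr, yq, ?_⟩⟩
    have hβγ : γ = β := by linarith
    have := sgn γ (χ.X r.1 + χ.X q.1 - 2 * χ.X p.1) hγ
      (by push_cast; rw [hβγ] at E1 ⊢; linarith) (by omega)
    omega
  · refine ⟨q, r, ht, Or.inl ⟨yq, ?_⟩⟩
    have hγ0 : γ = 0 := by linarith
    have := sgn β (χ.X q.1 - χ.X p.1) hβ (by push_cast; rw [hγ0] at E1; linarith) (by omega)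
    omega
  · exfalso
    omega
  · refine ⟨q, r, ht, Or.inl ⟨yq, ?_⟩⟩
    have hγ0 : γ = 0 := by linarith
    have := sgn β (χ.X q.1 - χ.X p.1) hβ (by push_cast; rw [hγ0] at E1; linarith) (by omega)
    omega
  · refine ⟨q, r, ht, Or.inr ⟨yq, yr, ?_⟩⟩
    have hβγ : γ = β := by linarith
    have := sgn γ (χ.X r.1 + χ.X q.1 - 2 * χ.X p.1) hγ
      (by push_cast; rw [hβγ] at E1 ⊢; linarith) (by omega)
    omega
  · refine ⟨r, q, hswap, Or.inl ⟨yr, ?_⟩⟩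
    have hβ0 : β = 0 := by linarith
    have := sgn γ (χ.X r.1 - χ.X p.1) hγ (by push_cast; rw [hβ0] at E1; linarith) (by omega)
    omega
  · exfalso
    have hβ0 : β = 0 := by linarith
    have hγ0 : γ = 0 := by linarith
    rw [hβ0, hγ0] at E1
    rcases hε with rfl | rfl <;> push_cast at E1 <;> linarith

/-- The strip given by adapted coordinates. -/
def Adapted.strip [Fintype (latticePoints P)] (h : χ.Adapted P g) (hP : Convex ℝ P) (hg : 2 ≤ g)
    {T : Finset (Finset (latticePoints P))} (hT : IsUnimodularTriangulation P T) :
    Strip P T g where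
  X p := χ.X p.1
  Y p := χ.Y p.1
  two_le := hg
  triangulation := hT
  ext p q h1 h2 := by
    apply Subtype.ext
    apply toPlane_injective
    exact χ.ext_real (by rw [x_toPlane, x_toPlane, h1]) (by rw [y_toPlane, y_toPlane, h2])
  Y_cases p := by
    have := h.Y_le_one hP hg p.2
    have := h.neg_one_le_Y hP hg p.2
    omega
  abs_area a b c h' := by rw [coordArea_eq]; exact hT.doubleArea_abs h'
  relation a b c d β h1 h2 := by
    have := χ.relation (α := 1) (β := 1) (γ := 2 - β) (δ := β) (p := c.1) (q := d.1) (r := a.1)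
      (s := b.1) (by ring) (by linarith) (by linarith)
    simpa only [one_mul] using this
  segments t ht t' ht' a ha b hb c hc d hd α β γ δ h1 h2 h3 h4 h5 h6 h7 := by
    have := χ.relation h5 h6 h7
    exact hT.segments_eq ht ht' ha hb hc hd h1 h2 h3 h4 h5 this.1 this.2
  apex_unique a b c d h1 h2 h3 := by
    rw [coordArea_eq, coordArea_eq] at h3
    exact hT.apex_unique h1 h2 h3
  opposite a b c h' hin := by
    simp only [coordArea_eq]
    refine hT.exists_opposite h' ?_
    rcases hin with hin | hin | ⟨h0, -, h1, h2⟩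
    · exact hP.combo_interior_self_mem_interior ((h a.1).2 hin) b.2 (by norm_num) (by norm_num)
        (by norm_num)
    · rw [add_comm]
      exact hP.combo_interior_self_mem_interior ((h b.1).2 hin) a.2 (by norm_num) (by norm_num)
        (by norm_num)
    · have h0' : (χ.Y a.1 : ℝ) + χ.Y b.1 = 0 := by exact_mod_cast h0
      have h1' : (2 : ℝ) < (χ.X a.1 : ℝ) + χ.X b.1 := by exact_mod_cast h1
      have h2' : (χ.X a.1 : ℝ) + χ.X b.1 < 2 * g := by exact_mod_cast h2
      refine h.mem_interior hP (by omega) ?_ ?_ ?_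
      · rw [y_combo _ (by norm_num), y_toPlane, y_toPlane]; linarith
      · rw [x_combo _ (by norm_num), x_toPlane, x_toPlane]; linarith
      · rw [x_combo _ (by norm_num), x_toPlane, x_toPlane]; linarith
  axis p hp := by
    have h1 := h.nonneg hP (by omega) p.2 (by rw [y_toPlane, hp]; simp)
    have h2 := h.le_add_one hP (by omega) p.2 (by rw [y_toPlane, hp]; simp)
    rw [x_toPlane] at h1 h2
    exact ⟨by exact_mod_cast h1, by exact_mod_cast h2⟩
  sides q r hq hr := by
    -- The midpoint lies in P and on the axis, where P is confined to [0, g+1].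
    have hm : (1 / 2 : ℝ) • toPlane q.1 + (1 / 2 : ℝ) • toPlane r.1 ∈ P :=
      hP q.2 r.2 (by norm_num) (by norm_num) (by norm_num)
    have hy : χ.y ((1 / 2 : ℝ) • toPlane q.1 + (1 / 2 : ℝ) • toPlane r.1) = 0 := by
      rw [y_combo _ (by norm_num), y_toPlane, y_toPlane, hq, hr]; norm_num
    have h1 := h.nonneg hP (by omega) hm hy
    have h2 := h.le_add_one hP (by omega) hm hy
    rw [x_combo _ (by norm_num), x_toPlane, x_toPlane] at h1 h2
    have h1' : (0 : ℝ) ≤ (χ.X q.1 : ℝ) + χ.X r.1 := by linarith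
    have h2' : (χ.X q.1 : ℝ) + χ.X r.1 ≤ 2 * g + 2 := by linarith
    exact ⟨by exact_mod_cast h1', by exact_mod_cast h2'⟩
  exists_inner i h1 h2 := by
    have : χ.point i 0 ∈ interiorLatticePoints P := (h _).2 (by simp [h1, h2])
    exact ⟨⟨χ.point i 0, (interior_subset
      (show toPlane (χ.point i 0) ∈ interior P from this) : toPlane (χ.point i 0) ∈ P)⟩,
      by simp, by simp⟩
  left p hp := by
    simpa only [← sub_eq_add_neg] using h.exists_cap hP hg hT (Or.inr rfl) hp
  right p hp := h.exists_cap hP hg hT (Or.inl rfl) hp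

end Chart

/-- A finite nonempty set of integers which contains everything between its elements is an
interval. -/
theorem exists_eq_Icc {J : Finset ℤ} (hne : J.Nonempty)
    (h : ∀ x ∈ J, ∀ z ∈ J, ∀ y, x ≤ y → y ≤ z → y ∈ J) : ∃ lo : ℤ,
      J = Finset.Icc lo (lo + J.card - 1) := by
  have hJ : J = Finset.Icc (J.min' hne) (J.max' hne) := by
    ext y
    rw [Finset.mem_Icc]
    exact ⟨fun hy => ⟨J.min'_le y hy, J.le_max' y hy⟩,
      fun hy => h _ (J.min'_mem hne) _ (J.max'_mem hne) y hy.1 hy.2⟩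
  have hle : J.min' hne ≤ J.max' hne := J.min'_le _ (J.max'_mem hne)
  have hcard : (J.card : ℤ) = J.max' hne + 1 - J.min' hne := by
    have h1 : J.card = (J.max' hne + 1 - J.min' hne).toNat := by
      conv_lhs => rw [hJ]
      exact Int.card_Icc _ _
    omega
  refine ⟨J.min' hne, ?_⟩
  have : J.min' hne + J.card - 1 = J.max' hne := by omega
  rw [this]
  exact hJ

/-- A primitive vector along the line of interior lattice points extends to a lattice basis. On that
line the interior lattice points are consecutive by convexity, and a translation starts them at 1.
-/
theorem exists_adapted_chart {P : Set (ℝ × ℝ)} {g : ℕ} (hP : Convex ℝ P) (hh : IsHyperelliptic P)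
    (hg : genus P = g) (h2 : 2 ≤ g) : ∃ χ : Chart, χ.Adapted P g := by
  have hfin : (interiorLatticePoints P).Finite := by
    apply Set.finite_of_ncard_ne_zero
    rw [genus] at hg
    omega
  obtain ⟨u, hu, v, hv, huv⟩ := (Set.one_lt_ncard hfin).1 (by rw [genus] at hg; omega)
  -- a primitive vector along the line through the interior lattice points
  obtain ⟨k, n₁, n₂, hk, hcop, e1, e2⟩ : ∃ k n₁ n₂ : ℤ, k ≠ 0 ∧ IsCoprime n₁ n₂ ∧
      v.1 - u.1 = k * n₁ ∧ v.2 - u.2 = k * n₂ := by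
    have hgcd : 0 < Int.gcd (v.1 - u.1) (v.2 - u.2) := by
      rw [Nat.pos_iff_ne_zero, Ne, Int.gcd_eq_zero_iff]
      rintro ⟨h1, h2⟩
      exact huv (Prod.ext (by omega) (by omega))
    obtain ⟨n₁, n₂, hc, h1, h2⟩ := Int.exists_gcd_one hgcd
    exact ⟨Int.gcd (v.1 - u.1) (v.2 - u.2), n₁, n₂, by exact_mod_cast hgcd.ne',
      Int.isCoprime_iff_gcd_eq_one.2 hc, h1.trans (mul_comm _ _), h2.trans (mul_comm _ _)⟩
  obtain ⟨s, t, hst⟩ := hcop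
  -- The second coordinate vanishes on the line through `u` and `v`; the Bézout coefficients give a
  -- first coordinate with determinant 1.
  let χ₀ : Chart :=
    { a := s, b := t, c := -(s * u.1 + t * u.2), a' := -n₂, b' := n₁
      c' := n₂ * u.1 - n₁ * u.2, det := by linear_combination hst }
  have hY0 : ∀ p ∈ interiorLatticePoints P, χ₀.Y p = 0 := by
    intro p hp
    obtain ⟨w, hw⟩ := (collinear_iff_of_mem (Set.mem_image_of_mem toPlane hu)).1 hh
    obtain ⟨r, hr⟩ := hw _ (Set.mem_image_of_mem toPlane hp)
    obtain ⟨r', hr'⟩ := hw _ (Set.mem_image_of_mem toPlane hv)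
    simp only [toPlane, vadd_eq_add, Prod.ext_iff, Prod.fst_add, Prod.snd_add, Prod.smul_fst,
      Prod.smul_snd, smul_eq_mul] at hr hr'
    have e1' : (v.1 : ℝ) - u.1 = k * n₁ := by exact_mod_cast e1
    have e2' : (v.2 : ℝ) - u.2 = k * n₂ := by exact_mod_cast e2
    have : (k : ℝ) * χ₀.Y p = 0 := by
      simp only [Chart.Y, χ₀]
      push_cast
      linear_combination ((p.1 : ℝ) - u.1) * e2' - ((p.2 : ℝ) - u.2) * e1' +
        ((v.1 : ℝ) - u.1) * hr.2 - ((v.2 : ℝ) - u.2) * hr.1 + r * w.2 * hr'.1 - r * w.1 * hr'.2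
    rcases mul_eq_zero.1 this with h | h
    · exact absurd (by exact_mod_cast h) hk
    · exact_mod_cast h
  have hinj : Set.InjOn χ₀.X (hfin.toFinset : Set (ℤ × ℤ)) := by
    intro p hp q hq h
    rw [Finset.mem_coe, Set.Finite.mem_toFinset] at hp hq
    apply toPlane_injective
    exact χ₀.ext_real (by rw [Chart.x_toPlane, Chart.x_toPlane, h])
      (by rw [Chart.y_toPlane, Chart.y_toPlane, hY0 p hp, hY0 q hq])
  have hmem : ∀ x, x ∈ hfin.toFinset.image χ₀.X ↔ χ₀.point x 0 ∈ interiorLatticePoints P := by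
    intro x
    rw [Finset.mem_image]
    constructor
    · rintro ⟨p, hp, rfl⟩
      rw [Set.Finite.mem_toFinset] at hp
      have : χ₀.point (χ₀.X p) 0 = p := by
        apply toPlane_injective
        exact χ₀.ext_real (by simp) (by simp [hY0 p hp])
      rw [this]
      exact hp
    · intro hp
      exact ⟨_, hfin.mem_toFinset.2 hp, χ₀.X_point x 0⟩
  -- Lattice points of the line between two interior ones are interior, so the first coordinates
  -- form an interval.
  obtain ⟨lo, hlo⟩ := exists_eq_Icc (J := hfin.toFinset.image χ₀.X)
    ⟨χ₀.X u, Finset.mem_image_of_mem _ (hfin.mem_toFinset.2 hu)⟩ (by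
      intro x hx z hz y hxy hyz
      rw [hmem] at hx hz ⊢
      rcases hxy.eq_or_lt with rfl | hxy
      · exact hx
      have hxz : (0 : ℝ) < z - x := by
        have : (x : ℝ) < z := by exact_mod_cast hxy.trans_le hyz
        linarith
      have hxy' : (x : ℝ) ≤ y := by exact_mod_cast hxy.le
      have hyz' : (y : ℝ) ≤ z := by exact_mod_cast hyz
      have hs : ((z : ℝ) - y) / (z - x) + ((y : ℝ) - x) / (z - x) = 1 := by field_simp; ring
      have m := hP.interior hx hz (div_nonneg (by linarith) hxz.le)
        (div_nonneg (by linarith) hxz.le) hs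
      have heq : (((z : ℝ) - y) / (z - x)) • toPlane (χ₀.point x 0) +
          (((y : ℝ) - x) / (z - x)) • toPlane (χ₀.point z 0) = toPlane (χ₀.point y 0) := by
        refine χ₀.ext_real ?_ ?_
        · rw [Chart.x_combo _ hs]
          simp only [Chart.x_toPlane, Chart.X_point]
          field_simp
          ring
        · rw [Chart.y_combo _ hs]
          simp only [Chart.y_toPlane, Chart.Y_point]
          simp
      rw [heq] at m
      exact m)
  have hcard : (hfin.toFinset.image χ₀.X).card = g := by
    rw [Finset.card_image_of_injOn hinj, ← hg, genus, Set.ncard_eq_toFinset_card _ hfin]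
  rw [hcard] at hlo
  -- The shift moves the first interior lattice point from `lo` to 1.
  refine ⟨{ χ₀ with c := χ₀.c - lo + 1 }, fun p => ?_⟩
  have hX : Chart.X { χ₀ with c := χ₀.c - lo + 1 } p = χ₀.X p - lo + 1 := by
    simp only [Chart.X]; ring
  have hY : Chart.Y { χ₀ with c := χ₀.c - lo + 1 } p = χ₀.Y p := rfl
  rw [hX, hY]
  constructor
  · intro hp
    have : χ₀.X p ∈ hfin.toFinset.image χ₀.X :=
      Finset.mem_image_of_mem _ (hfin.mem_toFinset.2 hp)
    rw [hlo, Finset.mem_Icc] at this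
    exact ⟨hY0 p hp, by omega, by omega⟩
  · rintro ⟨h0, h1, h2⟩
    have : χ₀.X p ∈ hfin.toFinset.image χ₀.X := by
      rw [hlo, Finset.mem_Icc]; omega
    rw [hmem] at this
    have hp : χ₀.point (χ₀.X p) 0 = p := by
      apply toPlane_injective
      exact χ₀.ext_real (by simp) (by simp [h0])
    rwa [hp] at this

/-- The dimension of the cone of every regular unimodular triangulation of a hyperelliptic
polygon of genus `g` lies between `g` and `2g - 1`. -/
theorem coneDim_bounds {P : Set (ℝ × ℝ)} {g : ℕ} (hP : IsLatticePolygon P)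
    (hh : IsHyperelliptic P) (hg : genus P = g) (h2 : 2 ≤ g)
    {T : Finset (Finset (latticePoints P))} (hT : IsRegularUnimodularTriangulation P T) :
    g ≤ coneDim T ∧ coneDim T ≤ 2 * g - 1 := by
  have := hP.finite
  have := Fintype.ofFinite (latticePoints P)
  obtain ⟨χ, hχ⟩ := exists_adapted_chart hP.convex hh hg h2
  let S := hχ.strip hP.convex (by exact_mod_cast h2) hT.1
  have h1 := S.le_coneDim hT
  have h2 := S.coneDim_le hT
  omega

end TropicalModuli

namespace TropicalModuli

/-! ### Triangulations induced by height functions -/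

section Induced

variable {P : Set (ℝ × ℝ)}

/-- The unimodular triangles which come from facets of the lower convex hull of the graph of
`ω`. -/
noncomputable def inducedTriangles [Fintype (latticePoints P)] (ω : latticePoints P → ℝ) :
    Finset (Finset (latticePoints P)) :=
  open scoped Classical in
  Finset.univ.filter fun t => IsUnimodularTriangle t ∧ ∃ u, IsDualVertex ω t u

theorem mem_inducedTriangles [Fintype (latticePoints P)] {ω : latticePoints P → ℝ}
    {t : Finset (latticePoints P)} :
    t ∈ inducedTriangles ω ↔ IsUnimodularTriangle t ∧ ∃ u, IsDualVertex ω t u := by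
  simp [inducedTriangles]

theorem hull_subset (hP : Convex ℝ P) (s : Set (latticePoints P)) : hull s ⊆ P := by
  refine convexHull_min ?_ hP
  rintro _ ⟨p, -, rfl⟩
  exact p.2

/-- The sum is the height of the lifted combination above the plane given by `u` and `m`. For fixed
`z` it depends on the weight only through ∑ w ω, so two representations of one point can be
compared. -/
theorem IsWeight.sum_monomialValue [Fintype (latticePoints P)] {s : Set (latticePoints P)}
    {w : latticePoints P → ℝ} {z : ℝ × ℝ} (hz : ∑ p, w p • toPlane p.1 = z)
    (hw : IsWeight s w) (ω : latticePoints P → ℝ) (u : ℝ × ℝ) (m : ℝ) :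
    ∑ p, w p * (monomialValue ω p u - m) = ∑ p, w p * ω p + z.1 * u.1 + z.2 * u.2 - m := by
  have h1 : ∑ p, w p * (p.1.1 : ℝ) = z.1 := by
    rw [← hz, Prod.fst_sum]; simp [toPlane]
  have h2 : ∑ p, w p * (p.1.2 : ℝ) = z.2 := by
    rw [← hz, Prod.snd_sum]; simp [toPlane]
  have h3 := hw.sum_eq
  calc ∑ p, w p * (monomialValue ω p u - m)
      = ∑ p, (w p * ω p + w p * (p.1.1 : ℝ) * u.1 + w p * (p.1.2 : ℝ) * u.2 - w p * m) :=
        Finset.sum_congr rfl fun p _ => by rw [monomialValue]; ring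
    _ = _ := by
        rw [Finset.sum_sub_distrib, Finset.sum_add_distrib, Finset.sum_add_distrib,
          ← Finset.sum_mul, ← Finset.sum_mul, ← Finset.sum_mul, h1, h2, h3, one_mul]

/-- Cells of the lower convex hull meet along common faces. -/
theorem hull_inter_of_isDualVertex [Fintype (latticePoints P)] {ω : latticePoints P → ℝ}
    {t t' : Finset (latticePoints P)} {u u' : ℝ × ℝ} (h : IsDualVertex ω t u)
    (h' : IsDualVertex ω t' u') :
    hull (t : Set (latticePoints P)) ∩ hull (t' : Set (latticePoints P)) =
      hull ((t : Set (latticePoints P)) ∩ (t' : Set (latticePoints P))) := by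
  apply Set.Subset.antisymm
  · rintro z ⟨hz, hz'⟩
    rw [mem_hull_iff] at hz hz' ⊢
    obtain ⟨w, hw, hwz⟩ := hz
    obtain ⟨w', hw', hwz'⟩ := hz'
    obtain ⟨m, hm, hlt⟩ := h
    obtain ⟨m', hm', hlt'⟩ := h'
    have e1 : ∑ p, w p * (monomialValue ω p u - m) = 0 := by
      refine Finset.sum_eq_zero fun p _ => ?_
      by_cases hp : p ∈ t
      · rw [hm p hp, sub_self, mul_zero]
      · rw [hw.supp p hp, zero_mul]
    have e2 : ∑ p, w' p * (monomialValue ω p u' - m') = 0 := by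
      refine Finset.sum_eq_zero fun p _ => ?_
      by_cases hp : p ∈ t'
      · rw [hm' p hp, sub_self, mul_zero]
      · rw [hw'.supp p hp, zero_mul]
    have e3 : 0 ≤ ∑ p, w p * (monomialValue ω p u' - m') := by
      refine Finset.sum_nonneg fun p _ => mul_nonneg (hw.nonneg p) ?_
      by_cases hp : p ∈ t'
      · rw [hm' p hp, sub_self]
      · linarith [hlt' p hp]
    have hpos : ∀ p, 0 ≤ w' p * (monomialValue ω p u - m) := by
      refine fun p => mul_nonneg (hw'.nonneg p) ?_
      by_cases hp : p ∈ t
      · rw [hm p hp, sub_self]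
      · linarith [hlt p hp]
    -- The lift of `w'` lies on the plane over `t'`, hence not above the lift of `w`, which lies on
    -- the plane over `t`. All terms are nonnegative, so `w'` vanishes off `t`.
    have e4 : ∑ p, w' p * (monomialValue ω p u - m) = 0 := by
      refine le_antisymm ?_ (Finset.sum_nonneg fun p _ => hpos p)
      rw [hw.sum_monomialValue hwz] at e1 e3
      rw [hw'.sum_monomialValue hwz'] at e2 ⊢
      linarith
    refine ⟨w', ⟨hw'.nonneg, fun p hp => ?_, hw'.sum_eq⟩, hwz'⟩
    by_cases hpt : p ∈ t
    · exact hw'.supp p fun hp' => hp ⟨hpt, hp'⟩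
    · have := (Finset.sum_eq_zero_iff_of_nonneg fun p _ => hpos p).1 e4 p (Finset.mem_univ p)
      exact (mul_eq_zero.1 this).resolve_right (by linarith [hlt p hpt])
  · exact Set.subset_inter (convexHull_mono (Set.image_mono Set.inter_subset_left))
      (convexHull_mono (Set.image_mono Set.inter_subset_right))

/-- If the unimodular triangles induced by a height function cover the polygon, they form a regular
triangulation. -/
theorem isRegularUnimodularTriangulation_inducedTriangles [Fintype (latticePoints P)]
    (hP : Convex ℝ P) {ω : latticePoints P → ℝ}
    (hcover : ∀ z ∈ P, ∃ t ∈ inducedTriangles ω, z ∈ hull (t : Set (latticePoints P))) :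
    IsRegularUnimodularTriangulation P (inducedTriangles ω) := by
  refine ⟨⟨fun t ht => (mem_inducedTriangles.1 ht).1, ?_, fun t ht t' ht' => ?_⟩,
    ω, fun t ht => (mem_inducedTriangles.1 ht).2⟩
  · apply Set.Subset.antisymm
    · exact Set.iUnion₂_subset fun t _ => hull_subset hP _
    · intro z hz
      obtain ⟨t, ht, hzt⟩ := hcover z hz
      exact Set.mem_iUnion₂.2 ⟨t, ht, hzt⟩
  · obtain ⟨u, hu⟩ := (mem_inducedTriangles.1 ht).2
    obtain ⟨u', hu'⟩ := (mem_inducedTriangles.1 ht').2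
    exact hull_inter_of_isDualVertex hu hu'

/-- A triangle is induced by integral heights if an integral affine function vanishes on the lifted
triangle and is positive on the other lifted points. -/
theorem triple_mem_inducedTriangles [Fintype (latticePoints P)] {h : latticePoints P → ℤ}
    {a b c : latticePoints P} (hD : |doubleArea a.1 b.1 c.1| = 1) (ξ η m : ℤ)
    (ha : h a + a.1.1 * ξ + a.1.2 * η = m) (hb : h b + b.1.1 * ξ + b.1.2 * η = m)
    (hc : h c + c.1.1 * ξ + c.1.2 * η = m)
    (hlt : ∀ p, p ≠ a → p ≠ b → p ≠ c → m < h p + p.1.1 * ξ + p.1.2 * η) :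
    {a, b, c} ∈ inducedTriangles fun p => (h p : ℝ) := by
  refine mem_inducedTriangles.2 ⟨⟨a, b, c, by simp, hD⟩, (ξ, η), m, fun p hp => ?_, fun p hp => ?_⟩
  · have : h p + p.1.1 * ξ + p.1.2 * η = m := by
      simp only [Finset.mem_insert, Finset.mem_singleton] at hp
      rcases hp with rfl | rfl | rfl <;> assumption
    simp only [monomialValue]
    exact_mod_cast this
  · simp only [Finset.mem_insert, Finset.mem_singleton, not_or] at hp
    simp only [monomialValue]
    exact_mod_cast hlt p hp.1 hp.2.1 hp.2.2

end Induced

/-! ### A family of quadrilaterals -/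

/-- The quadrilateral with vertices `(1, 1)`, `(m + 1, 1)`, `(g + 1, 0)` and `(0, -1)`. -/
def quadrilateral (g m : ℤ) : Set (ℝ × ℝ) :=
  {z | z.2 ≤ 1 ∧ z.2 + 1 ≤ 2 * z.1 ∧ z.1 ≤ (g + 1) * (z.2 + 1) ∧ z.1 ≤ g + 1 - (g - m) * z.2}

section Quadrilateral

variable {g m : ℤ}

theorem convex_quadrilateral : Convex ℝ (quadrilateral g m) := by
  rintro z ⟨h1, h2, h3, h4⟩ w ⟨k1, k2, k3, k4⟩ r s hr hs hrs
  obtain rfl : s = 1 - r := by linarith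
  simp only [quadrilateral, Set.mem_ofPred_eq, Prod.fst_add, Prod.snd_add, Prod.smul_fst,
    Prod.smul_snd, smul_eq_mul]
  refine ⟨?_, ?_, ?_, ?_⟩
  · linarith [mul_le_mul_of_nonneg_left h1 hr, mul_le_mul_of_nonneg_left k1 hs]
  · linarith [mul_le_mul_of_nonneg_left h2 hr, mul_le_mul_of_nonneg_left k2 hs]
  · linarith [mul_le_mul_of_nonneg_left h3 hr, mul_le_mul_of_nonneg_left k3 hs]
  · linarith [mul_le_mul_of_nonneg_left h4 hr, mul_le_mul_of_nonneg_left k4 hs]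

theorem mem_latticePoints_quadrilateral (hm : 0 ≤ m) (hg : m ≤ g) {p : ℤ × ℤ} :
    p ∈ latticePoints (quadrilateral g m) ↔ (p.2 = 0 ∧ 1 ≤ p.1 ∧ p.1 ≤ g + 1) ∨
      (p.2 = 1 ∧ 1 ≤ p.1 ∧ p.1 ≤ m + 1) ∨ (p.2 = -1 ∧ p.1 = 0) := by
  have : p ∈ latticePoints (quadrilateral g m) ↔ p.2 ≤ 1 ∧ p.2 + 1 ≤ 2 * p.1 ∧
      p.1 ≤ (g + 1) * (p.2 + 1) ∧ p.1 ≤ g + 1 - (g - m) * p.2 := by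
    simp only [latticePoints, quadrilateral, toPlane, Set.mem_ofPred_eq]
    norm_cast
  rw [this]
  constructor
  · rintro ⟨h1, h2, h3, h4⟩
    have : -1 ≤ p.2 := by nlinarith
    obtain h | h | h : p.2 = -1 ∨ p.2 = 0 ∨ p.2 = 1 := by omega
    all_goals rw [h] at h2 h3 h4; omega
  · rintro (⟨h, h1, h2⟩ | ⟨h, h1, h2⟩ | ⟨h, h1⟩)
    all_goals rw [h]; refine ⟨?_, ?_, ?_, ?_⟩ <;> linarith

theorem latticePoints_quadrilateral (hm : 0 ≤ m) (hg : m ≤ g) :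
    latticePoints (quadrilateral g m) = ((Finset.Icc 1 (g + 1) ×ˢ {0} ∪
      Finset.Icc 1 (m + 1) ×ˢ {1} ∪ {(0, -1)} : Finset (ℤ × ℤ)) : Set (ℤ × ℤ)) := by
  ext p
  rw [mem_latticePoints_quadrilateral hm hg]
  simp only [Finset.coe_union, Finset.coe_product, Finset.coe_singleton, Set.mem_union,
    Set.mem_prod, Finset.coe_Icc, Set.mem_Icc, Set.mem_singleton_iff, Prod.ext_iff]
  omega

/-- The rows at heights 0, 1 and -1 have g + 1, m + 1 and 1 points. Subtracting the three affine
functions leaves the intended dimension g + m. -/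
theorem card_latticePoints_quadrilateral (hm : 0 ≤ m) (hg : m ≤ g) :
    (Nat.card (latticePoints (quadrilateral g m)) : ℤ) = g + m + 3 := by
  rw [latticePoints_quadrilateral hm hg, Nat.card_coe_set_eq, Set.ncard_coe_finset,
    Finset.card_union_of_disjoint, Finset.card_union_of_disjoint]
  · simp; omega
  · rw [Finset.disjoint_left]
    simp only [Finset.mem_product, Finset.mem_singleton]
    omega
  · rw [Finset.disjoint_left]
    simp only [Finset.mem_union, Finset.mem_product, Finset.mem_singleton, Finset.mem_Icc,
      Prod.ext_iff]
    omega

theorem finite_latticePoints_quadrilateral (hm : 0 ≤ m) (hg : m ≤ g) :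
    Finite (latticePoints (quadrilateral g m)) := by
  rw [latticePoints_quadrilateral hm hg]
  infer_instance

theorem mem_interiorLatticePoints_quadrilateral (hm : 0 ≤ m) (hg : m ≤ g) {p : ℤ × ℤ} :
    p ∈ interiorLatticePoints (quadrilateral g m) ↔ p.2 = 0 ∧ 1 ≤ p.1 ∧ p.1 ≤ g := by
  constructor
  · intro hp
    -- From an interior point one can move a little in every direction; from each remaining lattice
    -- point a suitable `v` violates an inequality.
    have key : ∀ v : ℝ × ℝ, ∃ ε : ℝ, 0 < ε ∧ toPlane p + ε • v ∈ quadrilateral g m := by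
      intro v
      obtain ⟨ε, h1, h2⟩ :=
        ((eventually_mem_of_mem_interior hp v).and self_mem_nhdsWithin).exists
      exact ⟨ε, h2, h1⟩
    have hp' : p ∈ latticePoints (quadrilateral g m) :=
      show toPlane p ∈ quadrilateral g m from interior_subset hp
    rcases (mem_latticePoints_quadrilateral hm hg).1 hp' with ⟨h, h1, h2⟩ | ⟨h, h1, h2⟩ | ⟨h, h1⟩
    · refine ⟨h, h1, ?_⟩
      by_contra! hlt
      obtain rfl : p = (g + 1, 0) := Prod.ext (by omega) h
      obtain ⟨ε, hε, -, -, h3, -⟩ := key (1, 0)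
      simp [toPlane] at h3
      linarith
    · obtain ⟨ε, hε, h3, -⟩ := key (0, 1)
      simp [toPlane, h] at h3
      linarith
    · obtain ⟨ε, hε, -, h3, h4, -⟩ := key (0, -1)
      simp [toPlane, h, h1] at h3 h4
      have : (0 : ℝ) ≤ g := by exact_mod_cast hm.trans hg
      nlinarith
  · rintro ⟨h, h1, h2⟩
    have hsub : {z : ℝ × ℝ | z.2 < 1 ∧ z.2 + 1 < 2 * z.1 ∧ z.1 < (g + 1) * (z.2 + 1) ∧
        z.1 < g + 1 - (g - m) * z.2} ⊆ interior (quadrilateral g m) := by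
      refine interior_maximal (fun z hz => ⟨hz.1.le, hz.2.1.le, hz.2.2.1.le, hz.2.2.2.le⟩) ?_
      have i1 : IsOpen {z : ℝ × ℝ | z.2 < 1} := isOpen_lt (by fun_prop) (by fun_prop)
      have i2 : IsOpen {z : ℝ × ℝ | z.2 + 1 < 2 * z.1} := isOpen_lt (by fun_prop) (by fun_prop)
      have i3 : IsOpen {z : ℝ × ℝ | z.1 < (g + 1) * (z.2 + 1)} :=
        isOpen_lt (by fun_prop) (by fun_prop)
      have i4 : IsOpen {z : ℝ × ℝ | z.1 < g + 1 - (g - m) * z.2} :=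
        isOpen_lt (by fun_prop) (by fun_prop)
      exact i1.inter (i2.inter (i3.inter i4))
    apply hsub
    have h1' : (1 : ℝ) ≤ p.1 := by exact_mod_cast h1
    have h2' : (p.1 : ℝ) ≤ g := by exact_mod_cast h2
    simp only [toPlane, h, Set.mem_ofPred_eq]
    norm_num
    refine ⟨?_, ?_⟩ <;> linarith

theorem genus_quadrilateral (hm : 0 ≤ m) (hg : m ≤ g) :
    (genus (quadrilateral g m) : ℤ) = g := by
  have : interiorLatticePoints (quadrilateral g m) =
      ((Finset.Icc 1 g ×ˢ {0} : Finset (ℤ × ℤ)) : Set (ℤ × ℤ)) := by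
    ext p
    rw [mem_interiorLatticePoints_quadrilateral hm hg]
    simp only [Finset.mem_coe, Finset.mem_product, Finset.mem_Icc, Finset.mem_singleton]
    tauto
  rw [genus, this, Set.ncard_coe_finset]
  simp
  omega

theorem isHyperelliptic_quadrilateral (hm : 0 ≤ m) (hg : m ≤ g) :
    IsHyperelliptic (quadrilateral g m) := by
  refine (collinear_iff_exists_forall_eq_smul_vadd _).2 ⟨(0, 0), (1, 0), ?_⟩
  rintro _ ⟨p, hp, rfl⟩
  have h := ((mem_interiorLatticePoints_quadrilateral hm hg).1 hp).1
  exact ⟨p.1, by simp [toPlane, h]⟩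

/-- Convex integral heights on the lattice points of the quadrilateral. -/
def quadrilateralHeight (p : latticePoints (quadrilateral g m)) : ℤ :=
  if p.1.2 = 0 then p.1.1 ^ 2 else if p.1.2 = 1 then p.1.1 ^ 2 - p.1.1 + 1 else 0

theorem height_axis {p : latticePoints (quadrilateral g m)} (h : p.1.2 = 0) :
    quadrilateralHeight p = p.1.1 ^ 2 := by simp [quadrilateralHeight, h]

theorem height_top {p : latticePoints (quadrilateral g m)} (h : p.1.2 = 1) :
    quadrilateralHeight p = p.1.1 ^ 2 - p.1.1 + 1 := by simp [quadrilateralHeight, h]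

theorem height_bot {p : latticePoints (quadrilateral g m)} (h : p.1.2 = -1) :
    quadrilateralHeight p = 0 := by simp [quadrilateralHeight, h]

end Quadrilateral

end TropicalModuli

namespace TropicalModuli

/-! ### A regular unimodular triangulation of the quadrilateral. -/

section Quadrilateral

variable {g m : ℤ}

/-- The triangulation of the quadrilateral induced by `quadrilateralHeight`. -/
noncomputable def quadrilateralTriangles (g m : ℤ) [Fintype (latticePoints (quadrilateral g m))] :
    Finset (Finset (latticePoints (quadrilateral g m))) :=
  inducedTriangles fun p => (quadrilateralHeight p : ℝ)

theorem quadrilateral_cases (hm : 0 ≤ m) (hg : m ≤ g)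
    (p : latticePoints (quadrilateral g m)) :
    (p.1.2 = 0 ∧ quadrilateralHeight p = p.1.1 ^ 2 ∧ 1 ≤ p.1.1 ∧ p.1.1 ≤ g + 1) ∨
      (p.1.2 = 1 ∧ quadrilateralHeight p = p.1.1 ^ 2 - p.1.1 + 1 ∧ 1 ≤ p.1.1 ∧ p.1.1 ≤ m + 1) ∨
      (p.1.2 = -1 ∧ quadrilateralHeight p = 0 ∧ p.1.1 = 0) := by
  rcases (mem_latticePoints_quadrilateral hm hg).1 p.2 with ⟨h, h'⟩ | ⟨h, h'⟩ | ⟨h, h'⟩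
  · exact Or.inl ⟨h, height_axis h, h'⟩
  · exact Or.inr (Or.inl ⟨h, height_top h, h'⟩)
  · exact Or.inr (Or.inr ⟨h, height_bot h, h'⟩)

theorem coord_ne {p q : latticePoints (quadrilateral g m)} {x y : ℤ} (hq : q.1 = (x, y))
    (h : p ≠ q) (hy : p.1.2 = y) : p.1.1 ≠ x :=
  fun hx => h (Subtype.ext (by rw [hq]; exact Prod.ext hx hy))

/-- The product of two consecutive integers is positive unless one of them vanishes. -/
theorem mul_pred_pos {k : ℤ} (h0 : k ≠ 0) (h1 : k ≠ 1) : 0 < k * (k - 1) := by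
  rcases lt_or_gt_of_ne h0 with h | h
  · exact mul_pos_of_neg_of_neg h (by omega)
  · exact mul_pos h (by omega)

theorem exists_axis_point (hm : 0 ≤ m) (hg : m ≤ g) {i : ℤ} (h1 : 1 ≤ i) (h2 : i ≤ g + 1) :
    ∃ p : latticePoints (quadrilateral g m), p.1 = (i, 0) :=
  ⟨⟨(i, 0), (mem_latticePoints_quadrilateral hm hg).2 (Or.inl ⟨rfl, h1, h2⟩)⟩, rfl⟩

theorem exists_top_point (hm : 0 ≤ m) (hg : m ≤ g) {i : ℤ} (h1 : 1 ≤ i) (h2 : i ≤ m + 1) :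
    ∃ p : latticePoints (quadrilateral g m), p.1 = (i, 1) :=
  ⟨⟨(i, 1), (mem_latticePoints_quadrilateral hm hg).2 (Or.inr (Or.inl ⟨rfl, h1, h2⟩))⟩, rfl⟩

theorem exists_bottom_point (hm : 0 ≤ m) (hg : m ≤ g) :
    ∃ p : latticePoints (quadrilateral g m), p.1 = (0, -1) :=
  ⟨⟨(0, -1), (mem_latticePoints_quadrilateral hm hg).2 (Or.inr (Or.inr ⟨rfl, rfl⟩))⟩, rfl⟩

/-- A real number in a half-open interval with integral ends lies in one of length one. -/
theorem exists_unit_interval {x : ℝ} {k n : ℤ} (h1 : (k : ℝ) < x) (h2 : x ≤ n) :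
    ∃ i : ℤ, k ≤ i ∧ i + 1 ≤ n ∧ (i : ℝ) ≤ x ∧ x ≤ i + 1 := by
  have h := Int.lt_ceil.2 h1
  refine ⟨⌈x⌉ - 1, by omega, by have := Int.ceil_le.2 h2; omega, ?_, ?_⟩
  · push_cast; linarith [Int.ceil_lt_add_one x]
  · push_cast; linarith [Int.le_ceil x]

variable [Fintype (latticePoints (quadrilateral g m))]
  {a b c : latticePoints (quadrilateral g m)}

/-- Relative to the supporting plane, the heights become (x - i)(x - i - 1) on the axis, (x - i -
1)² + i² on top and 0 at the bottom. -/
theorem lower_triangle_mem (hm : 0 ≤ m) (hg : m ≤ g) {i : ℤ} (ha : a.1 = (i, 0))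
    (hb : b.1 = (i + 1, 0)) (hc : c.1 = (0, -1)) : {a, b, c} ∈ quadrilateralTriangles g m := by
  have hi : 1 ≤ i := by
    have := quadrilateral_cases hm hg a; simp only [ha] at this; omega
  refine triple_mem_inducedTriangles (by simp [ha, hb, hc, doubleArea])
    (-(2 * i + 1)) (i ^ 2 + i) (-(i ^ 2 + i)) ?_ ?_ ?_ fun p pa pb pc => ?_
  · rw [height_axis (by simp [ha]), ha]; ring
  · rw [height_axis (by simp [hb]), hb]; ring
  · rw [height_bot (by simp [hc]), hc]; ring
  · rcases quadrilateral_cases hm hg p with ⟨h, hh, -⟩ | ⟨h, hh, -⟩ | ⟨h, -, h'⟩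
    · have := mul_pred_pos (sub_ne_zero.2 (coord_ne ha pa h))
        (fun h' => coord_ne hb pb h (by linarith))
      rw [hh, h]; nlinarith
    · rw [hh, h]; nlinarith [sq_nonneg (p.1.1 - (i + 1))]
    · exact absurd h' (coord_ne hc pc h)

/-- The apex (k,1) is the point of the top row nearest to i + 1. Relative to the supporting plane
the heights are (x - i)(x - i - 1) on the axis, (x - i - 1)² - (k - i - 1)² on top and (k - i - 1)²
+ i² at the bottom. -/
theorem upper_triangle_mem (hm : 0 ≤ m) (hg : m ≤ g) {i : ℤ} (ha : a.1 = (i, 0))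
    (hb : b.1 = (i + 1, 0)) (hc : c.1 = (min (i + 1) (m + 1), 1)) :
    {a, b, c} ∈ quadrilateralTriangles g m := by
  have hi : 1 ≤ i := by
    have := quadrilateral_cases hm hg a; simp only [ha] at this; omega
  obtain ⟨k, hk⟩ : ∃ k, k = min (i + 1) (m + 1) := ⟨_, rfl⟩
  rw [← hk] at hc
  refine triple_mem_inducedTriangles (by simp [ha, hb, hc, doubleArea])
    (-(2 * i + 1)) (i - (k - (i + 1)) ^ 2) (-(i ^ 2 + i)) ?_ ?_ ?_ fun p pa pb pc => ?_
  · rw [height_axis (by simp [ha]), ha]; ring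
  · rw [height_axis (by simp [hb]), hb]; ring
  · rw [height_top (by simp [hc]), hc]; ring
  · rcases quadrilateral_cases hm hg p with ⟨h, hh, -⟩ | ⟨h, hh, h1, h2⟩ | ⟨h, hh, h'⟩
    · have := mul_pred_pos (sub_ne_zero.2 (coord_ne ha pa h))
        (fun h' => coord_ne hb pb h (by linarith))
      rw [hh, h]; nlinarith
    · have hne := coord_ne hc pc h
      have : (k - (i + 1)) ^ 2 < (p.1.1 - (i + 1)) ^ 2 := by
        rw [sq_lt_sq]
        rcases abs_cases (k - (i + 1)) with h | h <;>
          rcases abs_cases (p.1.1 - (i + 1)) with h' | h' <;> omega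
      rw [hh, h]; nlinarith
    · rw [hh, h, h']; nlinarith [sq_nonneg (k - (i + 1))]

/-- Relative to the supporting plane the heights are (x - i)² on the axis, (x - i)(x - i - 1) on top
and i² - i + 1 at the bottom. -/
theorem top_triangle_mem (hm : 0 ≤ m) (hg : m ≤ g) {i : ℤ} (ha : a.1 = (i, 0))
    (hb : b.1 = (i, 1)) (hc : c.1 = (i + 1, 1)) : {a, b, c} ∈ quadrilateralTriangles g m := by
  have hi : 1 ≤ i := by
    have := quadrilateral_cases hm hg a; simp only [ha] at this; omega
  refine triple_mem_inducedTriangles (by simp [ha, hb, hc, doubleArea])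
    (-(2 * i)) (i - 1) (-i ^ 2) ?_ ?_ ?_ fun p pa pb pc => ?_
  · rw [height_axis (by simp [ha]), ha]; ring
  · rw [height_top (by simp [hb]), hb]; ring
  · rw [height_top (by simp [hc]), hc]; ring
  · rcases quadrilateral_cases hm hg p with ⟨h, hh, -⟩ | ⟨h, hh, -⟩ | ⟨h, hh, h'⟩
    · have := sq_pos_of_ne_zero (sub_ne_zero.2 (coord_ne ha pa h))
      rw [hh, h]; nlinarith
    · have := mul_pred_pos (sub_ne_zero.2 (coord_ne hb pb h))
        (fun h' => coord_ne hc pc h (by linarith))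
      rw [hh, h]; nlinarith
    · rw [hh, h, h']; nlinarith

/-- Relative to the supporting plane the heights are x(x - 1) on the axis, (x - 1)² on top and 0 at
the bottom. -/
theorem left_triangle_mem (hm : 0 ≤ m) (hg : m ≤ g) (ha : a.1 = (1, 0))
    (hb : b.1 = (1, 1)) (hc : c.1 = (0, -1)) : {a, b, c} ∈ quadrilateralTriangles g m := by
  refine triple_mem_inducedTriangles (by simp [ha, hb, hc, doubleArea])
    (-1) 0 0 ?_ ?_ ?_ fun p pa pb pc => ?_
  · rw [height_axis (by simp [ha]), ha]; ring
  · rw [height_top (by simp [hb]), hb]; ring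
  · rw [height_bot (by simp [hc]), hc]; ring
  · rcases quadrilateral_cases hm hg p with ⟨h, hh, h1, -⟩ | ⟨h, hh, h1, -⟩ | ⟨h, hh, h'⟩
    · have := coord_ne ha pa h
      have : 2 ≤ p.1.1 := by omega
      rw [hh, h]; nlinarith
    · have := coord_ne hb pb h
      have : 2 ≤ p.1.1 := by omega
      rw [hh, h]; nlinarith
    · exact absurd h' (coord_ne hc pc h)

theorem quadrilateral_cover (hm : 0 ≤ m) (hg : m ≤ g) {z : ℝ × ℝ} (hz : z ∈ quadrilateral g m) :
    ∃ t ∈ quadrilateralTriangles g m,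
      z ∈ hull (t : Set (latticePoints (quadrilateral g m))) := by
  obtain ⟨x, y⟩ := z
  obtain ⟨h1, h2, h3, h4⟩ := hz
  simp only at h1 h2 h3 h4
  have hm' : (0 : ℝ) ≤ m := by exact_mod_cast hm
  have hg' : (m : ℝ) ≤ g := by exact_mod_cast hg
  obtain ⟨s, hs⟩ := exists_bottom_point hm hg
  -- These points form the triangle (1,0), (1,1), (0,-1) at the left end.
  by_cases hx : x ≤ 1 ∧ x ≤ y + 1
  · obtain ⟨p, hp⟩ := exists_axis_point hm hg (i := 1) le_rfl (by omega)
    obtain ⟨q, hq⟩ := exists_top_point hm hg (i := 1) le_rfl (by omega)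
    refine ⟨_, left_triangle_mem hm hg hp hq hs, mem_hull_triple.2
      ⟨2 * x - y - 1, y + 1 - x, 1 - x, by linarith, by linarith, by linarith, by ring, ?_, ?_⟩⟩
    · simp only [hp, hq, hs]; push_cast; ring
    · simp only [hp, hq, hs]; push_cast; ring
  by_cases hy : y ≤ 0
  · have hxy : y + 1 < x := by
      by_contra! h
      exact hx ⟨by linarith, h⟩
    have hpos : 0 < y + 1 := by
      by_contra! h
      have : y + 1 = 0 := le_antisymm h (by nlinarith)
      rw [this] at h3
      linarith
    -- Below the axis all triangles share (0,-1); projecting from it onto the axis finds the base.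
    obtain ⟨i, i1, i2, i3, i4⟩ := exists_unit_interval (x := x / (y + 1)) (k := 1) (n := g + 1)
      (by rw [Int.cast_one, lt_div_iff₀ hpos]; linarith)
      (by rw [div_le_iff₀ hpos]; push_cast; exact h3)
    rw [le_div_iff₀ hpos] at i3
    rw [div_le_iff₀ hpos] at i4
    obtain ⟨p, hp⟩ := exists_axis_point hm hg i1 (by omega)
    obtain ⟨q, hq⟩ := exists_axis_point hm hg (i := i + 1) (by omega) i2
    refine ⟨_, lower_triangle_mem hm hg hp hq hs, mem_hull_triple.2
      ⟨(i + 1) * (y + 1) - x, x - i * (y + 1), -y, by linarith, by linarith, by linarith,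
        by ring, ?_, ?_⟩⟩
    · simp only [hp, hq, hs]; push_cast; ring
    · simp only [hp, hq, hs]; push_cast; ring
  have hx1 : 1 < x := by
    by_contra! h
    exact hx ⟨h, by linarith⟩
  push Not at hy
  by_cases hxm : x ≤ m + 1
  · obtain ⟨i, i1, i2, i3, i4⟩ := exists_unit_interval (x := x) (k := 1) (n := m + 1)
      (by exact_mod_cast hx1) (by exact_mod_cast hxm)
    obtain ⟨p, hp⟩ := exists_axis_point hm hg i1 (by omega)
    obtain ⟨q, hq⟩ := exists_top_point hm hg (i := i + 1) (by omega) i2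
    -- Up to x = m + 1 the region above the axis consists of unit squares, cut by the diagonal from
    -- (i,0) to (i+1,1).
    by_cases hd : y ≤ x - i
    · obtain ⟨p', hp'⟩ := exists_axis_point hm hg (i := i + 1) (by omega) (by omega)
      refine ⟨_, upper_triangle_mem hm hg hp hp' (by rw [hq, min_eq_left i2]), mem_hull_triple.2
        ⟨i + 1 - x, x - i - y, y, by linarith, by linarith, by linarith, by ring, ?_, ?_⟩⟩
      · simp only [hp, hq, hp']; push_cast; ring
      · simp only [hp, hq, hp']; push_cast; ring
    · obtain ⟨q', hq'⟩ := exists_top_point hm hg i1 (by omega)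
      refine ⟨_, top_triangle_mem hm hg hp hq' hq, mem_hull_triple.2
        ⟨1 - y, y - (x - i), x - i, by linarith, by linarith, by linarith, by ring, ?_, ?_⟩⟩
      · simp only [hp, hq, hq']; push_cast; ring
      · simp only [hp, hq, hq']; push_cast; ring
  · push Not at hxm
    have hpos : 0 < 1 - y := by
      by_contra! h
      have : y = 1 := le_antisymm h1 (by linarith)
      rw [this] at h4
      linarith
    -- Further right, all triangles share (m+1,1); projecting from it onto the axis finds the base.
    obtain ⟨i, i1, i2, i3, i4⟩ := exists_unit_interval (x := (x - (m + 1) * y) / (1 - y))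
      (k := m + 1) (n := g + 1)
      (by rw [lt_div_iff₀ hpos]; push_cast; linarith)
      (by rw [div_le_iff₀ hpos]; push_cast; linarith)
    rw [le_div_iff₀ hpos] at i3
    rw [div_le_iff₀ hpos] at i4
    obtain ⟨p, hp⟩ := exists_axis_point hm hg (i := i) (by omega) (by omega)
    obtain ⟨p', hp'⟩ := exists_axis_point hm hg (i := i + 1) (by omega) i2
    obtain ⟨q, hq⟩ := exists_top_point hm hg (i := m + 1) (by omega) le_rfl
    refine ⟨_, upper_triangle_mem hm hg hp hp' (by rw [hq, min_eq_right (by omega)]),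
      mem_hull_triple.2 ⟨(i + 1) * (1 - y) - (x - (m + 1) * y), x - (m + 1) * y - i * (1 - y), y,
        by linarith, by linarith, by linarith, by ring, ?_, ?_⟩⟩
    · simp only [hp, hq, hp']; push_cast; ring
    · simp only [hp, hq, hp']; push_cast; ring

theorem isRegular_quadrilateralTriangles (hm : 0 ≤ m) (hg : m ≤ g) :
    IsRegularUnimodularTriangulation (quadrilateral g m) (quadrilateralTriangles g m) :=
  isRegularUnimodularTriangulation_inducedTriangles convex_quadrilateral
    fun _ hz => quadrilateral_cover hm hg hz

end Quadrilateral

section Polygon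

variable {g m : ℤ}

theorem isLatticePolygon_quadrilateral (hm : 0 ≤ m) (hmg : m ≤ g) (hg : 1 ≤ g) :
    IsLatticePolygon (quadrilateral g m) := by
  have := finite_latticePoints_quadrilateral hm hmg
  have := Fintype.ofFinite (latticePoints (quadrilateral g m))
  refine ⟨⟨(latticePoints (quadrilateral g m)).toFinset, ?_⟩,
    toPlane (1, 0), (mem_interiorLatticePoints_quadrilateral hm hmg).2 ⟨rfl, le_rfl, hg⟩⟩
  rw [Set.coe_toFinset]
  apply Set.Subset.antisymm
  · intro z hz
    obtain ⟨t, -, hzt⟩ := quadrilateral_cover hm hmg hz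
    refine convexHull_mono ?_ hzt
    rintro _ ⟨p, -, rfl⟩
    exact Set.mem_image_of_mem _ p.2
  · refine convexHull_min ?_ convex_quadrilateral
    rintro _ ⟨p, hp, rfl⟩
    exact hp

end Polygon


end TropicalModuli

namespace TropicalModuli

/-! ### The kernel for the quadrilateral, and the dimension g + m. -/

section Quadrilateral

variable {g m : ℤ} [Fintype (latticePoints (quadrilateral g m))]
  {ω : latticePoints (quadrilateral g m) → ℝ}

theorem exists_strip_quadrilateral (hm : 0 ≤ m) (hmg : m ≤ g) (hg : 2 ≤ g) :
    ∃ S : Strip (quadrilateral g m) (quadrilateralTriangles g m) g,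
      (∀ p, S.X p = p.1.1) ∧ ∀ p, S.Y p = p.1.2 := by
  let χ : Chart := ⟨1, 0, 0, 0, 1, 0, by norm_num⟩
  have hX : ∀ p, χ.X p = p.1 := fun p => by simp [Chart.X, χ]
  have hY : ∀ p, χ.Y p = p.2 := fun p => by simp [Chart.Y, χ]
  have hχ : χ.Adapted (quadrilateral g m) g := fun p => by
    rw [mem_interiorLatticePoints_quadrilateral hm hmg, hX, hY]
  exact ⟨hχ.strip convex_quadrilateral hg (isRegular_quadrilateralTriangles hm hmg).1,
    fun p => hX p.1, fun p => hY p.1⟩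

section Relations

variable {S : Strip (quadrilateral g m) (quadrilateralTriangles g m) g}
  {p p' q r : latticePoints (quadrilateral g m)} {i : ℤ}

theorem inner_quadrilateral (hX : ∀ p, S.X p = p.1.1) (hY : ∀ p, S.Y p = p.1.2)
    (hp : p.1 = (i, 0)) (h1 : 1 ≤ i) (h2 : i ≤ g) : S.Inner p := by
  rw [Strip.inner_iff, hX, hY, hp]
  exact ⟨rfl, h1, h2⟩

theorem leftSpine_quadrilateral (hm : 0 ≤ m) (hmg : m ≤ g)
    (hX : ∀ p, S.X p = p.1.1) (hY : ∀ p, S.Y p = p.1.2) (hp : p.1 = (i + 1, 0))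
    (hp' : p'.1 = (i, 0)) (hq : q.1 = (min (i + 1) (m + 1), 1)) (hr : r.1 = (0, -1)) :
    S.LeftSpine p p' q r where
  Y_eq := by simp [hY, hp']
  X_eq := by simp [hX, hp', hp]
  top := by simp [hY, hq]
  bot := by simp [hY, hr]
  mem_top := by rw [triple_swap_left]; exact upper_triangle_mem hm hmg hp' hp hq
  mem_bot := by rw [triple_swap_left]; exact lower_triangle_mem hm hmg hp' hp hr

theorem rightSpine_quadrilateral (hm : 0 ≤ m) (hmg : m ≤ g)
    (hX : ∀ p, S.X p = p.1.1) (hY : ∀ p, S.Y p = p.1.2) (hp : p.1 = (i, 0))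
    (hp' : p'.1 = (i + 1, 0)) (hq : q.1 = (min (i + 1) (m + 1), 1)) (hr : r.1 = (0, -1)) :
    S.flipX.LeftSpine p p' q r where
  Y_eq := by simp [Strip.flipX, hY, hp']
  X_eq := by simp only [Strip.flipX, hX, hp', hp]; ring
  top := by simp [Strip.flipX, hY, hq]
  bot := by simp [Strip.flipX, hY, hr]
  mem_top := upper_triangle_mem hm hmg hp hp' hq
  mem_bot := lower_triangle_mem hm hmg hp hp' hr

/-- The heights of zero length on the skeleton are affine on the segment of interior lattice
points. -/
theorem second_difference_eq_zero (hm : 0 ≤ m) (hmg : m ≤ g) (hg : 2 ≤ g)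
    (hω : skeletonMap (quadrilateralTriangles g m) ω = 0) {a b c : latticePoints (quadrilateral g m)}
    (h1 : 1 ≤ i) (h2 : i + 1 < g) (ha : a.1 = (i, 0)) (hb : b.1 = (i + 1, 0))
    (hc : c.1 = (i + 2, 0)) : ω a + ω c = 2 * ω b := by
  obtain ⟨S, hX, hY⟩ := exists_strip_quadrilateral hm hmg hg
  obtain ⟨r, hr⟩ := exists_bottom_point hm hmg
  obtain ⟨q, hq⟩ := exists_top_point hm hmg (i := min (i + 1) (m + 1)) (by omega) (by omega)
  obtain ⟨q', hq'⟩ := exists_top_point hm hmg (i := min (i + 1 + 1) (m + 1)) (by omega) (by omega)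
  have hin : S.Inner b := inner_quadrilateral hX hY hb (by omega) (by omega)
  have hL : S.LeftValue b (fun ω => ω a - ω b) :=
    Or.inl ⟨a, q, r, leftSpine_quadrilateral hm hmg hX hY hb ha hq hr, rfl⟩
  have hR : S.flipX.LeftValue b (fun ω => ω c - ω b) :=
    Or.inl ⟨c, q', r, rightSpine_quadrilateral hm hmg hX hY hb (by rw [hc]; ring_nf) hq' hr, rfl⟩
  obtain ⟨e, d, hd, he⟩ := S.outerArc_nonempty hin
  have h := S.skeletonMap_middle hin hL hR (by rw [hX, hb]; simp only; omega)
    (by rw [hX, hb]; simp only; omega) he hd ω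
  rw [hω] at h
  simp only [Pi.zero_apply] at h
  linarith

/-- The relation given by the edge dual to a segment between interior lattice points. -/
theorem gap_eq_zero (hm : 0 ≤ m) (hmg : m ≤ g) (hg : 2 ≤ g)
    (hω : skeletonMap (quadrilateralTriangles g m) ω = 0) (h1 : 1 ≤ i) (h2 : i < g)
    (hp : p.1 = (i, 0)) (hp' : p'.1 = (i + 1, 0)) {k : ℤ} (hk : k = min (i + 1) (m + 1))
    (hq : q.1 = (k, 1)) (hr : r.1 = (0, -1)) :
    ω q + ω r - (2 - (k - 2 * i : ℤ)) * ω p - (k - 2 * i : ℤ) * ω p' = 0 := by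
  obtain ⟨S, hX, hY⟩ := exists_strip_quadrilateral hm hmg hg
  have hin : S.Inner p := inner_quadrilateral hX hY hp (by omega) (by omega)
  have hin' : S.Inner p' := inner_quadrilateral hX hY hp' (by omega) (by omega)
  have mq := upper_triangle_mem hm hmg hp hp' (by rw [hq, hk])
  have mr := lower_triangle_mem hm hmg hp hp' hr
  obtain ⟨e, he⟩ := S.exists_edge mq (S.innerEdge_of_left p' hin)
  have h := S.skeletonMap_gap he (Or.inl ⟨hin, hin'⟩) ω
  have hqr : q ≠ r := by rintro rfl; rw [hq] at hr; simp at hr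
  -- The first coordinates of q and r add up to k = (2 - β) i + β (i + 1).
  rw [edgeLength_eq S.triangulation (S.isQuad_of_hasSide he mq mr hqr (β := k - 2 * i)
    (by simp only [hX, hp, hp', hq, hr]; ring) (by simp only [hY, hp, hp', hq, hr]; ring)),
    quadLength_apply, hω] at h
  exact h.symm

/-- The relation given by the loop around the first interior lattice point. -/
theorem left_loop_eq_zero (hm : 0 ≤ m) (hmg : m ≤ g) (hg : 2 ≤ g)
    (hω : skeletonMap (quadrilateralTriangles g m) ω = 0)
    (hp : p.1 = (1, 0)) (hp' : p'.1 = (2, 0)) (hq : q.1 = (1, 1)) (hr : r.1 = (0, -1)) :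
    ω q + ω r - 2 * ω p + (ω p' - ω p) = 0 := by
  obtain ⟨S, hX, hY⟩ := exists_strip_quadrilateral hm hmg hg
  obtain ⟨q', hq'⟩ := exists_top_point hm hmg (i := min (1 + 1) (m + 1)) (by omega) (by omega)
  have hin : S.Inner p := inner_quadrilateral hX hY hp (by omega) (by omega)
  have hL : S.LeftCross p q r := ⟨by simp [hY, hq], by simp [hY, hr], by simp [hX, hq, hr, hp],
    left_triangle_mem hm hmg hp hq hr⟩
  have hR : S.flipX.LeftValue p (fun ω => ω p' - ω p) :=
    Or.inl ⟨p', q', r, rightSpine_quadrilateral hm hmg hX hY hp (by rw [hp']; rfl) hq' hr, rfl⟩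
  obtain ⟨e, he⟩ := S.outerArc_nonempty hin
  have h := S.skeletonMap_left_cross hin (by simp [hX, hp]) hL hR he ω
  rw [hω] at h
  simp only [Pi.zero_apply] at h
  linarith

/-- The relation given by the loop around the last interior lattice point. -/
theorem right_loop_eq_zero (hm : 0 ≤ m) (hmg : m ≤ g) (hg : 2 ≤ g)
    (hω : skeletonMap (quadrilateralTriangles g m) ω = 0) {p'' : latticePoints (quadrilateral g m)}
    (hp'' : p''.1 = (g - 1, 0)) (hp : p.1 = (g, 0)) (hp' : p'.1 = (g + 1, 0))
    (hq : q.1 = (m + 1, 1)) (hr : r.1 = (0, -1)) :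
    2 * (ω p' - ω p + (ω p'' - ω p)) + (ω q + ω r - (2 - (2 * g + 1 - m : ℤ)) * ω p' -
      (2 * g + 1 - m : ℤ) * ω p) = 0 := by
  obtain ⟨S, hX, hY⟩ := exists_strip_quadrilateral hm hmg hg
  obtain ⟨q', hq'⟩ := exists_top_point hm hmg (i := min (g - 1 + 1) (m + 1)) (by omega) (by omega)
  have hin : S.Inner p := inner_quadrilateral hX hY hp (by omega) (by omega)
  have hR : S.flipX.LeftSpine p p' q r :=
    rightSpine_quadrilateral hm hmg hX hY hp hp' (by rw [hq, min_eq_right (by omega)]) hr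
  have hL : S.LeftValue p (fun ω => ω p'' - ω p) := Or.inl ⟨p'', q', r,
    leftSpine_quadrilateral hm hmg hX hY (by rw [hp]; ring_nf) hp'' hq' hr, rfl⟩
  rw [← S.flipX_flipX] at hL
  obtain ⟨e, he⟩ := S.flipX.outerArc_nonempty (S.flipX_inner.2 hin)
  have h := S.flipX.skeletonMap_left_spine (S.flipX_inner.2 hin)
    (by simp only [Strip.flipX, hX, hp]; ring) hR hL he ω
  -- In the reflected coordinates q sits at g - m and r at g + 1.
  have hβ : S.flipX.X q + S.flipX.X r = 2 * g + 1 - m := by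
    simp only [Strip.flipX, hX, hq, hr]; ring
  rw [hω, hβ] at h
  exact h.symm

end Relations

/-- Heights of zero length on the skeleton are determined by their values on a triangle. -/
theorem eq_zero_of_skeletonMap_quadrilateral (hm : 0 ≤ m) (hmg : m < g) (hg : 2 ≤ g)
    (hω : skeletonMap (quadrilateralTriangles g m) ω = 0)
    {p p' r : latticePoints (quadrilateral g m)} (hp : p.1 = (1, 0)) (hp' : p'.1 = (2, 0))
    (hr : r.1 = (0, -1)) (zp : ω p = 0) (zp' : ω p' = 0) (zr : ω r = 0) : ω = 0 := by
  have hmg' := hmg.le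
  -- Vanishing second differences propagate two consecutive zeros along the interior lattice points.
  have axis : ∀ n : ℕ, ∀ a b : latticePoints (quadrilateral g m), (n : ℤ) + 2 ≤ g →
      a.1 = ((n : ℤ) + 1, 0) → b.1 = ((n : ℤ) + 2, 0) → ω a = 0 ∧ ω b = 0 := by
    intro n
    induction n with
    | zero =>
      intro a b _ ha hb
      obtain rfl : a = p := Subtype.ext (by rw [ha, hp]; simp)
      obtain rfl : b = p' := Subtype.ext (by rw [hb, hp']; simp)
      exact ⟨zp, zp'⟩
    | succ n ih =>
      intro a b hn ha hb
      push_cast at hn ha hb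
      obtain ⟨c, hc⟩ := exists_axis_point hm hmg' (i := n + 1) (by omega) (by omega)
      obtain ⟨zc, za⟩ := ih c a (by omega) hc (by rw [ha]; ring_nf)
      have := second_difference_eq_zero hm hmg' hg hω (i := n + 1) (by omega) (by omega) hc
        (by rw [ha]) (by rw [hb])
      exact ⟨za, by linarith⟩
  have inner : ∀ i, 1 ≤ i → i ≤ g → ∀ a : latticePoints (quadrilateral g m), a.1 = (i, 0) →
      ω a = 0 := by
    intro i h1 h2 a ha
    rcases h2.eq_or_lt with rfl | h2
    · obtain ⟨c, hc⟩ := exists_axis_point hm hmg' (i := i - 1) (by omega) (by omega)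
      obtain ⟨n, hn⟩ := Int.eq_ofNat_of_zero_le (show 0 ≤ i - 2 by omega)
      exact (axis n c a (by omega) (by rw [hc]; congr 1; omega)
        (by rw [ha]; congr 1; omega)).2
    · obtain ⟨c, hc⟩ := exists_axis_point hm hmg' (i := i + 1) (by omega) (by omega)
      obtain ⟨n, hn⟩ := Int.eq_ofNat_of_zero_le (show 0 ≤ i - 1 by omega)
      exact (axis n a c (by omega) (by rw [ha]; congr 1; omega)
        (by rw [hc]; congr 1; omega)).1
  -- The left loop determines the height at (1,1), and the gap from k - 1 to k the one at (k,1).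
  -- Since m < g, there is such a gap for every k from 2 to m + 1.
  have top : ∀ k, 1 ≤ k → k ≤ m + 1 → ∀ q : latticePoints (quadrilateral g m), q.1 = (k, 1) →
      ω q = 0 := by
    intro k h1 h2 q hq
    rcases h1.eq_or_lt with rfl | h1
    · have := left_loop_eq_zero hm hmg' hg hω hp hp' hq hr
      linarith
    · obtain ⟨a, ha⟩ := exists_axis_point hm hmg' (i := k - 1) (by omega) (by omega)
      obtain ⟨b, hb⟩ := exists_axis_point hm hmg' (i := k - 1 + 1) (by omega) (by omega)
      have := gap_eq_zero hm hmg' hg hω (i := k - 1) (k := k) (by omega) (by omega) ha hb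
        (by omega) hq hr
      rw [inner _ (by omega) (by omega) a ha, inner _ (by omega) (by omega) b hb, zr] at this
      linarith
  funext a
  rcases (mem_latticePoints_quadrilateral hm hmg').1 a.2 with ⟨h, h1, h2⟩ | ⟨h, h1, h2⟩ | ⟨h, h1⟩
  · rcases h2.eq_or_lt with h2 | h2
    · obtain ⟨b, hb⟩ := exists_axis_point hm hmg' (i := g) (by omega) (by omega)
      obtain ⟨c, hc⟩ := exists_axis_point hm hmg' (i := g - 1) (by omega) (by omega)
      obtain ⟨q, hq⟩ := exists_top_point hm hmg' (i := m + 1) (by omega) le_rfl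
      have := right_loop_eq_zero hm hmg' hg hω hc hb (Prod.ext h2 h) hq hr
      rw [inner _ (by omega) le_rfl b hb, inner _ (by omega) (by omega) c hc,
        top _ (by omega) le_rfl q hq, zr] at this
      -- In the right loop only (g+1,0) is left, with the nonzero coefficient 2g + 1 - m.
      have h0 : ((2 * g + 1 - m : ℤ) : ℝ) * ω a = 0 := by linarith
      exact (mul_eq_zero.1 h0).resolve_left (Int.cast_ne_zero.2 (by omega))
    · exact inner _ h1 (by omega) a (Prod.ext rfl h)
  · exact top _ h1 h2 a (Prod.ext rfl h)
  · obtain rfl : a = r := Subtype.ext (by rw [hr]; exact Prod.ext h1 h)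
    exact zr

/-- Evaluation at (1,0), (2,0) and (0,-1) is injective on the kernel. -/
theorem finrank_ker_quadrilateral_le (hm : 0 ≤ m) (hmg : m < g) (hg : 2 ≤ g) :
    Module.finrank ℝ (LinearMap.ker (skeletonMap (quadrilateralTriangles g m))) ≤ 3 := by
  obtain ⟨p, hp⟩ := exists_axis_point hm hmg.le (i := 1) le_rfl (by omega)
  obtain ⟨p', hp'⟩ := exists_axis_point hm hmg.le (i := 2) (by omega) (by omega)
  obtain ⟨r, hr⟩ := exists_bottom_point hm hmg.le
  let f : LinearMap.ker (skeletonMap (quadrilateralTriangles g m)) →ₗ[ℝ] (Fin 3 → ℝ) :=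
    (LinearMap.funLeft ℝ ℝ ![p, p', r]).comp (Submodule.subtype _)
  have hf : Function.Injective f := by
    rw [← LinearMap.ker_eq_bot, LinearMap.ker_eq_bot']
    rintro ⟨ω, hω⟩ h
    have h0 := congrFun h 0
    have h1 := congrFun h 1
    have h2 := congrFun h 2
    exact Subtype.ext (eq_zero_of_skeletonMap_quadrilateral hm hmg hg hω hp hp' hr h0 h1 h2)
  simpa using LinearMap.finrank_le_finrank_of_injective hf

end Quadrilateral

/-- Affine heights bound the dimension for every triangulation by the number of lattice points minus
three; the explicit triangulation has no further kernel and attains this. -/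
theorem hasModuliDim_quadrilateral {g m : ℤ} {d : ℕ} (hm : 0 ≤ m) (hmg : m < g) (hg : 2 ≤ g)
    (hd : (d : ℤ) = g + m) : HasModuliDim (quadrilateral g m) d := by
  have := finite_latticePoints_quadrilateral hm hmg.le
  have := Fintype.ofFinite (latticePoints (quadrilateral g m))
  have hcard := card_latticePoints_quadrilateral hm hmg.le
  have hle : ∀ T, IsRegularUnimodularTriangulation (quadrilateral g m) T → coneDim T ≤ d := by
    intro T hT
    have h1 := coneDim_add_finrank_ker hT
    have h2 := three_le_finrank_ker hT.1 (by
      rw [Finset.nonempty_iff_ne_empty]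
      rintro rfl
      obtain ⟨p, -⟩ := exists_bottom_point hm hmg.le
      have hp := hT.1.cover.ge p.2
      simp at hp)
    omega
  refine ⟨⟨quadrilateralTriangles g m, isRegular_quadrilateralTriangles hm hmg.le, ?_⟩, ?_⟩
  · have hT := isRegular_quadrilateralTriangles hm hmg.le
    have h1 := coneDim_add_finrank_ker hT
    have h2 := finrank_ker_quadrilateral_le hm hmg hg
    have h3 := hle _ hT
    omega
  · rintro _ ⟨T, hT, rfl⟩
    exact hle T hT

end TropicalModuli

theorem theorem1p2 (g d : ℕ) (hg : 2 ≤ g) :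
    (∃ P : Set (ℝ × ℝ), TropicalModuli.IsLatticePolygon P ∧ TropicalModuli.IsHyperelliptic P ∧
      TropicalModuli.genus P = g ∧ TropicalModuli.HasModuliDim P d) ↔
      g ≤ d ∧ d ≤ 2 * g - 1 := by
  constructor
  · rintro ⟨P, hP, hh, hgP, ⟨T, hT, rfl⟩, -⟩
    exact TropicalModuli.coneDim_bounds hP hh hgP hg hT
  · rintro ⟨h1, h2⟩
    -- The quadrilateral with m = d - g has dimension g + m = d, and the bounds on d amount to 0 ≤ m
    -- < g.
    have hm : (0 : ℤ) ≤ d - g := by omega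
    have hmg : (d - g : ℤ) < g := by omega
    refine ⟨TropicalModuli.quadrilateral g (d - g),
      TropicalModuli.isLatticePolygon_quadrilateral hm hmg.le (by omega),
      TropicalModuli.isHyperelliptic_quadrilateral hm hmg.le,
      by exact_mod_cast TropicalModuli.genus_quadrilateral hm hmg.le,
      TropicalModuli.hasModuliDim_quadrilateral hm hmg (by omega) (by ring)⟩
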